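/- **Setting.** Let $\Gamma$ be a congruence subgroup of $\mathrm{SL}_2(\mathbb Z)$, let $\mathfrak g=\mathfrak{sl}_2(\mathbb R)$ and $K=\mathrm{SO}(2)=\{r(\theta)=\begin{pmatrix}\cos\theta&\sin\theta\\-\sin\theta&\cos\theta\end{pmatrix}\}$. In $\mathfrak g_{\mathbb C}=\mathfrak{sl}_2(\mathbb C)$ let $H=-i\begin{pmatrix}0&1\\-1&0\end{pmatrix}$, $R=\frac12\begin{pmatrix}1&i\\i&-1\end{pmatrix}$, $L=\frac12\begin{pmatrix}1&-i\\-i&-1\end{pmatrix}$. A vector $v$ of a $(\mathfrak g,K)$-module has weight $k$ if $r(\theta)v=e^{ik\theta}v$ for all $\theta$ (equivalently $Hv=kv$). Let $\mathcal A(\Gamma)$ be the space of automorphic forms on $\mathrm{SL}_2(\mathbb R)$ for $\Gamma$: smooth, left $\Gamma$-invariant, right $K$-finite, slowly increasing functions that are finite under the center of the universal enveloping algebra $\mathcal U(\mathfrak g_{\mathbb C})$; $\mathfrak g$ and $K$ act by right translation. Let $\mathcal A(\Gamma)_{\mathfrak n\text{-fin}}$ be the space of $\Phi\in\mathcal A(\Gamma)$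 with $L^v\Phi=0$ for all large $v$. For a function $\Phi$ of weight $k$, let $\tilde\Phi$ be the function on the upper half plane with $(\tilde\Phi|_kg)(i)=\Phi(g)$ for all $g\in\mathrm{SL}_2(\mathbb R)$, where $(f|_kg)(\tau)=(c\tau+d)^{-k}f\big(\frac{a\tau+b}{c\tau+d}\big)$ for $g=\begin{pmatrix}a&b\\c&d\end{pmatrix}$; explicitly $\tilde\Phi(x+iy)=y^{-k/2}\Phi\Big(\begin{pmatrix}1&x\\0&1\end{pmatrix}\begin{pmatrix}y^{1/2}&0\\0&y^{-1/2}\end{pmatrix}\Big)$. For an integer $p\ge0$ let $\mathcal D_{p,+}$ be the irreducible $(\mathfrak g,K)$-module with weights $p+1,p+3,p+5,\dots$, each of multiplicity one. Let $M_\ell(\Gamma)$ be the space of holomorphic modular forms of weight $\ell$ for $\Gamma$. Let $$E_2(\tau)=-\frac3{\pi y}+1-24\sum_{n\ge1}\sigma_1(n)e^{2\pi in\tau},\qquad \tau=x+iy,\quad \sigma_1(n)=\sum_{d\mid n}d,$$ let $\Phi_2$ be the function of weight $2$ with $\tilde\Phi_2=E_2$, and let $V_{\Phi_2}$ be the $(\mathfrak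 g,K)$-module generated by $\Phi_2$. Let $N(0)=\mathcal U(\mathfrak g_{\mathbb C})\otimes_{\mathcal U(\mathfrak b)}\mathbb C$, where $\mathfrak b=\langle H,L\rangle$ acts trivially on $\mathbb C$, and let $N(0)^\vee$ be its dual in category $\mathcal O$: the direct sum of the duals of the weight spaces of $N(0)$, with $(Xf)(v)=f(\tau(X)v)$, where $\tau$ is the anti-involution of $\mathfrak g_{\mathbb C}$ that fixes $H$ and interchanges $R$ and $L$; $r(\theta)$ acts on vectors of weight $k$ by $e^{ik\theta}$. **Proposition.** $\mathcal A(\Gamma)_{\mathfrak n\text{-fin}}$ is a $(\mathfrak g,K)$-module, and as $(\mathfrak g,K)$-modules $$\mathcal A(\Gamma)_{\mathfrak n\text{-fin}}=V_{\Phi_2}\oplus\bigoplus_{\ell=1}^\infty n_\ell\,\mathcal D_{\ell-1,+},\qquad n_\ell=\dim M_\ell(\Gamma)<\infty.$$ More precisely, $\mathcal A(\Gamma)_{\mathfrak n\text{-fin}}$ is the internal direct sum of $V_{\Phi_2}$ and of the submodules $I_\ell$ ($\ell\ge1$), where $I_\ell$ is the sum of all submodules isomorphic to $\mathcal D_{\ell-1,+}$,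 and $I_\ell$ is isomorphic to the direct sum of $n_\ell$ copies of $\mathcal D_{\ell-1,+}$. The lowest weight vectors of $I_\ell$ correspond to the elements of $M_\ell(\Gamma)$: a vector of $I_\ell$ is annihilated by $L$ if and only if it has weight $\ell$, and $\Phi\mapsto\tilde\Phi$ is a bijection from the set of these vectors (including $0$) onto $M_\ell(\Gamma)$. There is an exact sequence of $(\mathfrak g,K)$-modules $$0\longrightarrow\mathbb C\longrightarrow V_{\Phi_2}\longrightarrow\mathcal D_{1,+}\longrightarrow0,$$ where $\mathbb C$ is the trivial module, embedded as the constant functions, and this sequence does not split. Moreover, $V_{\Phi_2}\cong N(0)^\vee$ as $(\mathfrak g,K)$-modules. -/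

import Mathlib

open scoped MatrixGroups ContDiff DirectSum

noncomputable section

namespace NFin

/-! ### The Lie algebra, the maximal compact subgroup, and modules for the pair -/

/-- The complexification `𝔰𝔩₂(ℂ)` of the Lie algebra of `SL(2, ℝ)`. -/
abbrev 𝔤 : Type := LieAlgebra.SpecialLinear.sl (Fin 2) ℂ

/-- The traceless matrix `(a, b; c, -a)`. -/
def tracelessMat (a b c : ℂ) : 𝔤 :=
  ⟨!![a, b; c, -a], by
    simp [LieAlgebra.SpecialLinear.sl, Matrix.trace_fin_two]⟩

/-- `H = -i (0, 1; -1, 0)`. -/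
def H : 𝔤 := tracelessMat 0 (-Complex.I) Complex.I

/-- `R = ½ (1, i; i, -1)`. -/
def R : 𝔤 := tracelessMat (1 / 2) (Complex.I / 2) (Complex.I / 2)

/-- `L = ½ (1, -i; -i, -1)`. -/
def L : 𝔤 := tracelessMat (1 / 2) (-Complex.I / 2) (-Complex.I / 2)

/-- The coefficient of `H` of an element of `𝔰𝔩₂(ℂ)` in the basis `H, R, L`. -/
def coeffH (X : 𝔤) : ℂ := (X.1 0 1 - X.1 1 0) * Complex.I / 2

/-- The coefficient of `R` of an element of `𝔰𝔩₂(ℂ)` in the basis `H, R, L`. -/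
def coeffR (X : 𝔤) : ℂ := X.1 0 0 - (X.1 0 1 + X.1 1 0) * Complex.I / 2

/-- The coefficient of `L` of an element of `𝔰𝔩₂(ℂ)` in the basis `H, R, L`. -/
def coeffL (X : 𝔤) : ℂ := X.1 0 0 + (X.1 0 1 + X.1 1 0) * Complex.I / 2

lemma apply_one_one (X : 𝔤) : X.1 1 1 = -X.1 0 0 := by
  have h : Matrix.trace X.1 = 0 := X.2
  rw [Matrix.trace_fin_two] at h
  linear_combination h

lemma ext_of_entries {X Y : 𝔤} (h0 : X.1 0 0 = Y.1 0 0) (h1 : X.1 0 1 = Y.1 0 1)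
    (h2 : X.1 1 0 = Y.1 1 0) : X = Y := by
  apply Subtype.ext
  ext i j
  fin_cases i <;> fin_cases j
  · exact h0
  · exact h1
  · exact h2
  · have := apply_one_one X
    have := apply_one_one Y
    simp_all

lemma eq_coeff (X : 𝔤) : X = coeffH X • H + coeffR X • R + coeffL X • L := by
  apply ext_of_entries <;>
  · simp [coeffH, coeffR, coeffL, H, R, L, tracelessMat]
    ring_nf
    try simp only [Complex.I_sq]
    try ring

lemma lie_entry (X Y : 𝔤) : (⁅X, Y⁆ : 𝔤).1 = X.1 * Y.1 - Y.1 * X.1 := rfl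

lemma add_entry (X Y : 𝔤) (i j : Fin 2) : (X + Y).1 i j = X.1 i j + Y.1 i j := rfl

lemma smul_entry (c : ℂ) (X : 𝔤) (i j : Fin 2) : (c • X).1 i j = c * X.1 i j := rfl

lemma lie_H_R : ⁅H, R⁆ = (2 : ℂ) • R := by
  apply ext_of_entries <;>
  · rw [lie_entry]
    simp [H, R, tracelessMat]
    ring_nf
    try simp only [Complex.I_sq]
    try ring

lemma lie_H_L : ⁅H, L⁆ = (-2 : ℂ) • L := by
  apply ext_of_entries <;>
  · rw [lie_entry]
    simp [H, L, tracelessMat]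
    ring_nf
    try simp only [Complex.I_sq]
    try ring

lemma lie_R_L : ⁅R, L⁆ = H := by
  apply ext_of_entries <;>
  · rw [lie_entry]
    simp [H, R, L, tracelessMat]
    ring_nf
    try simp only [Complex.I_sq]
    try ring

/-- The maximal compact subgroup `SO(2)` of `SL(2, ℝ)`. -/
def K : Subgroup SL(2, ℝ) where
  carrier := {g | g.1 * g.1.transpose = 1}
  one_mem' := by simp
  mul_mem' := by
    intro a b ha hb
    rw [Set.mem_ofPred_eq] at ha hb ⊢
    rw [Matrix.SpecialLinearGroup.coe_mul, Matrix.transpose_mul, Matrix.mul_assoc,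
      ← Matrix.mul_assoc b.1, hb, Matrix.one_mul, ha]
  inv_mem' := by
    intro a ha
    rw [Set.mem_ofPred_eq] at ha ⊢
    have h : (a⁻¹).1 = a.1.transpose := by
      have h1 : (a⁻¹).1 * a.1 = 1 := by
        rw [← Matrix.SpecialLinearGroup.coe_mul, inv_mul_cancel, Matrix.SpecialLinearGroup.coe_one]
      calc (a⁻¹).1 = (a⁻¹).1 * (a.1 * a.1.transpose) := by rw [ha, Matrix.mul_one]
        _ = a.1.transpose := by rw [← Matrix.mul_assoc, h1, Matrix.one_mul]
    rw [h, Matrix.transpose_transpose]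
    exact mul_eq_one_comm.mp ha

/-- The rotation `r(θ) = (cos θ, sin θ; -sin θ, cos θ)`. -/
def rot (θ : ℝ) : K :=
  ⟨⟨!![Real.cos θ, Real.sin θ; -Real.sin θ, Real.cos θ], by
      rw [Matrix.det_fin_two_of]; nlinarith [Real.sin_sq_add_cos_sq θ]⟩, by
    change (!![Real.cos θ, Real.sin θ; -Real.sin θ, Real.cos θ] : Matrix (Fin 2) (Fin 2) ℝ) *
      (!![Real.cos θ, Real.sin θ; -Real.sin θ, Real.cos θ]).transpose = 1
    ext i j
    fin_cases i <;> fin_cases j <;>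
      simp [Matrix.mul_apply, Fin.sum_univ_two] <;> nlinarith [Real.sin_sq_add_cos_sq θ]⟩

lemma K_entries (k : K) : k.1.1 1 1 = k.1.1 0 0 ∧ k.1.1 1 0 = -k.1.1 0 1 := by
  have h : k.1.1 * k.1.1.transpose = 1 := k.2
  have hd : k.1.1.det = 1 := k.1.2
  rw [Matrix.det_fin_two] at hd
  have h00 := congrFun (congrFun h 0) 0
  have h01 := congrFun (congrFun h 0) 1
  have h11 := congrFun (congrFun h 1) 1
  simp [Matrix.mul_apply, Fin.sum_univ_two] at h00 h01 h11
  constructor <;> nlinarith [sq_nonneg (k.1.1 1 1 - k.1.1 0 0), sq_nonneg (k.1.1 1 0 + k.1.1 0 1)]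

/-- The basic character `r(θ) ↦ e^{iθ}` of `SO(2)`. -/
def chi : K →* ℂ where
  toFun k := k.1.1 0 0 + k.1.1 0 1 * Complex.I
  map_one' := by simp
  map_mul' k l := by
    obtain ⟨h1, h2⟩ := K_entries l
    simp [Matrix.mul_apply, Fin.sum_univ_two, h1, h2]
    ring_nf
    simp only [Complex.I_sq]
    ring

lemma chi_rot (θ : ℝ) : chi (rot θ) = Complex.exp (θ * Complex.I) := by
  rw [Complex.exp_mul_I]
  simp [chi, rot]

/-- The adjoint action of `SO(2)` on `𝔰𝔩₂(ℂ)`. -/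
def Ad (k : K) (X : 𝔤) : 𝔤 :=
  ⟨k.1.1.map Complex.ofReal * X.1 * (k⁻¹).1.1.map Complex.ofReal, by
    change Matrix.trace (k.1.1.map Complex.ofReal * X.1 * (k⁻¹).1.1.map Complex.ofReal) = 0
    rw [Matrix.mul_assoc, Matrix.trace_mul_comm, Matrix.mul_assoc]
    have h : (k⁻¹).1.1.map Complex.ofReal * k.1.1.map Complex.ofReal = 1 := by
      have h1 : (k⁻¹).1.1 * k.1.1 = 1 := by
        rw [← Matrix.SpecialLinearGroup.coe_mul, ← Subgroup.coe_mul, inv_mul_cancel]; simp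
      have h2 := Matrix.map_mul (L := (k⁻¹).1.1) (M := k.1.1) (f := Complex.ofRealHom)
      rw [h1] at h2
      refine h2.symm.trans ?_
      simp
    rw [h, Matrix.mul_one]
    exact X.2⟩

/-- A complex vector space with a linear action of `𝔤` also carries an action of `SO(2)`. -/
class GKRep (V : Type) [AddCommGroup V] [Module ℂ V] [LieRingModule 𝔤 V] where
  /-- The action of `SO(2)`. -/
  rho : Representation ℂ K V

section GK

variable (V : Type) [AddCommGroup V] [Module ℂ V] [LieRingModule 𝔤 V] [LieModule ℂ 𝔤 V] [GKRep V]

/-- The vectors of weight `m`: those with `r(θ) v = e^{imθ} v` for all `θ`. -/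
def weightSpace (m : ℤ) : Submodule ℂ V where
  carrier := {v | ∀ θ : ℝ, GKRep.rho (rot θ) v = Complex.exp (m * θ * Complex.I) • v}
  add_mem' := by
    intro a b ha hb θ
    rw [map_add, ha, hb, smul_add]
  zero_mem' := by intro θ; simp
  smul_mem' := by
    intro c v hv θ
    rw [map_smul, hv, smul_comm]

/-- The axioms of a `(𝔤, K)`-module for `K = SO(2)`: compatibility of the two actions with the
adjoint action, local finiteness and continuity of the action of `K` (that is, `V` is the sum of
its weight spaces), and the requirement that the derivative of the action of `K` is the action of
its Lie algebra, which is spanned by `iH`. -/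
structure IsGKModule : Prop where
  rho_lie : ∀ (k : K) (X : 𝔤) (v : V), GKRep.rho k ⁅X, v⁆ = ⁅Ad k X, GKRep.rho k v⁆
  iSup_weightSpace : ⨆ m : ℤ, weightSpace V m = ⊤
  lie_H : ∀ (m : ℤ), ∀ v ∈ weightSpace V m, ⁅H, v⁆ = (m : ℂ) • v

/-- A subspace that is stable under `𝔤` and `K`. -/
structure GKSubmodule extends LieSubmodule ℂ 𝔤 V where
  rho_mem : ∀ (k : K) {v : V}, v ∈ carrier → GKRep.rho k v ∈ carrier

variable {V}

instance (N : GKSubmodule V) : GKRep N.toLieSubmodule where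
  rho :=
    { toFun := fun k => (GKRep.rho (V := V) k).restrict (p := N.toSubmodule) (q := N.toSubmodule)
        (fun _ hv => N.rho_mem k hv)
      map_one' := by
        ext v
        change ((GKRep.rho (V := V) 1) v.1 : V) = v.1
        simp
      map_mul' := by
        intro k l
        ext v
        change ((GKRep.rho (V := V) (k * l)) v.1 : V) = GKRep.rho k (GKRep.rho l v.1)
        simp }

/-- The sum of a family of stable subspaces. -/
def GKSubmodule.sum {ι : Type} (N : ι → GKSubmodule V) : GKSubmodule V where
  toSubmodule := ⨆ i, (N i).toSubmodule
  lie_mem := by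
    intro X v hv
    change v ∈ ⨆ i, (N i).toSubmodule at hv
    change ⁅X, v⁆ ∈ ⨆ i, (N i).toSubmodule
    have : (⨆ i, (N i).toSubmodule) ≤
        (⨆ i, (N i).toSubmodule).comap (LieModule.toEnd ℂ 𝔤 V X) :=
      iSup_le fun i w hw => Submodule.mem_iSup_of_mem i ((N i).lie_mem hw)
    exact this hv
  rho_mem := by
    intro k v hv
    change v ∈ ⨆ i, (N i).toSubmodule at hv
    change GKRep.rho k v ∈ ⨆ i, (N i).toSubmodule
    have : (⨆ i, (N i).toSubmodule) ≤ (⨆ i, (N i).toSubmodule).comap (GKRep.rho k) :=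
      iSup_le fun i w hw => Submodule.mem_iSup_of_mem i ((N i).rho_mem k hw)
    exact this hv

/-- The stable subspace generated by a set. -/
def GKSubmodule.generatedBy (s : Set V) : GKSubmodule V where
  carrier := {v | ∀ N : GKSubmodule V, s ⊆ N.carrier → v ∈ N.carrier}
  add_mem' := fun ha hb N hN => N.add_mem' (ha N hN) (hb N hN)
  zero_mem' := fun N _ => N.zero_mem'
  smul_mem' := fun c _ hv N hN => N.smul_mem' c (hv N hN)
  lie_mem := fun hv N hN => N.lie_mem (hv N hN)
  rho_mem := fun k _ hv N hN => N.rho_mem k (hv N hN)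

end GK

/-- Linear maps that commute with `𝔤` and `K`. -/
structure GKHom (V W : Type) [AddCommGroup V] [Module ℂ V] [LieRingModule 𝔤 V] [GKRep V]
    [AddCommGroup W] [Module ℂ W] [LieRingModule 𝔤 W] [GKRep W] extends V →ₗ⁅ℂ, 𝔤⁆ W where
  map_rho : ∀ (k : K) (v : V), toFun (GKRep.rho k v) = GKRep.rho k (toFun v)

/-- `V` and `W` are isomorphic, compatibly with the actions of `𝔤` and `K`. -/
def GKIsomorphic (V W : Type) [AddCommGroup V] [Module ℂ V] [LieRingModule 𝔤 V] [GKRep V]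
    [AddCommGroup W] [Module ℂ W] [LieRingModule 𝔤 W] [GKRep W] : Prop :=
  ∃ T : GKHom V W, Function.Bijective T.toLieModuleHom

/-- `V` is irreducible: it is non-zero, and `0` and `V` are its only stable subspaces. -/
def IsIrreducible (V : Type) [AddCommGroup V] [Module ℂ V] [LieRingModule 𝔤 V]
    [LieModule ℂ 𝔤 V] [GKRep V] : Prop :=
  Nontrivial V ∧ ∀ N : GKSubmodule V, N.toSubmodule = ⊥ ∨ N.toSubmodule = ⊤

instance (ι : Type) (V : ι → Type) [∀ i, AddCommGroup (V i)] [∀ i, Module ℂ (V i)]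
    [∀ i, LieRingModule 𝔤 (V i)] [∀ i, LieModule ℂ 𝔤 (V i)] [∀ i, GKRep (V i)] :
    GKRep (⨁ i, V i) where
  rho :=
    { toFun := fun k => DirectSum.lmap fun i => GKRep.rho (V := V i) k
      map_one' := by
        refine LinearMap.ext fun v => DFinsupp.ext fun i => ?_
        exact congrArg (fun f => f (v i)) (map_one (GKRep.rho (V := V i)))
      map_mul' := by
        intro k l
        refine LinearMap.ext fun v => DFinsupp.ext fun i => ?_
        exact congrArg (fun f => f (v i)) (map_mul (GKRep.rho (V := V i)) k l) }

/-- The sum of all stable subspaces of `A` that are isomorphic to `D`. -/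
def isotypic {V : Type} [AddCommGroup V] [Module ℂ V] [LieRingModule 𝔤 V] [LieModule ℂ 𝔤 V]
    [GKRep V] (A : GKSubmodule V) (D : Type) [AddCommGroup D] [Module ℂ D] [LieRingModule 𝔤 D]
    [GKRep D] : GKSubmodule V :=
  GKSubmodule.sum fun N : {N : GKSubmodule V //
    N.toSubmodule ≤ A.toSubmodule ∧ GKIsomorphic D N.toLieSubmodule} => N.1

/-- The trivial one-dimensional module. -/
abbrev Triv : Type := TrivialLieModule ℂ 𝔤 ℂ

instance : GKRep Triv where
  rho := Representation.trivial ℂ K Triv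

end NFin

namespace NFin

/-! ### The modules `D_{p,+}` -/

/-- The underlying space of `D_{p,+}`; the basis vector `single j 1` has weight `p + 1 + 2 j`. -/
def DPlus (_p : ℕ) : Type := ℕ →₀ ℂ

namespace DPlus

variable (p : ℕ)

instance : AddCommGroup (DPlus p) := inferInstanceAs (AddCommGroup (ℕ →₀ ℂ))
instance : Module ℂ (DPlus p) := inferInstanceAs (Module ℂ (ℕ →₀ ℂ))

/-- The basis vector of weight `p + 1 + 2 j`. -/
def e (j : ℕ) : DPlus p := Finsupp.single j (1 : ℂ)

lemma hom_ext {W : Type} [AddCommGroup W] [Module ℂ W] {f g : DPlus p →ₗ[ℂ] W}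
    (h : ∀ j, f (e p j) = g (e p j)) : f = g :=
  Finsupp.lhom_ext' (M := ℂ) (R := ℂ) fun j => LinearMap.ext_ring (h j)

/-- The linear map with prescribed values on the basis. -/
def lin (w : ℕ → DPlus p) : DPlus p →ₗ[ℂ] DPlus p := Finsupp.linearCombination ℂ w

lemma lin_e (w : ℕ → DPlus p) (j : ℕ) : lin p w (e p j) = w j :=
  (Finsupp.linearCombination_single ℂ (1 : ℂ) j).trans (one_smul ℂ _)

/-- `H e_j = (p + 1 + 2 j) e_j`. -/
def opH : DPlus p →ₗ[ℂ] DPlus p := lin p fun j => ((p : ℂ) + 1 + 2 * j) • e p j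

/-- `R e_j = e_{j+1}`. -/
def opR : DPlus p →ₗ[ℂ] DPlus p := lin p fun j => e p (j + 1)

/-- `L e_j = -j (p + j) e_{j-1}`. -/
def opL : DPlus p →ₗ[ℂ] DPlus p := lin p fun j => (-(j : ℂ) * (p + j)) • e p (j - 1)

lemma HR : opH p ∘ₗ opR p = opR p ∘ₗ opH p + (2 : ℂ) • opR p := by
  apply hom_ext
  intro j
  simp only [LinearMap.comp_apply, LinearMap.add_apply, LinearMap.smul_apply, opH, opR, lin_e,
    map_smul]
  push_cast
  module

lemma HL : opH p ∘ₗ opL p = opL p ∘ₗ opH p - (2 : ℂ) • opL p := by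
  apply hom_ext
  intro j
  simp only [LinearMap.comp_apply, LinearMap.sub_apply, LinearMap.smul_apply, opH, opL, lin_e,
    map_smul]
  rcases j with _ | j
  · simp
  · push_cast
    module

lemma RL : opR p ∘ₗ opL p = opL p ∘ₗ opR p + opH p := by
  apply hom_ext
  intro j
  simp only [LinearMap.comp_apply, LinearMap.add_apply, opH, opR, opL, lin_e, map_smul]
  rcases j with _ | j
  · simp
    module
  · push_cast
    module

/-- The action of `X = a H + b R + c L`. -/
def op (X : 𝔤) : DPlus p →ₗ[ℂ] DPlus p := coeffH X • opH p + coeffR X • opR p + coeffL X • opL p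

instance : LieRingModule 𝔤 (DPlus p) where
  bracket X v := op p X v
  add_lie X Y v := by
    change op p (X + Y) v = op p X v + op p Y v
    simp only [op, coeffH, coeffR, coeffL, LinearMap.add_apply, LinearMap.smul_apply,
      add_entry]
    module
  lie_add X v w := map_add (op p X) v w
  leibniz_lie X Y v := by
    change op p X (op p Y v) = op p ⁅X, Y⁆ v + op p Y (op p X v)
    have h1 : opH p (opR p v) = opR p (opH p v) + (2 : ℂ) • opR p v :=
      LinearMap.congr_fun (HR p) v
    have h2 : opH p (opL p v) = opL p (opH p v) - (2 : ℂ) • opL p v :=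
      LinearMap.congr_fun (HL p) v
    have h3 : opR p (opL p v) = opL p (opR p v) + opH p v := LinearMap.congr_fun (RL p) v
    have hH : coeffH ⁅X, Y⁆ = coeffR X * coeffL Y - coeffL X * coeffR Y := by
      simp only [coeffH, coeffR, coeffL, lie_entry, Matrix.sub_apply, Matrix.mul_apply,
        Fin.sum_univ_two, apply_one_one]
      ring_nf
    have hR : coeffR ⁅X, Y⁆ = 2 * (coeffH X * coeffR Y - coeffR X * coeffH Y) := by
      simp only [coeffH, coeffR, lie_entry, Matrix.sub_apply, Matrix.mul_apply,
        Fin.sum_univ_two, apply_one_one]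
      ring_nf
      simp only [Complex.I_sq]
      ring
    have hL : coeffL ⁅X, Y⁆ = -2 * (coeffH X * coeffL Y - coeffL X * coeffH Y) := by
      simp only [coeffH, coeffL, lie_entry, Matrix.sub_apply, Matrix.mul_apply,
        Fin.sum_univ_two, apply_one_one]
      ring_nf
      simp only [Complex.I_sq]
      ring
    simp only [op, LinearMap.add_apply, LinearMap.smul_apply, map_add, map_smul, h1, h2, h3, hH,
      hR, hL]
    module

instance : LieModule ℂ 𝔤 (DPlus p) where
  smul_lie t X v := by
    change op p (t • X) v = t • op p X v
    simp only [op, coeffH, coeffR, coeffL, LinearMap.add_apply, LinearMap.smul_apply,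
      smul_entry]
    module
  lie_smul t X v := map_smul (op p X) t v

/-- `r(θ)` multiplies the basis vector of weight `m` by `e^{imθ}`. -/
instance : GKRep (DPlus p) where
  rho :=
    { toFun := fun k => lin p fun j => (chi k ^ (p + 1 + 2 * j)) • e p j
      map_one' := by
        apply hom_ext
        intro j
        simp [lin_e]
      map_mul' := by
        intro k l
        apply hom_ext
        intro j
        simp only [lin_e, Module.End.mul_apply, map_mul, map_smul, smul_smul]
        rw [mul_pow, mul_comm] }

lemma rho_e (k : K) (j : ℕ) :
    GKRep.rho k (e p j) = (chi k ^ (p + 1 + 2 * j)) • e p j := lin_e p _ j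

lemma lie_H_eq (v : DPlus p) : ⁅H, v⁆ = opH p v := by
  have : coeffH H = 1 ∧ coeffR H = 0 ∧ coeffL H = 0 := by
    refine ⟨?_, ?_, ?_⟩ <;> simp [coeffH, coeffR, coeffL, H, tracelessMat]
    ring_nf
    simp
  change op p H v = _
  simp [op, this]

lemma lie_R_eq (v : DPlus p) : ⁅R, v⁆ = opR p v := by
  have : coeffH R = 0 ∧ coeffR R = 1 ∧ coeffL R = 0 := by
    refine ⟨?_, ?_, ?_⟩ <;> simp [coeffH, coeffR, coeffL, R, tracelessMat] <;> ring_nf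
  change op p R v = _
  simp [op, this]

lemma lie_L_eq (v : DPlus p) : ⁅L, v⁆ = opL p v := by
  have : coeffH L = 0 ∧ coeffR L = 0 ∧ coeffL L = 1 := by
    refine ⟨?_, ?_, ?_⟩ <;> simp [coeffH, coeffR, coeffL, L, tracelessMat]
    ring_nf
  change op p L v = _
  simp [op, this]

lemma e_mem_weightSpace (j : ℕ) : e p j ∈ weightSpace (DPlus p) (p + 1 + 2 * j : ℕ) := by
  intro θ
  rw [rho_e, chi_rot, ← Complex.exp_nat_mul]
  congr 2
  push_cast
  ring

/-- The `j`-th coordinate. -/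
def coord (j : ℕ) : DPlus p →ₗ[ℂ] ℂ := Finsupp.lapply (M := ℂ) (R := ℂ) j

lemma coord_e (i j : ℕ) : coord p j (e p i) = if i = j then 1 else 0 :=
  Finsupp.single_apply

lemma ext_coord {v w : DPlus p} (h : ∀ j, coord p j v = coord p j w) : v = w :=
  Finsupp.ext h

lemma coord_rho (k : K) (v : DPlus p) (j : ℕ) :
    coord p j (GKRep.rho k v) = chi k ^ (p + 1 + 2 * j) * coord p j v := by
  have : coord p j ∘ₗ (GKRep.rho (V := DPlus p) k) = chi k ^ (p + 1 + 2 * j) • coord p j := by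
    apply hom_ext
    intro i
    rw [LinearMap.comp_apply, rho_e, map_smul, LinearMap.smul_apply, coord_e]
    by_cases h : i = j <;> simp [h]
  exact LinearMap.congr_fun this v

lemma coord_L (v : DPlus p) (j : ℕ) :
    coord p j ⁅L, v⁆ = -((j : ℂ) + 1) * (p + (j + 1)) * coord p (j + 1) v := by
  rw [lie_L_eq]
  have : coord p j ∘ₗ opL p = (-((j : ℂ) + 1) * (p + (j + 1))) • coord p (j + 1) := by
    apply hom_ext
    intro i
    rw [LinearMap.comp_apply, opL, lin_e, map_smul, LinearMap.smul_apply, coord_e, coord_e]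
    rcases i with _ | i
    · simp
    · by_cases h : i = j <;> simp [h]
  exact LinearMap.congr_fun this v

/-- The weights of `D_{p,+}` are `p + 1, p + 3, p + 5, …`, each with multiplicity one: the space
of vectors of weight `m` is spanned by the basis vector with `p + 1 + 2 j = m`, if any. -/
lemma mem_weightSpace_iff (m : ℤ) (v : DPlus p) :
    v ∈ weightSpace (DPlus p) m ↔ ∀ j : ℕ, coord p j v ≠ 0 → m = p + 1 + 2 * j := by
  have key : ∀ (θ : ℝ) (j : ℕ), coord p j (GKRep.rho (rot θ) v) =
      Complex.exp ((p + 1 + 2 * j : ℤ) * θ * Complex.I) * coord p j v := by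
    intro θ j
    rw [coord_rho, chi_rot, ← Complex.exp_nat_mul]
    push_cast
    ring_nf
  constructor
  · intro h j hj
    have h1 := congrArg (coord p j) (h 1)
    rw [key, map_smul, smul_eq_mul] at h1
    have h2 := mul_right_cancel₀ hj h1
    rw [Complex.exp_eq_exp_iff_exists_int] at h2
    obtain ⟨n, hn⟩ := h2
    have h4 : ((p + 1 + 2 * j : ℤ) : ℝ) = m + n * (2 * Real.pi) := by
      have := congrArg Complex.im hn
      simpa using this
    by_cases hn0 : n = 0
    · subst hn0
      simp only [Int.cast_zero, zero_mul, add_zero] at h4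
      exact_mod_cast h4.symm
    · exfalso
      have hn' : (n : ℝ) ≠ 0 := by
        simpa using hn0
      apply irrational_pi
      refine ⟨((p + 1 + 2 * j : ℤ) - m : ℚ) / (2 * n), ?_⟩
      push_cast at h4 ⊢
      field_simp
      linarith
  · intro h θ
    apply ext_coord
    intro j
    rw [key, map_smul, smul_eq_mul]
    by_cases hj : coord p j v = 0
    · rw [hj, mul_zero, mul_zero]
    · rw [h j hj]

/-- `D_{p,+}` is irreducible. -/
lemma irreducible : IsIrreducible (DPlus p) := by
  have he : ∀ j, e p j ≠ 0 := by
    intro j h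
    have := coord_e p j j
    rw [h, map_zero] at this
    simp at this
  refine ⟨⟨e p 0, 0, he 0⟩, fun N => ?_⟩
  by_cases hN : N.toSubmodule = ⊥
  · exact Or.inl hN
  right
  obtain ⟨v, hvN, hv⟩ := Submodule.exists_mem_ne_zero_of_ne_bot hN
  have step : ∀ (d : ℕ) (v : DPlus p), v ∈ N.toSubmodule → v ≠ 0 →
      (∀ j, d < j → coord p j v = 0) → e p 0 ∈ N.toSubmodule := by
    intro d
    induction d with
    | zero =>
      intro v hvN hv h
      have h1 : v = coord p 0 v • e p 0 := by
        apply ext_coord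
        intro j
        rw [map_smul, coord_e]
        rcases j with _ | j
        · simp
        · rw [h _ (Nat.succ_pos j)]; simp
      have h2 : coord p 0 v ≠ 0 := fun h3 => hv (by rw [h1, h3, zero_smul])
      have h3 : e p 0 = (coord p 0 v)⁻¹ • v := by
        nth_rewrite 2 [h1]
        rw [smul_smul, inv_mul_cancel₀ h2, one_smul]
      rw [h3]
      exact Submodule.smul_mem _ _ hvN
    | succ d ih =>
      intro v hvN hv h
      by_cases hd : coord p (d + 1) v = 0
      · refine ih v hvN hv fun j hj => ?_
        rcases Nat.lt_or_ge (d + 1) j with h1 | h1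
        · exact h j h1
        · rw [show j = d + 1 by omega, hd]
      · refine ih ⁅L, v⁆ (N.lie_mem hvN) (fun h0 => hd ?_) fun j hj => ?_
        · have h1 := coord_L p v d
          rw [h0, map_zero] at h1
          have h2 : -((d : ℂ) + 1) * (p + (d + 1)) ≠ 0 := by
            refine mul_ne_zero (neg_ne_zero.mpr (by exact_mod_cast Nat.succ_ne_zero d)) ?_
            exact_mod_cast Nat.succ_ne_zero (p + d)
          exact (mul_eq_zero.mp h1.symm).resolve_left h2
        · rw [coord_L, h (j + 1) (by omega), mul_zero]
  have h0 : e p 0 ∈ N.toSubmodule := by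
    obtain ⟨d, hd⟩ : ∃ d, ∀ j, d < j → coord p j v = 0 := by
      let s : Finset ℕ := Finsupp.support (show ℕ →₀ ℂ from v)
      refine ⟨s.sup id, fun j hj => ?_⟩
      by_contra hne
      have : j ∈ s := Finsupp.mem_support_iff.mpr hne
      exact absurd (Finset.le_sup (f := id) this) (not_le.mpr hj)
    exact step d v hvN hv hd
  have hall : ∀ j, e p j ∈ N.toSubmodule := by
    intro j
    induction j with
    | zero => exact h0
    | succ j ih =>
      have : ⁅R, e p j⁆ = e p (j + 1) := by rw [lie_R_eq, opR, lin_e]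
      rw [← this]
      exact N.lie_mem ih
  rw [eq_top_iff]
  intro w _
  have : N.toSubmodule.mkQ = 0 := hom_ext p fun j => by
    rw [LinearMap.zero_apply]
    exact (Submodule.Quotient.mk_eq_zero _).mpr (hall j)
  exact (Submodule.Quotient.mk_eq_zero _).mp (LinearMap.congr_fun this w)

lemma K_relation (k : K) : k.1.1 0 0 ^ 2 + k.1.1 0 1 ^ 2 = 1 := by
  have h : k.1.1 * k.1.1.transpose = 1 := k.2
  have h00 := congrFun (congrFun h 0) 0
  simp [Matrix.mul_apply, Fin.sum_univ_two] at h00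
  nlinarith

lemma Ad_coeff (k : K) (X : 𝔤) : coeffH (Ad k X) = coeffH X ∧
    coeffR (Ad k X) = chi k ^ 2 * coeffR X ∧ chi k ^ 2 * coeffL (Ad k X) = coeffL X := by
  obtain ⟨h1, h2⟩ := K_entries k
  have hr : ((k.1.1 0 0 : ℝ) : ℂ) ^ 2 + ((k.1.1 0 1 : ℝ) : ℂ) ^ 2 = 1 := by
    exact_mod_cast K_relation k
  have hinv : (k⁻¹).1.1 = !![k.1.1 0 0, -k.1.1 0 1; k.1.1 0 1, k.1.1 0 0] := by
    change (k.1⁻¹ : SL(2, ℝ)).1 = _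
    rw [Matrix.SpecialLinearGroup.SL2_inv_expl]
    change !![k.1.1 1 1, -k.1.1 0 1; -k.1.1 1 0, k.1.1 0 0] = _
    rw [h1, h2, neg_neg]
  have hk : k.1.1 = !![k.1.1 0 0, k.1.1 0 1; -k.1.1 0 1, k.1.1 0 0] := by
    nth_rewrite 1 [Matrix.eta_fin_two k.1.1]
    rw [h1, h2]
  have hchi : chi k = (k.1.1 0 0 : ℂ) + k.1.1 0 1 * Complex.I := rfl
  have hAd : (Ad k X).1 = k.1.1.map Complex.ofReal * X.1 * (k⁻¹).1.1.map Complex.ofReal := rfl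
  generalize hC : k.1.1 0 0 = C at *
  generalize hS : k.1.1 0 1 = S at *
  have hI := Complex.I_sq
  simp only [coeffH, coeffR, coeffL, hAd, hk, hinv, hchi, Matrix.mul_apply, Fin.sum_univ_two,
    Matrix.map_apply, Matrix.of_apply, Matrix.cons_val', Matrix.cons_val_zero, Matrix.cons_val_one,
    Matrix.cons_val_fin_one, apply_one_one, Complex.ofReal_neg]
  generalize X.1 0 0 = a
  generalize X.1 0 1 = b
  generalize X.1 1 0 = c
  have hS2 : (S : ℂ) ^ 2 = 1 - (C : ℂ) ^ 2 := by linear_combination hr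
  refine ⟨?_, ?_, ?_⟩
  · linear_combination (b - c) * Complex.I / 2 * hr
  · grind
  · grind

/-- `D_{p,+}` is a `(𝔤, K)`-module. -/
lemma isGKModule : IsGKModule (DPlus p) where
  rho_lie k X v := by
    obtain ⟨h1, h2, h3⟩ := Ad_coeff k X
    apply ext_coord
    intro j
    rw [coord_rho]
    have hR : ∀ (w : DPlus p) (j : ℕ), coord p j (opR p w) =
        if j = 0 then 0 else coord p (j - 1) w := by
      intro w j
      rcases j with _ | j
      · have : coord p 0 ∘ₗ opR p = 0 := hom_ext p fun i => by
          rw [LinearMap.comp_apply, opR, lin_e, coord_e]; simp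
        exact LinearMap.congr_fun this w
      · have : coord p (j + 1) ∘ₗ opR p = coord p j := hom_ext p fun i => by
          rw [LinearMap.comp_apply, opR, lin_e, coord_e, coord_e]; simp
        exact LinearMap.congr_fun this w
    have hH : ∀ (w : DPlus p) (j : ℕ), coord p j (opH p w) = (p + 1 + 2 * j) * coord p j w := by
      intro w j
      have : coord p j ∘ₗ opH p = ((p : ℂ) + 1 + 2 * j) • coord p j := hom_ext p fun i => by
        rw [LinearMap.comp_apply, opH, lin_e, map_smul, LinearMap.smul_apply, coord_e]
        by_cases h : i = j <;> simp [h]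
      exact LinearMap.congr_fun this w
    have hL : ∀ (w : DPlus p) (j : ℕ), coord p j (opL p w) =
        -((j : ℂ) + 1) * (p + (j + 1)) * coord p (j + 1) w := by
      intro w j
      rw [← lie_L_eq, coord_L]
    change _ * coord p j (op p X v) = coord p j (op p (Ad k X) (GKRep.rho k v))
    simp only [op, LinearMap.add_apply, LinearMap.smul_apply, map_add, map_smul, hR, hH, hL,
      smul_eq_mul, coord_rho, h1, h2]
    rw [← h3]
    rcases j with _ | j
    · simp only [if_true]; ring
    · simp only [Nat.succ_ne_zero, if_false, Nat.add_sub_cancel]; ring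
  iSup_weightSpace := by
    rw [eq_top_iff]
    intro w _
    have : (⨆ m : ℤ, weightSpace (DPlus p) m).mkQ = 0 := hom_ext p fun j => by
      rw [LinearMap.zero_apply]
      exact (Submodule.Quotient.mk_eq_zero _).mpr
        (Submodule.mem_iSup_of_mem _ (e_mem_weightSpace p j))
    exact (Submodule.Quotient.mk_eq_zero _).mp (LinearMap.congr_fun this w)
  lie_H m v hv := by
    rw [mem_weightSpace_iff] at hv
    rw [lie_H_eq]
    apply ext_coord
    intro j
    have : coord p j ∘ₗ opH p = ((p : ℂ) + 1 + 2 * j) • coord p j := hom_ext p fun i => by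
      rw [LinearMap.comp_apply, opH, lin_e, map_smul, LinearMap.smul_apply, coord_e]
      by_cases h : i = j <;> simp [h]
    have h2 : coord p j (opH p v) = ((p : ℂ) + 1 + 2 * j) * coord p j v :=
      LinearMap.congr_fun this v
    rw [h2, map_smul, smul_eq_mul]
    by_cases hj : coord p j v = 0
    · rw [hj, mul_zero, mul_zero]
    · rw [hv j hj]; push_cast; ring

end DPlus

end NFin

namespace NFin

/-! ### Verma modules and duality -/

/-- The universal enveloping algebra of `𝔤`. -/
abbrev U : Type := UniversalEnvelopingAlgebra ℂ 𝔤

/-- The inclusion of `𝔤` into its universal enveloping algebra. -/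
abbrev toU (X : 𝔤) : U := UniversalEnvelopingAlgebra.ι ℂ X

lemma toU_lie (X Y : 𝔤) : toU ⁅X, Y⁆ = toU X * toU Y - toU Y * toU X := by
  let _ : LieRing U := LieRing.ofAssociativeRing
  exact LieHom.map_lie _ _ _

/-- The left ideal generated by `L` and `H - c`. -/
def vermaIdeal (c : ℂ) : Submodule U U := Submodule.span U {toU L, toU H - algebraMap ℂ U c}

/-- The Verma module `N(c) = U(𝔤) ⊗_{U(𝔟)} ℂ_c` for `𝔟 = ⟨H, L⟩`, where `H` acts on `ℂ_c` by `c`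
and `L` acts by `0`. It is the quotient of `U(𝔤)` by the left ideal generated by `L` and `H - c`. -/
def Verma (c : ℂ) : Type := U ⧸ vermaIdeal c

namespace Verma

variable (c : ℂ)

instance : AddCommGroup (Verma c) := inferInstanceAs (AddCommGroup (U ⧸ vermaIdeal c))
instance : Module U (Verma c) := inferInstanceAs (Module U (U ⧸ vermaIdeal c))
instance : Module ℂ (Verma c) := inferInstanceAs (Module ℂ (U ⧸ vermaIdeal c))
instance : IsScalarTower ℂ U (Verma c) := inferInstanceAs (IsScalarTower ℂ U (U ⧸ vermaIdeal c))

instance : LieRingModule 𝔤 (Verma c) where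
  bracket X v := toU X • v
  add_lie X Y v := by
    change toU (X + Y) • v = toU X • v + toU Y • v
    rw [toU, map_add, add_smul]
  lie_add X v w := smul_add (toU X) v w
  leibniz_lie X Y v := by
    change toU X • toU Y • v = toU ⁅X, Y⁆ • v + toU Y • toU X • v
    rw [toU_lie, sub_smul, mul_smul, mul_smul, sub_add_cancel]

instance : LieModule ℂ 𝔤 (Verma c) where
  smul_lie t X v := by
    change toU (t • X) • v = t • toU X • v
    rw [toU, map_smul, smul_assoc]
  lie_smul t X v := by
    change toU X • t • v = t • toU X • v
    rw [← algebraMap_smul U t v, ← mul_smul, ← Algebra.commutes, mul_smul, algebraMap_smul]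

end Verma

/-- The anti-involution of `𝔤` that fixes `H` and interchanges `R` and `L`. -/
def tau (X : 𝔤) : 𝔤 := tracelessMat (X.1 0 0) (-X.1 1 0) (-X.1 0 1)

lemma tau_H : tau H = H := by
  apply ext_of_entries <;> simp [tau, H, tracelessMat]

lemma tau_R : tau R = L := by
  apply ext_of_entries <;> simp [tau, R, L, tracelessMat] <;> ring

lemma tau_L : tau L = R := by
  apply ext_of_entries <;> simp [tau, R, L, tracelessMat] <;> ring

lemma tau_tau (X : 𝔤) : tau (tau X) = X := by
  apply ext_of_entries <;> simp [tau, tracelessMat]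

lemma tau_add (X Y : 𝔤) : tau (X + Y) = tau X + tau Y := by
  apply ext_of_entries <;> simp [tau, tracelessMat, add_entry] <;> ring

lemma tau_smul (t : ℂ) (X : 𝔤) : tau (t • X) = t • tau X := by
  apply ext_of_entries <;> simp [tau, tracelessMat, smul_entry]

lemma tau_lie (X Y : 𝔤) : tau ⁅X, Y⁆ = ⁅tau Y, tau X⁆ := by
  have h1 : ∀ Z : 𝔤, (tau Z).1 0 0 = Z.1 0 0 := fun Z => rfl
  have h2 : ∀ Z : 𝔤, (tau Z).1 0 1 = -Z.1 1 0 := fun Z => rfl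
  have h3 : ∀ Z : 𝔤, (tau Z).1 1 0 = -Z.1 0 1 := fun Z => rfl
  apply ext_of_entries <;>
  · simp only [h1, h2, h3, lie_entry, Matrix.sub_apply, Matrix.mul_apply, Fin.sum_univ_two,
      apply_one_one]
    ring

/-- The full linear dual of a `𝔤`-module, with `X` acting by `(X f)(v) = f(τ(X) v)`. -/
def FullDual (V : Type) [AddCommGroup V] [Module ℂ V] : Type := Module.Dual ℂ V

/-- The functional underlying an element of `FullDual V`. -/
def FullDual.toDual {V : Type} [AddCommGroup V] [Module ℂ V] (f : FullDual V) : Module.Dual ℂ V := f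

section Dual

variable (V : Type) [AddCommGroup V] [Module ℂ V] [LieRingModule 𝔤 V] [LieModule ℂ 𝔤 V]

instance : AddCommGroup (FullDual V) := inferInstanceAs (AddCommGroup (Module.Dual ℂ V))
instance : Module ℂ (FullDual V) := inferInstanceAs (Module ℂ (Module.Dual ℂ V))

instance : LieRingModule 𝔤 (FullDual V) where
  bracket X f := LinearMap.comp f.toDual (LieModule.toEnd ℂ 𝔤 V (tau X))
  add_lie X Y f := by
    refine LinearMap.ext fun v => ?_
    change f.toDual ⁅tau (X + Y), v⁆ =
      f.toDual ⁅tau X, v⁆ + f.toDual ⁅tau Y, v⁆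
    rw [tau_add, add_lie, map_add]
  lie_add X f g := LinearMap.ext fun v => rfl
  leibniz_lie X Y f := by
    refine LinearMap.ext fun v => ?_
    change f.toDual ⁅tau Y, ⁅tau X, v⁆⁆ =
      f.toDual ⁅tau ⁅X, Y⁆, v⁆ +
        f.toDual ⁅tau X, ⁅tau Y, v⁆⁆
    rw [tau_lie, ← map_add, lie_lie, sub_add_cancel]

instance : LieModule ℂ 𝔤 (FullDual V) where
  smul_lie t X f := by
    refine LinearMap.ext fun v => ?_
    change f.toDual ⁅tau (t • X), v⁆ =
      t • f.toDual ⁅tau X, v⁆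
    rw [tau_smul, smul_lie, map_smul]
  lie_smul t X f := LinearMap.ext fun v => rfl

variable {V} in
lemma FullDual.lie_apply (X : 𝔤) (f : FullDual V) (v : V) :
    (⁅X, f⁆ : FullDual V).toDual v = f.toDual ⁅tau X, v⁆ := rfl

/-- The eigenspace of `H` for the integer `m`. -/
def eigenH (m : ℤ) : Submodule ℂ V := (LieModule.toEnd ℂ 𝔤 V H).eigenspace (m : ℂ)

variable {V} in
lemma mem_eigenH {m : ℤ} {v : V} : v ∈ eigenH V m ↔ ⁅H, v⁆ = (m : ℂ) • v :=
  Module.End.mem_eigenspace_iff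

/-- The sum of the eigenspaces of `H` for integral eigenvalues. -/
def weightPart : LieSubmodule ℂ 𝔤 V where
  toSubmodule := ⨆ m : ℤ, eigenH V m
  lie_mem := by
    intro X v hv
    change v ∈ ⨆ m : ℤ, eigenH V m at hv
    change ⁅X, v⁆ ∈ ⨆ m : ℤ, eigenH V m
    suffices h : (⨆ m : ℤ, eigenH V m) ≤
        (⨆ m : ℤ, eigenH V m).comap (LieModule.toEnd ℂ 𝔤 V X) from h hv
    refine iSup_le fun m w hw => ?_
    have hw' := mem_eigenH.mp hw
    change ⁅X, w⁆ ∈ ⨆ m : ℤ, eigenH V m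
    rw [eq_coeff X, add_lie, add_lie, smul_lie, smul_lie, smul_lie]
    refine add_mem (add_mem ?_ ?_) ?_
    · rw [hw']
      exact Submodule.smul_mem _ _ (Submodule.smul_mem _ _ (Submodule.mem_iSup_of_mem m hw))
    · refine Submodule.smul_mem _ _ (Submodule.mem_iSup_of_mem (m + 2) (mem_eigenH.mpr ?_))
      rw [leibniz_lie, hw', lie_H_R, smul_lie, lie_smul]
      push_cast
      module
    · refine Submodule.smul_mem _ _ (Submodule.mem_iSup_of_mem (m - 2) (mem_eigenH.mpr ?_))
      rw [leibniz_lie, hw', lie_H_L, smul_lie, lie_smul]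
      push_cast
      module

lemma iSup_eigenH_weightPart : ⨆ m : ℤ, eigenH (weightPart V) m = ⊤ := by
  have hinj : Function.Injective (weightPart V).toSubmodule.subtype := Subtype.val_injective
  apply Submodule.map_injective_of_injective hinj
  rw [Submodule.map_iSup, Submodule.map_subtype_top]
  refine le_antisymm (iSup_le fun m => ?_) (iSup_le fun m => ?_)
  · rintro _ ⟨w, -, rfl⟩
    exact w.2
  · refine le_trans ?_ (le_iSup _ m)
    intro w hw
    refine ⟨⟨w, Submodule.mem_iSup_of_mem m hw⟩,
      (mem_eigenH (V := weightPart V)).mpr (Subtype.ext ?_), rfl⟩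
    exact mem_eigenH.mp hw

variable {V} in
lemma isInternal_eigenH (h : ⨆ m : ℤ, eigenH V m = ⊤) : DirectSum.IsInternal (eigenH V) := by
  apply DirectSum.isInternal_submodule_of_iSupIndep_of_iSup_eq_top _ h
  exact (Module.End.eigenspaces_iSupIndep (LieModule.toEnd ℂ 𝔤 V H)).comp
    (f := fun m : ℤ => (m : ℂ)) Int.cast_injective

lemma chi_ne_zero (k : K) : chi k ≠ 0 := by
  intro h
  have := map_mul chi k k⁻¹
  rw [mul_inv_cancel, map_one, h, zero_mul] at this
  exact one_ne_zero this

variable {V} in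
/-- The decomposition of `V` into weight spaces. -/
def decomp (h : ⨆ m : ℤ, eigenH V m = ⊤) : (⨁ m : ℤ, eigenH V m) ≃ₗ[ℂ] V :=
  LinearEquiv.ofBijective (DirectSum.coeLinearMap (eigenH V)) (isInternal_eigenH h)

/-- Multiplication by `χ(k)^m` on the `m`-th summand. -/
def diag (k : K) : (⨁ m : ℤ, eigenH V m) →ₗ[ℂ] (⨁ m : ℤ, eigenH V m) :=
  DirectSum.lmap fun m : ℤ => (chi k ^ m) • LinearMap.id

variable {V} in
/-- If `V` is the direct sum of its weight spaces and all weights are integral, then `r(θ)` acts on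
vectors of weight `m` by `e^{imθ}`. -/
def weightRep (h : ⨆ m : ℤ, eigenH V m = ⊤) : Representation ℂ K V where
  toFun k := (decomp h).toLinearMap ∘ₗ diag V k ∘ₗ (decomp h).symm.toLinearMap
  map_one' := by
    have h1 : diag V 1 = LinearMap.id := by
      refine LinearMap.ext fun v => DFinsupp.ext fun m => ?_
      change chi 1 ^ m • v m = v m
      rw [map_one, one_zpow, one_smul]
    refine LinearMap.ext fun v => ?_
    simp [h1]
  map_mul' k l := by
    have h1 : diag V (k * l) = diag V k ∘ₗ diag V l := by
      refine LinearMap.ext fun v => DFinsupp.ext fun m => ?_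
      change chi (k * l) ^ m • v m = chi k ^ m • chi l ^ m • v m
      rw [map_mul, mul_zpow, mul_smul]
    refine LinearMap.ext fun v => ?_
    simp [h1]

variable {V} in
lemma weightRep_apply (h : ⨆ m : ℤ, eigenH V m = ⊤) (m : ℤ) (v : V) (hv : v ∈ eigenH V m)
    (k : K) : weightRep h k v = chi k ^ m • v := by
  have h1 : decomp h (DirectSum.lof ℂ ℤ (fun m => eigenH V m) m ⟨v, hv⟩) = v :=
    DirectSum.coeLinearMap_lof _ _ _
  have h2 : (decomp h).symm v = DirectSum.lof ℂ ℤ (fun m => eigenH V m) m ⟨v, hv⟩ := by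
    rw [LinearEquiv.symm_apply_eq, h1]
  change decomp h (diag V k ((decomp h).symm v)) = _
  rw [h2, diag, DirectSum.lmap_lof, LinearMap.smul_apply, map_smul, map_smul, LinearMap.id_apply,
    h1]

end Dual

/-- The dual `N(c)^∨` of a Verma module in category `𝒪` (with integral weights): the direct sum of
the duals of the weight spaces of `N(c)`, that is, the span of the functionals of integral weight,
with `X` acting by `(X f)(v) = f(τ(X) v)`. -/
abbrev VermaDual (c : ℂ) : LieSubmodule ℂ 𝔤 (FullDual (Verma c)) := weightPart (FullDual (Verma c))

instance (c : ℂ) : GKRep (VermaDual c) where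
  rho := weightRep (iSup_eigenH_weightPart _)

end NFin

namespace NFin

/-! ### Smooth functions on `SL(2, ℝ)` -/

/-- The four-dimensional space of the entries of real `2 × 2` matrices. -/
abbrev Entries : Type := Fin 2 → Fin 2 → ℝ

/-- The embedding of `SL(2, ℝ)` into the space of real matrices. -/
def entries (g : SL(2, ℝ)) : Entries := fun i j => g.1 i j

/-- The Lie algebra `𝔰𝔩₂(ℝ)`. -/
abbrev 𝔤ℝ : Type := LieAlgebra.SpecialLinear.sl (Fin 2) ℝ

/-- A function on the closed submanifold `SL(2, ℝ)` of the space of real matrices is smooth if it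
is the restriction of a function on matrices that is smooth at all points of `SL(2, ℝ)`. -/
def IsSmooth (Φ : SL(2, ℝ) → ℂ) : Prop :=
  ∃ F : Entries → ℂ, ∀ g : SL(2, ℝ), ContDiffAt ℝ ∞ F (entries g) ∧ F (entries g) = Φ g

lemma traceless_one_one (X : 𝔤ℝ) : X.1 1 1 = -X.1 0 0 := by
  have h : Matrix.trace X.1 = 0 := X.2
  rw [Matrix.trace_fin_two] at h
  linarith

lemma det_exp (X : 𝔤ℝ) : (NormedSpace.exp X.1).det = 1 := by
  let J : Matrix (Fin 2) (Fin 2) ℝ := !![0, 1; -1, 0]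
  let J' : Matrix (Fin 2) (Fin 2) ℝ := !![0, -1; 1, 0]
  have hJ : J * J' = 1 := by
    ext i j; fin_cases i <;> fin_cases j <;> simp [J, J', Matrix.mul_apply, Fin.sum_univ_two]
  have hJ' : J' * J = 1 := by
    ext i j; fin_cases i <;> fin_cases j <;> simp [J, J', Matrix.mul_apply, Fin.sum_univ_two]
  have hconj : ∀ A : Matrix (Fin 2) (Fin 2) ℝ,
      J * A.transpose * J' = !![A 1 1, -A 0 1; -A 1 0, A 0 0] := by
    intro A
    rw [Matrix.eta_fin_two A.transpose, Matrix.mul_fin_two, Matrix.mul_fin_two]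
    simp
  have hX : J * X.1.transpose * J' = -X.1 := by
    have h := traceless_one_one X
    rw [hconj]
    ext i j
    fin_cases i <;> fin_cases j <;> simp [h]
  let u : (Matrix (Fin 2) (Fin 2) ℝ)ˣ := ⟨J, J', hJ, hJ'⟩
  have h1 : J * (NormedSpace.exp X.1).transpose * J' = NormedSpace.exp (-X.1) := by
    rw [← hX, ← Matrix.exp_transpose]
    exact (Matrix.exp_units_conj u X.1.transpose).symm
  have hc : Commute X.1 (-X.1) := by
    change X.1 * -X.1 = -X.1 * X.1
    rw [mul_neg, neg_mul]
  have h2 : NormedSpace.exp X.1 * NormedSpace.exp (-X.1) = 1 := by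
    rw [← Matrix.exp_add_of_commute _ _ hc, add_neg_cancel, NormedSpace.exp_zero]
  rw [← h1, hconj] at h2
  have h3 := congrFun (congrFun h2 0) 0
  rw [Matrix.mul_apply, Fin.sum_univ_two] at h3
  simp at h3
  rw [Matrix.det_fin_two]
  linarith

/-- The exponential map `𝔰𝔩₂(ℝ) → SL(2, ℝ)`. -/
def expSL (X : 𝔤ℝ) : SL(2, ℝ) := ⟨NormedSpace.exp X.1, det_exp X⟩

/-- `(X Φ)(g) = d/dt Φ(g exp(t X))` at `t = 0`. -/
def derivAlong (X : 𝔤ℝ) (Φ : SL(2, ℝ) → ℂ) (g : SL(2, ℝ)) : ℂ :=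
  deriv (fun t : ℝ => Φ (g * expSL (t • X))) 0

/-- Right multiplication by a matrix. -/
def mulR (Y : Matrix (Fin 2) (Fin 2) ℝ) : Entries →L[ℝ] Entries :=
  LinearMap.toContinuousLinearMap
    { toFun := fun A i j => A i 0 * Y 0 j + A i 1 * Y 1 j
      map_add' := by
        intro A B; funext i j; simp only [Pi.add_apply]; ring
      map_smul' := by
        intro c A
        funext i j
        simp only [Pi.smul_apply, smul_eq_mul, RingHom.id_apply]
        ring }

lemma mulR_apply (Y : Matrix (Fin 2) (Fin 2) ℝ) (A : Entries) (i j : Fin 2) :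
    mulR Y A i j = A i 0 * Y 0 j + A i 1 * Y 1 j := rfl

lemma entries_mul (g h : SL(2, ℝ)) : entries (g * h) = mulR h.1 (entries g) := by
  funext i j
  rw [mulR_apply]
  simp [entries, Matrix.mul_apply, Fin.sum_univ_two]

section

open scoped Matrix.Norms.Operator

lemma hasDerivAt_exp_entry (X : Matrix (Fin 2) (Fin 2) ℝ) (i j : Fin 2) :
    HasDerivAt (fun t : ℝ => NormedSpace.exp (t • X) i j) (X i j) 0 := by
  have h1 := hasDerivAt_exp_smul_const (𝕂 := ℝ) X (0 : ℝ)
  rw [zero_smul, NormedSpace.exp_zero, one_mul] at h1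
  let f : Matrix (Fin 2) (Fin 2) ℝ →L[ℝ] ℝ :=
    LinearMap.toContinuousLinearMap (Matrix.entryLinearMap ℝ ℝ i j)
  exact f.hasFDerivAt.comp_hasDerivAt (0 : ℝ) h1

end

lemma derivAlong_eq {F : Entries → ℂ} {Φ : SL(2, ℝ) → ℂ}
    (h : ∀ g : SL(2, ℝ), ContDiffAt ℝ ∞ F (entries g) ∧ F (entries g) = Φ g) (X : 𝔤ℝ)
    (g : SL(2, ℝ)) :
    derivAlong X Φ g = fderiv ℝ F (entries g) (mulR X.1 (entries g)) := by
  have h1 : HasDerivAt (fun t : ℝ => entries (g * expSL (t • X))) (mulR X.1 (entries g)) 0 := by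
    refine hasDerivAt_pi.mpr fun i => hasDerivAt_pi.mpr fun j => ?_
    have h0 := ((hasDerivAt_exp_entry X.1 0 j).const_mul (entries g i 0)).add
      ((hasDerivAt_exp_entry X.1 1 j).const_mul (entries g i 1))
    refine h0.congr_of_eventuallyEq (Filter.Eventually.of_forall fun t => ?_)
    change entries (g * expSL (t • X)) i j = _
    rw [entries_mul, mulR_apply]
    rfl
  have h2 : (fun t : ℝ => Φ (g * expSL (t • X))) =
      F ∘ fun t : ℝ => entries (g * expSL (t • X)) := by
    funext t
    exact (h _).2.symm
  have h00 : g * expSL ((0 : ℝ) • X) = g := by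
    have : expSL ((0 : ℝ) • X) = 1 := by
      apply Subtype.ext
      change NormedSpace.exp ((0 : ℝ) • X.1) = 1
      rw [zero_smul, NormedSpace.exp_zero]
    rw [this, mul_one]
  have h3 : HasFDerivAt F (fderiv ℝ F (entries g)) (entries (g * expSL ((0 : ℝ) • X))) := by
    rw [h00]
    exact ((h g).1.differentiableAt (by simp)).hasFDerivAt
  rw [derivAlong, h2]
  exact (h3.comp_hasDerivAt (0 : ℝ) h1).deriv

lemma derivAlong_extension {F : Entries → ℂ} {Φ : SL(2, ℝ) → ℂ}
    (h : ∀ g : SL(2, ℝ), ContDiffAt ℝ ∞ F (entries g) ∧ F (entries g) = Φ g) (X : 𝔤ℝ)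
    (g : SL(2, ℝ)) :
    ContDiffAt ℝ ∞ (fun A => fderiv ℝ F A (mulR X.1 A)) (entries g) ∧
      fderiv ℝ F (entries g) (mulR X.1 (entries g)) = derivAlong X Φ g := by
  refine ⟨?_, (derivAlong_eq h X g).symm⟩
  have h1 : ContDiffAt ℝ ∞ (fderiv ℝ F) (entries g) := (h g).1.fderiv_right (by simp)
  exact h1.clm_apply (mulR X.1).contDiff.contDiffAt

lemma derivAlong_commutator {Φ : SL(2, ℝ) → ℂ} (hΦ : IsSmooth Φ) (X Y : 𝔤ℝ) (g : SL(2, ℝ)) :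
    derivAlong ⁅X, Y⁆ Φ g =
      derivAlong X (derivAlong Y Φ) g - derivAlong Y (derivAlong X Φ) g := by
  obtain ⟨F, hF⟩ := hΦ
  have key : ∀ X Y : 𝔤ℝ, derivAlong X (derivAlong Y Φ) g =
      fderiv ℝ (fderiv ℝ F) (entries g) (mulR X.1 (entries g)) (mulR Y.1 (entries g)) +
        fderiv ℝ F (entries g) (mulR Y.1 (mulR X.1 (entries g))) := by
    intro X Y
    rw [derivAlong_eq (derivAlong_extension hF Y) X g]
    have h1 : HasFDerivAt (fderiv ℝ F) (fderiv ℝ (fderiv ℝ F) (entries g)) (entries g) :=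
      (((hF g).1.fderiv_right (m := ∞) (by simp)).differentiableAt (by simp)).hasFDerivAt
    have h2 : HasFDerivAt (fun A : Entries => mulR Y.1 A) (mulR Y.1) (entries g) :=
      (mulR Y.1).hasFDerivAt
    rw [(h1.clm_apply h2).fderiv]
    simp [add_comm]
  have hsymm : IsSymmSndFDerivAt ℝ F (entries g) :=
    (hF g).1.isSymmSndFDerivAt (by
      rw [minSmoothness_of_isRCLikeNormedField]
      exact WithTop.coe_le_coe.mpr (le_top : (2 : ℕ∞) ≤ ⊤))
  rw [key, key, derivAlong_eq hF, hsymm (mulR X.1 (entries g)) (mulR Y.1 (entries g)),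
    add_sub_add_left_eq_sub, ← map_sub]
  congr 1
  funext i j
  have h : (⁅X, Y⁆ : 𝔤ℝ).1 = X.1 * Y.1 - Y.1 * X.1 := rfl
  simp only [h, mulR_apply, Pi.sub_apply, Matrix.sub_apply, Matrix.mul_apply, Fin.sum_univ_two]
  ring

/-- The space of smooth functions on `SL(2, ℝ)`. -/
def smoothFunctions : Submodule ℂ (SL(2, ℝ) → ℂ) where
  carrier := {Φ | IsSmooth Φ}
  add_mem' := by
    rintro Φ Ψ ⟨F, hF⟩ ⟨G, hG⟩
    exact ⟨F + G, fun g => ⟨(hF g).1.add (hG g).1, by simp [(hF g).2, (hG g).2]⟩⟩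
  zero_mem' := ⟨0, fun g => ⟨contDiffAt_const, rfl⟩⟩
  smul_mem' := by
    rintro c Φ ⟨F, hF⟩
    exact ⟨c • F, fun g => ⟨contDiffAt_const.smul (hF g).1, by simp [(hF g).2]⟩⟩

/-- Smooth functions on `SL(2, ℝ)`. -/
abbrev SmoothFn : Type := smoothFunctions

lemma derivAlong_smooth (X : 𝔤ℝ) (Φ : SmoothFn) : IsSmooth (derivAlong X Φ.1) := by
  obtain ⟨F, hF⟩ := Φ.2
  exact ⟨_, derivAlong_extension hF X⟩

lemma derivAlong_add (X : 𝔤ℝ) {Φ Ψ : SL(2, ℝ) → ℂ} (hΦ : IsSmooth Φ) (hΨ : IsSmooth Ψ) :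
    derivAlong X (Φ + Ψ) = derivAlong X Φ + derivAlong X Ψ := by
  obtain ⟨F, hF⟩ := hΦ
  obtain ⟨G, hG⟩ := hΨ
  funext g
  have h : ∀ g : SL(2, ℝ), ContDiffAt ℝ ∞ (F + G) (entries g) ∧
      (F + G) (entries g) = (Φ + Ψ) g := fun g =>
    ⟨(hF g).1.add (hG g).1, by simp [(hF g).2, (hG g).2]⟩
  rw [derivAlong_eq h, Pi.add_apply, derivAlong_eq hF, derivAlong_eq hG,
    fderiv_add ((hF g).1.differentiableAt (by simp)) ((hG g).1.differentiableAt (by simp))]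
  rfl

lemma derivAlong_smul (X : 𝔤ℝ) (c : ℂ) (Φ : SL(2, ℝ) → ℂ) (hΦ : IsSmooth Φ) :
    derivAlong X (c • Φ) = c • derivAlong X Φ := by
  obtain ⟨F, hF⟩ := hΦ
  funext g
  have h : ∀ g : SL(2, ℝ), ContDiffAt ℝ ∞ (c • F) (entries g) ∧
      (c • F) (entries g) = (c • Φ) g := fun g =>
    ⟨contDiffAt_const.smul (hF g).1, by simp [(hF g).2]⟩
  rw [derivAlong_eq h, Pi.smul_apply, derivAlong_eq hF,
    fderiv_const_smul ((hF g).1.differentiableAt (by simp))]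
  rfl

lemma derivAlong_lin (a b : ℝ) (X Y : 𝔤ℝ) {Φ : SL(2, ℝ) → ℂ} (hΦ : IsSmooth Φ) :
    derivAlong (a • X + b • Y) Φ = (a : ℂ) • derivAlong X Φ + (b : ℂ) • derivAlong Y Φ := by
  obtain ⟨F, hF⟩ := hΦ
  funext g
  rw [Pi.add_apply, Pi.smul_apply, Pi.smul_apply, derivAlong_eq hF, derivAlong_eq hF,
    derivAlong_eq hF]
  have h : mulR (a • X + b • Y : 𝔤ℝ).1 (entries g) =
      a • mulR X.1 (entries g) + b • mulR Y.1 (entries g) := by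
    have h' : (a • X + b • Y : 𝔤ℝ).1 = a • X.1 + b • Y.1 := rfl
    funext i j
    simp only [h', mulR_apply, Pi.add_apply, Pi.smul_apply, Matrix.add_apply, Matrix.smul_apply,
      smul_eq_mul]
    ring
  rw [h, map_add, map_smul, map_smul]
  rfl

/-- The derivation `X`, as an operator on smooth functions. -/
def deriveReal (X : 𝔤ℝ) : SmoothFn →ₗ[ℂ] SmoothFn where
  toFun Φ := ⟨derivAlong X Φ.1, derivAlong_smooth X Φ⟩
  map_add' Φ Ψ := Subtype.ext (derivAlong_add X Φ.2 Ψ.2)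
  map_smul' c Φ := Subtype.ext (derivAlong_smul X c Φ.1 Φ.2)

lemma deriveReal_lin (a b : ℝ) (X Y : 𝔤ℝ) (Φ : SmoothFn) :
    deriveReal (a • X + b • Y) Φ = (a : ℂ) • deriveReal X Φ + (b : ℂ) • deriveReal Y Φ :=
  Subtype.ext (derivAlong_lin a b X Y Φ.2)

lemma deriveReal_lie (X Y : 𝔤ℝ) (Φ : SmoothFn) :
    deriveReal ⁅X, Y⁆ Φ = deriveReal X (deriveReal Y Φ) - deriveReal Y (deriveReal X Φ) :=
  Subtype.ext (funext fun g => derivAlong_commutator Φ.2 X Y g)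

/-- The real part of an element of `𝔰𝔩₂(ℂ) = 𝔰𝔩₂(ℝ) ⊕ i 𝔰𝔩₂(ℝ)`. -/
def rePart (X : 𝔤) : 𝔤ℝ :=
  ⟨X.1.map Complex.re, by
    change Matrix.trace (X.1.map Complex.re) = 0
    rw [Matrix.trace_fin_two, Matrix.map_apply, Matrix.map_apply, apply_one_one]
    simp⟩

/-- The imaginary part of an element of `𝔰𝔩₂(ℂ) = 𝔰𝔩₂(ℝ) ⊕ i 𝔰𝔩₂(ℝ)`. -/
def imPart (X : 𝔤) : 𝔤ℝ :=
  ⟨X.1.map Complex.im, by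
    change Matrix.trace (X.1.map Complex.im) = 0
    rw [Matrix.trace_fin_two, Matrix.map_apply, Matrix.map_apply, apply_one_one]
    simp⟩

lemma rePart_smul (c : ℂ) (X : 𝔤) : rePart (c • X) = c.re • rePart X + (-c.im) • imPart X := by
  apply Subtype.ext
  ext i j
  change (c * X.1 i j).re = c.re * (X.1 i j).re + -c.im * (X.1 i j).im
  rw [Complex.mul_re]; ring

lemma imPart_smul (c : ℂ) (X : 𝔤) : imPart (c • X) = c.im • rePart X + c.re • imPart X := by
  apply Subtype.ext
  ext i j
  change (c * X.1 i j).im = c.im * (X.1 i j).re + c.re * (X.1 i j).im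
  rw [Complex.mul_im]; ring

lemma rePart_add (X Y : 𝔤) :
    rePart (X + Y) = (1 : ℝ) • rePart X + (1 : ℝ) • rePart Y := by
  rw [one_smul, one_smul]
  rfl

lemma imPart_add (X Y : 𝔤) :
    imPart (X + Y) = (1 : ℝ) • imPart X + (1 : ℝ) • imPart Y := by
  rw [one_smul, one_smul]
  rfl

lemma rePart_lie (X Y : 𝔤) : rePart ⁅X, Y⁆ =
    (1 : ℝ) • ⁅rePart X, rePart Y⁆ + (-1 : ℝ) • ⁅imPart X, imPart Y⁆ := by
  apply Subtype.ext
  rw [one_smul, neg_smul, one_smul]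
  change Matrix.map (X.1 * Y.1 - Y.1 * X.1) Complex.re =
    (X.1.map Complex.re * Y.1.map Complex.re - Y.1.map Complex.re * X.1.map Complex.re) +
    -(X.1.map Complex.im * Y.1.map Complex.im - Y.1.map Complex.im * X.1.map Complex.im)
  ext i j
  simp [Matrix.mul_apply, Fin.sum_univ_two]
  ring

lemma imPart_lie (X Y : 𝔤) : imPart ⁅X, Y⁆ =
    (1 : ℝ) • ⁅rePart X, imPart Y⁆ + (1 : ℝ) • ⁅imPart X, rePart Y⁆ := by
  apply Subtype.ext
  rw [one_smul, one_smul]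
  change Matrix.map (X.1 * Y.1 - Y.1 * X.1) Complex.im =
    (X.1.map Complex.re * Y.1.map Complex.im - Y.1.map Complex.im * X.1.map Complex.re) +
    (X.1.map Complex.im * Y.1.map Complex.re - Y.1.map Complex.re * X.1.map Complex.im)
  ext i j
  simp [Matrix.mul_apply, Fin.sum_univ_two]
  ring

/-- The complex linear extension of the action of `𝔰𝔩₂(ℝ)` on smooth functions by
left invariant derivations: `(X + i Y) Φ = X Φ + i (Y Φ)`. -/
def derive (X : 𝔤) : SmoothFn →ₗ[ℂ] SmoothFn :=
  deriveReal (rePart X) + Complex.I • deriveReal (imPart X)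

instance : LieRingModule 𝔤 SmoothFn where
  bracket X Φ := derive X Φ
  add_lie X Y Φ := by
    change derive (X + Y) Φ = derive X Φ + derive Y Φ
    simp only [derive, LinearMap.add_apply, LinearMap.smul_apply, rePart_add, imPart_add,
      deriveReal_lin]
    push_cast
    module
  lie_add X Φ Ψ := map_add (derive X) Φ Ψ
  leibniz_lie X Y Φ := by
    change derive X (derive Y Φ) = derive ⁅X, Y⁆ Φ + derive Y (derive X Φ)
    simp only [derive, LinearMap.add_apply, LinearMap.smul_apply, rePart_lie, imPart_lie,
      deriveReal_lin, deriveReal_lie, map_add, map_smul, smul_add, smul_sub, smul_smul,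
      Complex.I_mul_I]
    push_cast
    module

instance : LieModule ℂ 𝔤 SmoothFn where
  smul_lie c X Φ := by
    change derive (c • X) Φ = c • derive X Φ
    simp only [derive, LinearMap.add_apply, LinearMap.smul_apply, rePart_smul, imPart_smul,
      deriveReal_lin, smul_add, smul_smul]
    have h1 : ((c.re : ℝ) : ℂ) + Complex.I * (c.im : ℝ) = c := by
      rw [mul_comm]; exact Complex.re_add_im c
    have h2 : ((-c.im : ℝ) : ℂ) + Complex.I * (c.re : ℝ) = c * Complex.I := by
      nth_rewrite 3 [← h1]
      push_cast
      linear_combination -(c.im : ℂ) * Complex.I_mul_I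
    rw [← h2]
    nth_rewrite 5 [← h1]
    module
  lie_smul c X Φ := map_smul (derive X) c Φ

/-- Right translation: `(k Φ)(g) = Φ(g k)`. -/
def rightTranslate (k : SL(2, ℝ)) : SmoothFn →ₗ[ℂ] SmoothFn where
  toFun Φ := ⟨fun g => Φ.1 (g * k), by
    obtain ⟨F, hF⟩ := Φ.2
    refine ⟨fun A => F (mulR k.1 A), fun g => ?_⟩
    have h := hF (g * k)
    rw [entries_mul] at h
    exact ⟨ContDiffAt.comp (entries g) h.1 (mulR k.1).contDiff.contDiffAt, h.2⟩⟩
  map_add' Φ Ψ := rfl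
  map_smul' c Φ := rfl

instance : GKRep SmoothFn where
  rho :=
    { toFun := fun k => rightTranslate k
      map_one' := LinearMap.ext fun Φ => Subtype.ext <| funext fun g =>
        congrArg Φ.1 (mul_one g)
      map_mul' := fun k l => LinearMap.ext fun Φ => Subtype.ext <| funext fun g =>
        congrArg Φ.1 (mul_assoc g k.1 l.1).symm }

end NFin

namespace NFin

/-! ### Automorphic forms and modular forms -/

/-- Left invariance under a subgroup of `SL(2, ℤ)`. -/
def IsLeftInvariant (Γ : Subgroup SL(2, ℤ)) (Φ : SL(2, ℝ) → ℂ) : Prop :=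
  ∀ γ ∈ Γ, ∀ g : SL(2, ℝ), Φ (Matrix.SpecialLinearGroup.map (Int.castRingHom ℝ) γ * g) = Φ g

/-- The right translates of `Φ` by `SO(2)` span a finite-dimensional space. -/
def IsKFinite (Φ : SmoothFn) : Prop :=
  FiniteDimensional ℂ (Submodule.span ℂ (Set.range fun k : K => GKRep.rho k Φ))

/-- The action of the universal enveloping algebra on smooth functions. -/
def actU : U →ₐ[ℂ] Module.End ℂ SmoothFn :=
  UniversalEnvelopingAlgebra.lift ℂ (LieModule.toEnd ℂ 𝔤 SmoothFn)

/-- The orbit of `Φ` under the center of the universal enveloping algebra spans a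
finite-dimensional space. -/
def IsZFinite (Φ : SmoothFn) : Prop :=
  FiniteDimensional ℂ
    (Submodule.span ℂ ((fun z => actU z Φ) '' (Subalgebra.center ℂ U : Set U)))

/-- `|Φ(g)| ≤ C ‖g‖ ^ N`, where `‖g‖²` is the sum of the squares of the entries of `g`. -/
def IsSlowlyIncreasing (Φ : SL(2, ℝ) → ℂ) : Prop :=
  ∃ (C : ℝ) (N : ℕ), ∀ g : SL(2, ℝ), ‖Φ g‖ ≤ C * Real.sqrt (∑ i, ∑ j, g.1 i j ^ 2) ^ N

/-- Automorphic forms on `SL(2, ℝ)` for the group `Γ`. -/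
structure IsAutomorphicForm (Γ : Subgroup SL(2, ℤ)) (Φ : SmoothFn) : Prop where
  left_invariant : IsLeftInvariant Γ Φ.1
  kFinite : IsKFinite Φ
  zFinite : IsZFinite Φ
  slowly_increasing : IsSlowlyIncreasing Φ.1

/-- `L^v Φ = 0` for large enough `v`. -/
def IsNFinite (Φ : SmoothFn) : Prop :=
  ∃ v₀ : ℕ, ∀ v ≥ v₀, (LieModule.toEnd ℂ 𝔤 SmoothFn L ^ v) Φ = 0

/-- The set of `𝔫`-finite automorphic forms for `Γ`. -/
def nFiniteForms (Γ : Subgroup SL(2, ℤ)) : Set SmoothFn :=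
  {Φ | IsAutomorphicForm Γ Φ ∧ IsNFinite Φ}

/-- `(f |_k g)(τ) = (c τ + d)^{-k} f((a τ + b) / (c τ + d))`. -/
def slash (k : ℤ) (f : UpperHalfPlane → ℂ) (g : SL(2, ℝ)) (τ : UpperHalfPlane) : ℂ :=
  ((g.1 1 0 : ℂ) * (τ : ℂ) + (g.1 1 1 : ℂ)) ^ (-k) * f (g • τ)

/-- The matrix `(1, x; 0, 1) (y^{1/2}, 0; 0, y^{-1/2})` for `τ = x + i y`. -/
def sectionMat (τ : UpperHalfPlane) : SL(2, ℝ) :=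
  ⟨!![Real.sqrt τ.im, τ.re / Real.sqrt τ.im; 0, 1 / Real.sqrt τ.im], by
    have h : Real.sqrt τ.im ≠ 0 := (Real.sqrt_pos.mpr τ.im_pos).ne'
    rw [Matrix.det_fin_two_of]
    field_simp
    simp⟩

/-- The function `Φ~(x + i y) = y^{-k/2} Φ((1, x; 0, 1) (y^{1/2}, 0; 0, y^{-1/2}))` on the upper
half plane that corresponds to a function `Φ` of weight `k` on `SL(2, ℝ)`. -/
def tilde (k : ℤ) (Φ : SL(2, ℝ) → ℂ) (τ : UpperHalfPlane) : ℂ :=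
  ((τ.im ^ (-(k : ℝ) / 2) : ℝ) : ℂ) * Φ (sectionMat τ)

/-- The Eisenstein series
`E₂(τ) = -3 / (π y) + 1 - 24 ∑_{n ≥ 1} σ₁(n) e^{2 π i n τ}` of weight `2`. -/
def E2 (τ : UpperHalfPlane) : ℂ :=
  -3 / ((Real.pi : ℂ) * (τ.im : ℂ)) + 1 -
    24 * ∑' n : ℕ, (ArithmeticFunction.sigma 1 (n + 1) : ℂ) *
      Complex.exp (2 * Real.pi * Complex.I * ((n + 1 : ℕ) : ℂ) * (τ : ℂ))

/-- The space `M_k(Γ)` of holomorphic modular forms. -/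
abbrev M (Γ : Subgroup SL(2, ℤ)) (k : ℤ) : Type :=
  ModularForm (Γ : Subgroup (GL (Fin 2) ℝ)) k

/-- The lowest weight vectors (together with `0`) of a space of functions: the vectors of `N` that
are annihilated by `L`. -/
def lowestWeightVectors (N : GKSubmodule SmoothFn) : Set SmoothFn :=
  {Φ | Φ ∈ N.toSubmodule ∧ ⁅L, Φ⁆ = 0}

/-- The summands of the decomposition: `none` is the given subspace `V`, and `some p` is the
`D_{p,+}`-isotypic component of `A`. -/
def summand (A V : GKSubmodule SmoothFn) : Option ℕ → Submodule ℂ SmoothFn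
  | none => V.toSubmodule
  | some p => (isotypic A (DPlus p)).toSubmodule

end NFin

end

noncomputable section

namespace NFin

open UpperHalfPlane Filter Asymptotics Function ModularForm Matrix.SpecialLinearGroup
open scoped Topology Real

/-! ### Finite-dimensionality of the spaces of modular forms. -/

section Finiteness

/-! The dictionary `Φ(g) = (f |_k g)(i)` turns functions of weight `k` on the group into smooth
functions `f` on the upper half plane. Left invariance becomes invariance under the slash action,
slow increase becomes moderate growth, and `L` and `R` become `-2iy² ∂/∂τ̄` and `2i ∂/∂τ + k/y`
(`lie_L_lift`, `lie_R_lift`). A `K`-finite function is a sum of weight vectors lying in the span of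
its `K`-translates (`le_iSup_weightSpace`). These components inherit invariance, growth and
nilpotency under `L`, so it suffices to treat a `Φ` of weight `m` with `L^(v+1) Φ = 0`.

Then `f` is a polynomial in `1/y` with holomorphic coefficients, and a maximum principle argument
shows that every coefficient has moderate growth (`moderateGrowth_coeff`). Hence `L^v Φ` comes from
a holomorphic function of moderate growth that is invariant in weight `m - 2v`. Periodicity at each
cusp improves moderate growth to boundedness, so this is a modular form (`exists_modularForm`).

The decomposition follows by induction on `v` (`mem_iSup_component`). There are no non-zero forms of
negative weight. In positive weight, `L^v R^v f` is a non-zero multiple of `f`, so a multiple of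
`R^v f` can be subtracted from `Φ`. In weight `0` the form is a constant `c`. Since `R` kills
constants, another vector above them is needed; `Φ₂` supplies it, because `L Φ₂ = 3/π`. So the forms
are spanned by `1, Φ₂, R Φ₂, …` and by the `R^j f` with `f` of positive weight.

Each of these families is a ladder: `L` moves every rung to a non-zero multiple of the one below and
kills the bottom rung (`IsLadder`). As `L` is locally nilpotent, injectivity and independence can be
tested on the kernel of `L`, that is, on bottom rungs. There `H` acts by `0` or by `ℓ`, which
separates the summands (`iSupIndep_component`) and identifies the isotypic components with sums of
copies of `D_{ℓ-1,+}`. Inside the module of `Φ₂` the kernel of `L` consists of the constants, which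
a splitting would contradict. Finally, the functional "coefficient of `1`" on that module is a
lowest weight vector of weight `0`, so it defines a pairing with `N(0)`, which is perfect because
all weight spaces are lines. -/

lemma isZeroAtImInfty_of_isBigO_exp {f : ℍ → ℂ} {c : ℝ} (hc : 0 < c)
    (hf : f =O[atImInfty] fun τ => Real.exp (-c * τ.im)) : IsZeroAtImInfty f := by
  refine hf.trans_tendsto ?_
  refine Real.tendsto_exp_atBot.comp ?_
  exact (tendsto_id.const_mul_atTop_of_neg (neg_lt_zero.mpr hc)).comp tendsto_comap

/-- A form of level one that vanishes to a high order at infinity is zero. -/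
lemma levelOne_eq_zero_of_isBigO_exp (m : ℕ) : ∀ (k : ℤ) (_ : k < 12 * m) (g : ModularForm 𝒮ℒ k)
    (_ : g =O[atImInfty] fun τ => Real.exp (-2 * π * m * τ.im)), g = 0 := by
  induction m with
  | zero =>
    intro k hk g _
    exact ModularForm.isZero_of_neg_weight (by simpa using hk) g
  | succ m ih =>
    intro k hk g hg
    have hz : IsZeroAtImInfty g := by
      refine isZeroAtImInfty_of_isBigO_exp (c := 2 * π * ((m + 1 : ℕ) : ℝ)) (by positivity) ?_
      simpa using hg
    let g' : CuspForm 𝒮ℒ k :=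
      { toFun := g
        slash_action_eq' := g.slash_action_eq'
        holo' := g.holo'
        zero_at_cusps' := by
          intro c hc
          rw [Subgroup.IsArithmetic.isCusp_iff_isCusp_SL2Z] at hc
          rw [OnePoint.isZeroAt_iff_forall_SL2Z hc]
          intro γ _
          have : (g : ℍ → ℂ) ∣[k] γ = g := g.slash_action_eq' _ ⟨γ, rfl⟩
          exact this.symm ▸ hz }
    -- Division by `Δ` lowers the weight by `12` and, as `|Δ|` is bounded below by a multiple of
    -- `e^{-2πy}`, costs one factor of the decay. The induction hypothesis applies to the quotient.
    have h0 : CuspForm.discriminantEquiv g' = 0 := by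
      refine ih (k - 12) (by push_cast at hk; linarith) _ ?_
      obtain ⟨C, hC⟩ := hg.bound
      obtain ⟨D, hD, hΔ⟩ := exp_isBigO_discriminant.exists_pos
      refine IsBigO.of_bound (C * D) ?_
      filter_upwards [hC, hΔ.bound] with τ h1 h2
      have h3 : 0 < ‖ModularForm.discriminant τ‖ := norm_pos_iff.mpr (discriminant_ne_zero τ)
      rw [CuspForm.discriminantEquiv_apply, norm_div, div_le_iff₀ h3]
      rw [Real.norm_of_nonneg (Real.exp_pos _).le] at h1 h2 ⊢
      have hC0 : 0 ≤ C := by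
        by_contra hneg
        exact absurd ((norm_nonneg _).trans h1)
          (not_le.mpr (mul_neg_of_neg_of_pos (not_le.mp hneg) (Real.exp_pos _)))
      refine h1.trans ?_
      have h4 : Real.exp (-2 * π * (m + 1 : ℕ) * τ.im) =
          Real.exp (-2 * π * m * τ.im) * Real.exp (-2 * π * τ.im) := by
        rw [← Real.exp_add]; push_cast; ring_nf
      rw [h4]
      calc C * (Real.exp (-2 * π * m * τ.im) * Real.exp (-2 * π * τ.im))
          ≤ C * (Real.exp (-2 * π * m * τ.im) * (D * ‖ModularForm.discriminant τ‖)) := by gcongr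
        _ = _ := by ring
    ext τ
    have h2 := ModularForm.discriminant_mul_discriminantEquiv_apply g' τ
    rw [h0, _root_.zero_apply, mul_zero] at h2
    exact h2.symm

/-- After division by `q^n`, what remains of the `q`-expansion is still a power series in `q` and
hence bounded at infinity; `|q^n|` is exactly the asserted exponential. -/
lemma isBigO_exp_of_coeff_eq_zero {Γ : Subgroup (GL (Fin 2) ℝ)} {k : ℤ} {h : ℝ} (hh : 0 < h)
    (hΓ : h ∈ Γ.strictPeriods) (f : ModularForm Γ k) (n : ℕ)
    (hf : ∀ i < n, (qExpansion h f).coeff i = 0) :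
    f =O[atImInfty] fun τ => Real.exp (-2 * π * n / h * τ.im) := by
  let g : ℍ → ℂ := fun τ => (Periodic.qParam h τ ^ n)⁻¹ * f τ
  have hg : IsBoundedAtImInfty g := by
    refine isBoundedAtImInfty_of_hasSum_qExpansion (c := fun m => (qExpansion h f).coeff (m + n))
      hh fun τ => ?_
    have : Fact (IsCusp OnePoint.infty Γ) := ⟨Γ.isCusp_of_mem_strictPeriods hh hΓ⟩
    have h1 := ModularForm.hasSum_qExpansion f hh hΓ τ
    rw [← hasSum_nat_add_iff' n] at h1
    rw [Finset.sum_eq_zero (fun i hi => by rw [hf i (Finset.mem_range.mp hi), zero_mul]),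
      sub_zero] at h1
    refine (h1.mul_left (Periodic.qParam h τ ^ n)⁻¹).congr_fun ?_
    intro m
    have h0 : Periodic.qParam h (τ : ℂ) ^ n ≠ 0 := pow_ne_zero _ (Periodic.qParam_ne_zero _)
    simp only [smul_eq_mul, pow_add]
    field_simp
  have hfg : (f : ℍ → ℂ) = fun τ : ℍ => Periodic.qParam h τ ^ n * g τ := by
    funext τ
    rw [mul_inv_cancel_left₀ (pow_ne_zero _ (Periodic.qParam_ne_zero _))]
  rw [hfg]
  have hq : (fun τ : ℍ => Periodic.qParam h (τ : ℂ) ^ n) =O[atImInfty]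
      fun τ => Real.exp (-2 * π * n / h * τ.im) := by
    refine IsBigO.of_bound 1 (Eventually.of_forall fun τ => ?_)
    rw [one_mul, norm_pow, Periodic.norm_qParam, ← Real.exp_nat_mul,
      Real.norm_of_nonneg (Real.exp_pos _).le, UpperHalfPlane.coe_im]
    apply le_of_eq
    ring_nf
  simpa using hq.mul hg

/-- The space of modular forms for a finite index subgroup of `SL(2, ℤ)` is finite-dimensional. -/
theorem finiteDimensional_modularForm (Γ : Subgroup (GL (Fin 2) ℝ)) [Γ.IsArithmetic]
    [Γ.HasDetOne] (k : ℤ) : FiniteDimensional ℂ (ModularForm Γ k) := by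
  set h := Γ.strictWidthInfty with hdef
  have hh : 0 < h := Γ.strictWidthInfty_pos
  have hΓ : h ∈ Γ.strictPeriods := Γ.strictWidthInfty_mem_strictPeriods
  -- The number `k * card` is the weight of the norm of `f` down to level one, so vanishing to order
  -- `m` at infinity forces the norm to be zero.
  obtain ⟨m, hm⟩ : ∃ m : ℕ, k * Nat.card (𝒮ℒ ⧸ Γ.subgroupOf 𝒮ℒ) < 12 * m := by
    obtain ⟨m, hm⟩ := exists_nat_gt ((k * Nat.card (𝒮ℒ ⧸ Γ.subgroupOf 𝒮ℒ) : ℤ) : ℝ)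
    have : k * Nat.card (𝒮ℒ ⧸ Γ.subgroupOf 𝒮ℒ) < m := by exact_mod_cast hm
    exact ⟨m, by omega⟩
  -- The local parameter at infinity has width `h`, so `n > h m` coefficients in it give order at
  -- least `m` in the level one parameter.
  obtain ⟨n, hn⟩ := exists_nat_gt (h * m)
  let T : ModularForm Γ k →ₗ[ℂ] (Fin n → ℂ) :=
    { toFun := fun f i => (qExpansion h f).coeff i
      map_add' := fun f g => by
        funext i
        have := ModularForm.qExpansion_add hh hΓ f g
        simp [this]
      map_smul' := fun c f => by
        funext i
        have := ModularForm.qExpansion_smul hh hΓ c f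
        simp [this] }
  refine FiniteDimensional.of_injective T ?_
  rw [injective_iff_map_eq_zero]
  intro f hf
  have h1 := isBigO_exp_of_coeff_eq_zero hh hΓ f n fun i hi => congrFun hf ⟨i, hi⟩
  -- The norm is the product of the translates of `f` over the cosets. The trivial coset contributes
  -- `f`, which decays, and the other factors are bounded because `f` is bounded at all cusps.
  have h2 : ModularForm.norm 𝒮ℒ f = 0 := by
    refine levelOne_eq_zero_of_isBigO_exp m _ hm _ ?_
    have h3 : ∀ q, IsBoundedAtImInfty (SlashInvariantForm.quotientFunc (ℋ := 𝒮ℒ) f q) := by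
      refine Quotient.forall.mpr fun r => ?_
      rw [SlashInvariantForm.quotientFunc_mk]
      refine f.bdd_at_cusps' (c := r.1⁻¹ • OnePoint.infty) ?_ _ rfl
      rw [Subgroup.IsArithmetic.isCusp_iff_isCusp_SL2Z, isCusp_SL2Z_iff']
      obtain ⟨γ, hγ⟩ := (r⁻¹).2
      exact ⟨γ, by rw [hγ]; rfl⟩
    rw [ModularForm.coe_norm]
    classical
    let := Fintype.ofFinite (𝒮ℒ ⧸ Γ.subgroupOf 𝒮ℒ)
    rw [← Finset.mul_prod_erase Finset.univ (SlashInvariantForm.quotientFunc f)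
      (Finset.mem_univ (⟦1⟧ : 𝒮ℒ ⧸ Γ.subgroupOf 𝒮ℒ))]
    have h4 : (∏ q ∈ Finset.univ.erase (⟦1⟧ : 𝒮ℒ ⧸ Γ.subgroupOf 𝒮ℒ),
        SlashInvariantForm.quotientFunc f q) =O[atImInfty] (1 : ℍ → ℝ) := by
      rw [show (1 : ℍ → ℝ) = (fun x ↦ ∏ q ∈ Finset.univ.erase (⟦1⟧ : 𝒮ℒ ⧸ Γ.subgroupOf 𝒮ℒ), 1)
        by ext; simp, Finset.prod_fn]
      exact .finsetProd fun q _ => h3 q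
    have h5 : SlashInvariantForm.quotientFunc (ℋ := 𝒮ℒ) f ⟦1⟧ = f := by
      rw [SlashInvariantForm.quotientFunc_mk]; simp
    rw [h5]
    refine (h1.mul h4).trans (IsBigO.of_bound 1 ?_)
    filter_upwards with τ
    rw [Pi.one_apply, mul_one, one_mul, Real.norm_of_nonneg (Real.exp_pos _).le,
      Real.norm_of_nonneg (Real.exp_pos _).le, Real.exp_le_exp]
    refine mul_le_mul_of_nonneg_right ?_ τ.im_pos.le
    rw [div_le_iff₀ hh]
    nlinarith [Real.pi_pos]
  simpa [ModularForm.norm_eq_zero_iff] using h2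

end Finiteness
end NFin

end

noncomputable section

namespace NFin

open UpperHalfPlane Filter Asymptotics Function ModularForm Matrix.SpecialLinearGroup
open scoped Topology Real Manifold

/-! ### Moderate growth on the upper half plane. -/

section Growth

/-- A periodic holomorphic function that grows at most polynomially at infinity is bounded there. -/
lemma isBoundedAtImInfty_of_periodic {f : ℍ → ℂ} {h : ℝ} (hh : 0 < h)
    (hper : Periodic (f ∘ ofComplex) h) (hf : MDiff f) {C : ℝ} {N : ℕ}
    (hg : ∀ τ : ℍ, 1 ≤ τ.im → |τ.re| ≤ h → ‖f τ‖ ≤ C * τ.im ^ N) : IsBoundedAtImInfty f := by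
  set F := Periodic.cuspFunction h (f ∘ ofComplex) with hF
  have hinv : Tendsto (fun q => (Periodic.invQParam h q).im) (𝓝[≠] 0) atTop :=
    tendsto_comap.comp (Periodic.invQParam_tendsto hh)
  -- The preimage of `q` given by the principal logarithm has `|x| ≤ h/2`, so the growth hypothesis
  -- on a vertical strip is enough.
  have hbound : ∀ᶠ q in 𝓝[≠] (0 : ℂ), ‖F q‖ ≤ C * (Periodic.invQParam h q).im ^ N := by
    filter_upwards [hinv.eventually_ge_atTop 1, self_mem_nhdsWithin] with q hq hq0
    rw [hF, Periodic.cuspFunction_eq_of_nonzero h _ hq0, comp_apply,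
      ofComplex_apply_of_im_pos (by linarith)]
    refine hg ⟨_, by linarith⟩ hq ?_
    change |(Periodic.invQParam h q).re| ≤ h
    have h1 : (Periodic.invQParam h q).re = h / (2 * π) * q.arg := by
      simp only [Periodic.invQParam]
      rw [← Complex.log_im]
      generalize Complex.log q = w
      rw [show (h : ℂ) / (2 * π * Complex.I) * w = ((h / (2 * π) : ℝ) : ℂ) * (-Complex.I * w) by
        push_cast
        field_simp
        simp]
      rw [Complex.re_ofReal_mul]
      simp
    rw [h1, abs_mul, abs_of_pos (by positivity)]
    calc h / (2 * π) * |q.arg| ≤ h / (2 * π) * π := by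
          gcongr; exact Complex.abs_arg_le_pi q
      _ ≤ h := by field_simp; linarith
  have hnorm : ∀ q : ℂ, q ≠ 0 → ‖q‖ = Real.exp (-(2 * π / h) * (Periodic.invQParam h q).im) := by
    intro q hq
    nth_rewrite 1 [← Periodic.qParam_right_inv hh.ne' hq]
    rw [Periodic.norm_qParam]
    ring_nf
  -- Since `|q| = e^{-2πy/h}`, the factor `q` beats any power of `y`. The singularity of `F` at `q =
  -- 0` is therefore removable, and `F` is bounded near it.
  have hlim : Tendsto (fun q : ℂ => q * F q) (𝓝[≠] 0) (𝓝 0) := by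
    have h1 : Tendsto (fun t : ℝ => C * (t ^ N * Real.exp (-(2 * π / h) * t))) atTop (𝓝 0) := by
      simpa using (tendsto_rpow_mul_exp_neg_mul_atTop_nhds_zero N (2 * π / h)
        (by positivity)).const_mul C
    refine squeeze_zero_norm' ?_ (h1.comp hinv)
    filter_upwards [hbound, self_mem_nhdsWithin] with q hq hq0
    rw [norm_mul, hnorm q hq0, comp_apply]
    nlinarith [Real.exp_pos (-(2 * π / h) * (Periodic.invQParam h q).im)]
  have hd : ∀ᶠ q in 𝓝[≠] (0 : ℂ), DifferentiableAt ℂ F q := by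
    refine Periodic.eventually_differentiableAt_cuspFunction_nhds_ne_zero hh hper ?_
    exact eventually_of_mem (preimage_mem_comap (Ioi_mem_atTop 0))
        (fun z hz ↦ UpperHalfPlane.mdifferentiableAt_iff.mp (hf ⟨z, hz⟩))
  have ho : (fun q => F q - F 0) =o[𝓝[≠] 0] fun q : ℂ => (q - 0)⁻¹ := by
    rw [isLittleO_iff_tendsto' (by filter_upwards [self_mem_nhdsWithin] with q hq h0; simp_all)]
    have h2 : Tendsto (fun q : ℂ => q * F 0) (𝓝[≠] 0) (𝓝 0) := by
      have : Tendsto (fun q : ℂ => q * F 0) (𝓝 0) (𝓝 (0 * F 0)) := tendsto_id.mul_const _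
      rw [zero_mul] at this
      exact this.mono_left nhdsWithin_le_nhds
    simpa [mul_sub, mul_comm] using hlim.sub h2
  have hF' := Complex.tendsto_limUnder_of_differentiable_on_punctured_nhds_of_isLittleO hd ho
  have hb : F =O[𝓝[≠] 0] (1 : ℂ → ℝ) := hF'.isBigO_one ℝ
  have hq : Tendsto (fun τ : ℍ => Periodic.qParam h (τ : ℂ)) atImInfty (𝓝[≠] 0) :=
    (Periodic.qParam_tendsto hh).comp tendsto_coe_atImInfty
  have := hb.comp_tendsto hq
  refine this.congr_left fun τ => ?_
  exact UpperHalfPlane.eq_cuspFunction τ hh.ne' hper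

/-- The sum of the squares of the entries of the matrix `sectionMat τ`. -/
def size (τ : ℍ) : ℝ := τ.im + (τ.re ^ 2 + 1) / τ.im

lemma im_le_size (τ : ℍ) : τ.im ≤ size τ := by
  have := τ.im_pos
  have : 0 ≤ (τ.re ^ 2 + 1) / τ.im := by positivity
  unfold size; linarith

lemma inv_im_le_size (τ : ℍ) : τ.im⁻¹ ≤ size τ := by
  have h := τ.im_pos
  have h1 : 0 ≤ τ.re ^ 2 / τ.im := by positivity
  unfold size
  rw [add_div, one_div]
  linarith

lemma one_le_size (τ : ℍ) : 1 ≤ size τ := by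
  have h := τ.im_pos
  unfold size
  rw [← sub_nonneg]
  have : τ.im + (τ.re ^ 2 + 1) / τ.im - 1 =
    (τ.re ^ 2 + (τ.im - 1 / 2) ^ 2 + 3 / 4) / τ.im := by field_simp; ring
  rw [this]
  positivity

lemma size_pos (τ : ℍ) : 0 < size τ := zero_lt_one.trans_le (one_le_size τ)

lemma abs_re_le_size (τ : ℍ) : |τ.re| ≤ size τ := by
  have h := τ.im_pos
  unfold size
  rw [← sub_nonneg]
  have : τ.im + (τ.re ^ 2 + 1) / τ.im - |τ.re| =
    ((|τ.re| - τ.im / 2) ^ 2 + 3 / 4 * τ.im ^ 2 + 1) / τ.im := by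
    rw [← sq_abs τ.re]; field_simp; ring
  rw [this]
  positivity

/-- A function on the upper half plane has moderate growth if it is bounded by a polynomial in
`y`, `1 / y` and `x`. -/
def ModerateGrowth (f : ℍ → ℂ) : Prop := ∃ (C : ℝ) (N : ℕ), ∀ τ, ‖f τ‖ ≤ C * size τ ^ N

namespace ModerateGrowth

variable {f g : ℍ → ℂ}

lemma nonneg_of_bound {C : ℝ} {N : ℕ} (h : ∀ τ, ‖f τ‖ ≤ C * size τ ^ N) : 0 ≤ C := by
  by_contra hneg
  exact absurd ((norm_nonneg _).trans (h I))
    (not_le.mpr (mul_neg_of_neg_of_pos (not_le.mp hneg) (pow_pos (size_pos I) N)))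

lemma mono (hg : ModerateGrowth g) (h : ∀ τ, ‖f τ‖ ≤ ‖g τ‖) : ModerateGrowth f :=
  let ⟨C, N, hC⟩ := hg
  ⟨C, N, fun τ => (h τ).trans (hC τ)⟩

lemma mul (hf : ModerateGrowth f) (hg : ModerateGrowth g) :
    ModerateGrowth fun τ => f τ * g τ := by
  obtain ⟨C, N, hC⟩ := hf
  obtain ⟨D, M, hD⟩ := hg
  refine ⟨C * D, N + M, fun τ => ?_⟩
  rw [norm_mul, pow_add]
  calc ‖f τ‖ * ‖g τ‖ ≤ (C * size τ ^ N) * (D * size τ ^ M) :=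
        mul_le_mul (hC τ) (hD τ) (norm_nonneg _) ((norm_nonneg _).trans (hC τ))
    _ = _ := by ring

lemma add (hf : ModerateGrowth f) (hg : ModerateGrowth g) :
    ModerateGrowth fun τ => f τ + g τ := by
  obtain ⟨C, N, hC⟩ := hf
  obtain ⟨D, M, hD⟩ := hg
  have hC0 := nonneg_of_bound hC
  have hD0 := nonneg_of_bound hD
  refine ⟨C + D, max N M, fun τ => (norm_add_le _ _).trans ?_⟩
  rw [add_mul]
  gcongr
  · exact (hC τ).trans (by gcongr; exacts [one_le_size τ, le_max_left _ _])
  · exact (hD τ).trans (by gcongr; exacts [one_le_size τ, le_max_right _ _])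

lemma const (c : ℂ) : ModerateGrowth fun _ => c := ⟨‖c‖, 0, fun τ => by simp⟩

lemma const_mul (c : ℂ) (hf : ModerateGrowth f) : ModerateGrowth fun τ => c * f τ :=
  (const c).mul hf

lemma sub (hf : ModerateGrowth f) (hg : ModerateGrowth g) :
    ModerateGrowth fun τ => f τ - g τ := by
  simpa [sub_eq_add_neg] using hf.add (hg.const_mul (-1))

lemma pow (hf : ModerateGrowth f) (n : ℕ) : ModerateGrowth fun τ => f τ ^ n := by
  induction n with
  | zero => simpa using const 1
  | succ n ih => simpa [pow_succ] using ih.mul hf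

lemma im : ModerateGrowth fun τ => (τ.im : ℂ) :=
  ⟨1, 1, fun τ => by
    rw [Complex.norm_real, Real.norm_of_nonneg τ.im_pos.le]; simpa using im_le_size τ⟩

lemma im_inv : ModerateGrowth fun τ => (τ.im : ℂ)⁻¹ :=
  ⟨1, 1, fun τ => by
    rw [norm_inv, Complex.norm_real, Real.norm_of_nonneg τ.im_pos.le]
    simpa using inv_im_le_size τ⟩

lemma coe : ModerateGrowth fun τ => (τ : ℂ) := by
  have h : ModerateGrowth fun τ => (τ.re : ℂ) := ⟨1, 1, fun τ => by
    rw [Complex.norm_real, Real.norm_eq_abs]; simpa using abs_re_le_size τ⟩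
  refine (h.add (im.const_mul Complex.I)).mono fun τ => le_of_eq ?_
  congr 1
  rw [mul_comm]
  exact (Complex.re_add_im (τ : ℂ)).symm

lemma zpow (hf : ModerateGrowth f) (hf' : ModerateGrowth fun τ => (f τ)⁻¹) (n : ℤ) :
    ModerateGrowth fun τ => f τ ^ n := by
  rcases n with n | n
  · simpa using hf.pow n
  · simpa [zpow_negSucc] using hf'.pow (n + 1)

end ModerateGrowth

/-- Modular forms of non-negative weight have moderate growth. -/
lemma moderateGrowth_modularForm {Γ : Subgroup (GL (Fin 2) ℝ)} [Γ.IsArithmetic] {k : ℤ}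
    (hk : 0 ≤ k) (f : ModularForm Γ k) : ModerateGrowth f := by
  obtain ⟨C, hC⟩ := ModularFormClass.exists_bound hk f
  have hC0 : 0 ≤ C := by
    by_contra hneg
    refine absurd ((norm_nonneg _).trans (hC I)) (not_le.mpr (mul_neg_of_neg_of_pos
      (not_le.mp hneg) (lt_max_of_lt_left one_pos)))
  lift k to ℕ using hk
  refine ⟨C, k, fun τ => (hC τ).trans ?_⟩
  gcongr
  refine max_le (one_le_pow₀ (one_le_size τ)) ?_
  rw [zpow_natCast, one_div, ← inv_pow]
  exact pow_le_pow_left₀ (inv_nonneg.mpr τ.im_pos.le) (inv_im_le_size τ) k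

end Growth
end NFin

end

noncomputable section

namespace NFin

open UpperHalfPlane Filter Asymptotics Function ModularForm Matrix.SpecialLinearGroup
open scoped Topology Real Manifold

/-! ### The slash action, the size function and a criterion for modularity. -/

section Slash

/-- The automorphy factor `c τ + d`. -/
def den (g : SL(2, ℝ)) (τ : ℍ) : ℂ := (g.1 1 0 : ℂ) * (τ : ℂ) + (g.1 1 1 : ℂ)

lemma coe_smul_SL (g : SL(2, ℝ)) (τ : ℍ) :
    ((g • τ : ℍ) : ℂ) = ((g.1 0 0 : ℂ) * τ + g.1 0 1) / den g τ :=
  UpperHalfPlane.coe_specialLinearGroup_apply g τ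

lemma den_ne_zero (g : SL(2, ℝ)) (τ : ℍ) : den g τ ≠ 0 := UpperHalfPlane.denom_ne_zero (g : GL (Fin 2) ℝ) τ

lemma im_smul_SL (g : SL(2, ℝ)) (τ : ℍ) : (g • τ).im = τ.im / Complex.normSq (den g τ) := by
  have h := UpperHalfPlane.im_smul_eq_div_normSq (g : GL (Fin 2) ℝ) τ
  have hd : Matrix.GeneralLinearGroup.det (g : GL (Fin 2) ℝ) = 1 := by ext; simp
  rw [hd, Units.val_one, abs_one, one_mul] at h
  exact h

lemma den_mul (g h : SL(2, ℝ)) (τ : ℍ) : den (g * h) τ = den g (h • τ) * den h τ := by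
  have h0 := den_ne_zero h τ
  have h1 : den g (h • τ) = (g.1 1 0 : ℂ) * (((h.1 0 0 : ℂ) * τ + h.1 0 1) / den h τ) +
    (g.1 1 1 : ℂ) := by rw [← coe_smul_SL]; rfl
  rw [h1, add_mul, mul_assoc, div_mul_cancel₀ _ h0]
  simp only [den, Matrix.SpecialLinearGroup.coe_mul, Matrix.mul_apply, Fin.sum_univ_two]
  push_cast
  ring

lemma slash_eq (k : ℤ) (f : ℍ → ℂ) (g : SL(2, ℝ)) (τ : ℍ) :
    slash k f g τ = den g τ ^ (-k) * f (g • τ) := rfl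

lemma slash_mul (k : ℤ) (f : ℍ → ℂ) (g h : SL(2, ℝ)) (τ : ℍ) :
    slash k (slash k f g) h τ = slash k f (g * h) τ := by
  simp only [slash_eq]
  rw [den_mul, mul_zpow, mul_smul]
  ring

/-- The image of a matrix with integral entries in `SL(2, ℝ)`. -/
abbrev toReal (γ : SL(2, ℤ)) : SL(2, ℝ) := Matrix.SpecialLinearGroup.map (Int.castRingHom ℝ) γ

lemma slash_toReal (k : ℤ) (f : ℍ → ℂ) (γ : SL(2, ℤ)) : f ∣[k] γ = slash k f (toReal γ) := by
  funext τ
  rw [ModularForm.SL_slash_apply, slash, mul_comm]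
  rfl

lemma sectionMat_smul_I (τ : ℍ) : sectionMat τ • I = τ := by
  have h : sectionMat τ = τ.toSL2R := by ext i j; rw [UpperHalfPlane.coe_toSL2R]; rfl
  rw [h, UpperHalfPlane.toSL2R_smul_I]

lemma den_sectionMat (τ : ℍ) : den (sectionMat τ) I = ((Real.sqrt τ.im)⁻¹ : ℝ) := by
  simp [den, sectionMat]

lemma normSq_den_I (g : SL(2, ℝ)) : Complex.normSq (den g I) = g.1 1 0 ^ 2 + g.1 1 1 ^ 2 := by
  simp [den, Complex.normSq_apply]; ring

/-- The sum of the squares of the entries of `g`. -/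
def sqNorm (g : SL(2, ℝ)) : ℝ := ∑ i, ∑ j, g.1 i j ^ 2

lemma det_entries (g : SL(2, ℝ)) : g.1 0 0 * g.1 1 1 - g.1 0 1 * g.1 1 0 = 1 := by
  have := g.2; rwa [Matrix.det_fin_two] at this

/-- With `g • i = x + iy` one has `y = 1/(c²+d²)` and `x = (ac+bd) y`, and `(ac+bd)² + 1 =
(a²+b²)(c²+d²)` since the determinant is `1`. This is what matches slow increase on the group with
moderate growth on the upper half plane. -/
lemma sqNorm_eq_size (g : SL(2, ℝ)) : sqNorm g = size (g • I) := by
  have hd := det_entries g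
  have h1 : (g • I).im = 1 / (g.1 1 0 ^ 2 + g.1 1 1 ^ 2) := by
    rw [im_smul_SL, normSq_den_I]; rfl
  have h0 : 0 < g.1 1 0 ^ 2 + g.1 1 1 ^ 2 := by
    rw [← normSq_den_I]; exact Complex.normSq_pos.mpr (den_ne_zero g I)
  have h2 : (g • I).re = (g.1 0 0 * g.1 1 0 + g.1 0 1 * g.1 1 1) / (g.1 1 0 ^ 2 + g.1 1 1 ^ 2) := by
    rw [← UpperHalfPlane.coe_re, coe_smul_SL, Complex.div_re, normSq_den_I]
    simp [den]
    field_simp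
    ring
  rw [size, h1, h2, sqNorm]
  simp only [Fin.sum_univ_two]
  field_simp
  linear_combination (g.1 0 0 * g.1 1 1 - g.1 0 1 * g.1 1 0 + 1) * hd

/-- Submultiplicativity of the Frobenius norm, by Cauchy–Schwarz for each entry. -/
lemma sqNorm_mul_le (g h : SL(2, ℝ)) : sqNorm (g * h) ≤ sqNorm g * sqNorm h := by
  have key : ∀ a b x z : ℝ, (a * x + b * z) ^ 2 ≤ (a ^ 2 + b ^ 2) * (x ^ 2 + z ^ 2) := fun a b x z => by
    nlinarith [sq_nonneg (a * z - b * x)]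
  simp only [sqNorm, Matrix.SpecialLinearGroup.coe_mul, Matrix.mul_apply, Fin.sum_univ_two]
  linarith [key (g.1 0 0) (g.1 0 1) (h.1 0 0) (h.1 1 0), key (g.1 0 0) (g.1 0 1) (h.1 0 1) (h.1 1 1),
    key (g.1 1 0) (g.1 1 1) (h.1 0 0) (h.1 1 0), key (g.1 1 0) (g.1 1 1) (h.1 0 1) (h.1 1 1)]

lemma size_smul_le (g : SL(2, ℝ)) (τ : ℍ) : size (g • τ) ≤ sqNorm g * size τ := by
  have h := sqNorm_mul_le g (sectionMat τ)
  rwa [sqNorm_eq_size (g * _), mul_smul, sectionMat_smul_I, sqNorm_eq_size (sectionMat τ),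
    sectionMat_smul_I] at h

lemma ModerateGrowth.comp_smul {f : ℍ → ℂ} (hf : ModerateGrowth f) (g : SL(2, ℝ)) :
    ModerateGrowth fun τ => f (g • τ) := by
  obtain ⟨C, N, hC⟩ := hf
  have hC0 := nonneg_of_bound hC
  refine ⟨C * sqNorm g ^ N, N, fun τ => (hC _).trans ?_⟩
  rw [mul_assoc, ← mul_pow]
  gcongr
  · exact (size_pos _).le
  · exact size_smul_le g τ

lemma moderateGrowth_den (g : SL(2, ℝ)) : ModerateGrowth (den g) :=
  (ModerateGrowth.coe.const_mul _).add (ModerateGrowth.const _)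

/-- From `Im(gτ) = y / |cτ+d|²` one gets `1/|cτ+d| = Im(gτ) · y⁻¹ · |cτ+d|`, a product of functions
of moderate growth. -/
lemma moderateGrowth_den_inv (g : SL(2, ℝ)) : ModerateGrowth fun τ => (den g τ)⁻¹ := by
  have h1 := (ModerateGrowth.im.comp_smul g).mul
    (ModerateGrowth.im_inv.mul (((moderateGrowth_den g))))
  refine h1.mono fun τ => le_of_eq ?_
  rw [norm_mul, norm_mul, im_smul_SL, norm_inv, norm_inv, Complex.norm_real, Complex.norm_real,
    Real.norm_of_nonneg τ.im_pos.le, Real.norm_of_nonneg (div_nonneg τ.im_pos.le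
    (Complex.normSq_nonneg _)), Complex.normSq_eq_norm_sq]
  have := τ.im_pos
  have := norm_pos_iff.mpr (den_ne_zero g τ)
  field_simp

lemma ModerateGrowth.slash {f : ℍ → ℂ} (hf : ModerateGrowth f) (k : ℤ) (g : SL(2, ℝ)) :
    ModerateGrowth (slash k f g) :=
  ((moderateGrowth_den g).zpow (moderateGrowth_den_inv g) (-k)).mul (hf.comp_smul g)

/-- A holomorphic function of moderate growth that is invariant under a subgroup of finite index
of `SL(2, ℤ)` is a modular form. -/
def modularFormOfModerateGrowth (Γ : Subgroup SL(2, ℤ)) [Γ.FiniteIndex] (k : ℤ) (f : ℍ → ℂ)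
    (hf : MDiff f) (hg : ModerateGrowth f) (hΓ : ∀ γ ∈ Γ, slash k f (toReal γ) = f) : M Γ k where
  toFun := f
  slash_action_eq' := by
    rintro _ ⟨γ, hγ, rfl⟩
    exact (slash_toReal k f γ).trans (hΓ γ hγ)
  holo' := hf
  bdd_at_cusps' := by
    intro c hc
    rw [Subgroup.IsArithmetic.isCusp_iff_isCusp_SL2Z] at hc
    rw [OnePoint.isBoundedAt_iff_forall_SL2Z hc]
    intro γ _
    -- By finite index, `Γ` contains `γ Tⁿ γ⁻¹` for some `n > 0`, so `f |_k γ` has period `n`.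
    obtain ⟨n, hn, -, hmem⟩ := Subgroup.exists_pow_mem_of_index_ne_zero
      (Subgroup.FiniteIndex.index_ne_zero (H := Γ)) (γ * ModularGroup.T * γ⁻¹)
    rw [conj_pow] at hmem
    have hinv : (f ∣[k] γ) ∣[k] (ModularGroup.T ^ (n : ℤ)) = f ∣[k] γ := by
      have h1 := (slash_toReal k f _).trans (hΓ _ hmem)
      rw [← SlashAction.slash_mul, zpow_natCast]
      nth_rewrite 2 [← h1]
      rw [← SlashAction.slash_mul, inv_mul_cancel_right]
    have hper : ∀ τ : ℍ, (f ∣[k] γ) ((n : ℝ) +ᵥ τ) = (f ∣[k] γ) τ := by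
      intro τ
      have h1 := congrFun hinv τ
      rw [ModularForm.SL_slash_apply, UpperHalfPlane.modular_T_zpow_smul] at h1
      have h2 : UpperHalfPlane.denom (Matrix.SpecialLinearGroup.toGL
          (Matrix.SpecialLinearGroup.map (Int.castRingHom ℝ) (ModularGroup.T ^ (n : ℤ)))) (τ : ℂ) = 1 := by
        change (((ModularGroup.T ^ (n : ℤ)).1 1 0 : ℝ) : ℂ) * (τ : ℂ) +
          (((ModularGroup.T ^ (n : ℤ)).1 1 1 : ℝ) : ℂ) = 1
        rw [ModularGroup.coe_T_zpow]
        simp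
      rw [h2, one_zpow, mul_one] at h1
      exact_mod_cast h1
    have hmg : ModerateGrowth (f ∣[k] γ) := by
      rw [slash_toReal]; exact hg.slash k _
    obtain ⟨C, N, hC⟩ := hmg
    have hC0 := ModerateGrowth.nonneg_of_bound hC
    -- For `y ≥ 1` and `|x| ≤ n` one has `size τ ≤ y + n² + 1 ≤ (n² + 2) y`, which explains the
    -- constant.
    refine isBoundedAtImInfty_of_periodic (h := n) (by exact_mod_cast hn) ?_ ?_
      (C := C * ((n : ℝ) ^ 2 + 2) ^ N) (N := N) ?_
    · intro w
      by_cases hw : 0 < w.im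
      · have hw' : 0 < (w + (n : ℝ)).im := by simpa using hw
        rw [comp_apply, comp_apply, ofComplex_apply_of_im_pos hw, ofComplex_apply_of_im_pos hw',
          ← hper ⟨w, hw⟩]
        exact congrArg _ (UpperHalfPlane.ext (by simp [add_comm]))
      -- Off the upper half plane `ofComplex` takes one fixed default value, so periodicity holds
      -- there for trivial reasons.
      · have hw' : (w + (n : ℝ)).im ≤ 0 := by simpa using hw
        rw [comp_apply, comp_apply, ofComplex_apply_of_im_nonpos (not_lt.mp hw),
          ofComplex_apply_of_im_nonpos hw']
    · exact hf.slash k _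
    · intro τ h1 h2
      refine (hC τ).trans ?_
      rw [mul_assoc, ← mul_pow]
      gcongr
      · exact (size_pos τ).le
      · have h3 : τ.re ^ 2 ≤ (n : ℝ) ^ 2 := by
          rw [← sq_abs]; gcongr
        have h4 : (τ.re ^ 2 + 1) / τ.im ≤ (n : ℝ) ^ 2 + 1 := by
          rw [div_le_iff₀ τ.im_pos]; nlinarith [sq_nonneg (n : ℝ)]
        unfold size
        nlinarith [sq_nonneg (n : ℝ)]

end Slash
end NFin

end

noncomputable section

namespace NFin

open UpperHalfPlane Filter Asymptotics Function ModularForm Matrix.SpecialLinearGroup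
open scoped Topology Real Manifold

/-! ### From functions on the upper half plane to the group; `L` and `R` as differential operators.
-/

section Lift

lemma contDiffAt_zpow {E : Type*} [NormedAddCommGroup E] [NormedSpace ℝ E] {f : E → ℂ} {x : E}
    (hf : ContDiffAt ℝ ∞ f x) (h : f x ≠ 0) (n : ℤ) : ContDiffAt ℝ ∞ (fun y => f y ^ n) x := by
  rcases n with n | n
  · simpa using hf.pow n
  · simp only [zpow_negSucc]
    exact (hf.pow (n + 1)).inv (pow_ne_zero _ h)

/-- A function on the upper half plane is smooth in the real sense. -/
def RSmooth (f : ℍ → ℂ) : Prop := ∀ τ : ℍ, ContDiffAt ℝ ∞ (f ∘ ofComplex) (τ : ℂ)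

/-- The linear map `A ↦ A_{i0} √-1 + A_{i1}`. -/
def rowMap (i : Fin 2) : Entries →L[ℝ] ℂ :=
  LinearMap.toContinuousLinearMap
    { toFun := fun A => (A i 0 : ℂ) * Complex.I + A i 1
      map_add' := by intro A B; simp; ring
      map_smul' := by intro c A; simp; ring }

lemma rowMap_apply (i : Fin 2) (A : Entries) : rowMap i A = (A i 0 : ℂ) * Complex.I + A i 1 := rfl

lemma rowMap_one (g : SL(2, ℝ)) : rowMap 1 (entries g) = den g I := rfl

lemma rowMap_div (g : SL(2, ℝ)) : rowMap 0 (entries g) / rowMap 1 (entries g) = ((g • I : ℍ) : ℂ) := by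
  rw [coe_smul_SL, rowMap_one]; rfl

/-- An extension of `g ↦ (f |_k g)(i)` to real matrices. -/
def liftExt (k : ℤ) (f : ℍ → ℂ) (A : Entries) : ℂ :=
  rowMap 1 A ^ (-k) * (f ∘ ofComplex) (rowMap 0 A / rowMap 1 A)

lemma liftExt_spec (k : ℤ) {f : ℍ → ℂ} (hf : RSmooth f) (g : SL(2, ℝ)) :
    ContDiffAt ℝ ∞ (liftExt k f) (entries g) ∧ liftExt k f (entries g) = slash k f g I := by
  constructor
  · have h1 : rowMap 1 (entries g) ≠ 0 := den_ne_zero g I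
    refine (contDiffAt_zpow (rowMap 1).contDiff.contDiffAt h1 (-k)).mul ?_
    have h2 : ContDiffAt ℝ ∞ (fun A => rowMap 0 A / rowMap 1 A) (entries g) := by
      simp only [div_eq_mul_inv]
      exact (rowMap 0).contDiff.contDiffAt.mul ((rowMap 1).contDiff.contDiffAt.inv h1)
    exact ContDiffAt.comp (g := f ∘ ofComplex) (entries g) (by rw [rowMap_div]; exact hf _) h2
  · rw [liftExt, rowMap_div, rowMap_one, comp_apply, ofComplex_apply]
    rfl

/-- The function `g ↦ (f |_k g)(i)` on `SL(2, ℝ)`. -/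
def lift (k : ℤ) (f : ℍ → ℂ) (hf : RSmooth f) : SmoothFn :=
  ⟨fun g => slash k f g I, liftExt k f, liftExt_spec k hf⟩

lemma lift_apply (k : ℤ) (f : ℍ → ℂ) (hf : RSmooth f) (g : SL(2, ℝ)) :
    (lift k f hf).1 g = den g I ^ (-k) * f (g • I) := rfl

/-- The product rule for `den g I ^ (-k) * f (g • I)`. The point `g • I` moves with the Möbius
velocity of `X` at `i`, namely `2ai + b + c` for `X = (a, b; c, -a)`, divided by `(ci+d)²` formed
from the bottom row of `g`. The last bracket is the velocity of the automorphy factor. -/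
lemma derivAlong_lift (k : ℤ) {f : ℍ → ℂ} (hf : RSmooth f) (X : 𝔤ℝ) (g : SL(2, ℝ)) :
    derivAlong X (lift k f hf).1 g =
      den g I ^ (-k) * fderiv ℝ (f ∘ ofComplex) ((g • I : ℍ) : ℂ)
        ((2 * X.1 0 0 * Complex.I + X.1 0 1 + X.1 1 0) / den g I ^ 2) +
      (-k) * den g I ^ (-k - 1) *
        ((g.1 1 0 * X.1 0 0 + g.1 1 1 * X.1 1 0) * Complex.I +
          (g.1 1 0 * X.1 0 1 - g.1 1 1 * X.1 0 0)) * f (g • I) := by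
  refine (derivAlong_eq (liftExt_spec k hf) X g).trans ?_
  set A := entries g
  set Y := mulR X.1 A
  have hD : rowMap 1 A ≠ 0 := den_ne_zero g I
  -- The derivative depends only on the velocity `Y` of the curve, so the exponential curve may be
  -- replaced by the line `A + tY` in the space of matrices.
  have hline : ∀ i, HasDerivAt (fun t : ℝ => rowMap i (A + t • Y)) (rowMap i Y) 0 := by
    intro i
    have h0 : HasDerivAt (fun t : ℝ => A + t • Y) Y 0 := by
      simpa using ((hasDerivAt_id (0 : ℝ)).smul_const Y).const_add A
    exact (rowMap i).hasFDerivAt.comp_hasDerivAt (0 : ℝ) h0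
  have hA0 : A + (0 : ℝ) • Y = A := by simp
  have h1 : HasDerivAt (fun t : ℝ => rowMap 1 (A + t • Y) ^ (-k))
      ((-k : ℤ) * rowMap 1 A ^ (-k - 1) * rowMap 1 Y) 0 := by
    have hz := (hasDerivAt_zpow (-k) (rowMap 1 A) (Or.inl hD)).hasFDerivAt.restrictScalars ℝ
    have := HasFDerivAt.comp_hasDerivAt_of_eq (0 : ℝ) hz (hline 1) (by rw [hA0])
    exact this.congr_deriv (by simp [mul_comm])
  have h2 : HasDerivAt (fun t : ℝ => rowMap 0 (A + t • Y) / rowMap 1 (A + t • Y))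
      ((rowMap 0 Y * rowMap 1 A - rowMap 0 A * rowMap 1 Y) / rowMap 1 A ^ 2) 0 := by
    have := (hline 0).div (hline 1) (by rwa [hA0])
    rwa [hA0] at this
  have h3 : HasFDerivAt (f ∘ ofComplex) (fderiv ℝ (f ∘ ofComplex) ((g • I : ℍ) : ℂ))
      ((g • I : ℍ) : ℂ) := ((hf _).differentiableAt (by simp)).hasFDerivAt
  have h4 := HasFDerivAt.comp_hasDerivAt_of_eq (0 : ℝ) h3 h2
    (by rw [hA0]; exact (rowMap_div g).symm)
  have h5 := h1.mul h4
  have h6 : HasDerivAt (fun t : ℝ => liftExt k f (A + t • Y)) (fderiv ℝ (liftExt k f) A Y) 0 := by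
    have h0 : HasDerivAt (fun t : ℝ => A + t • Y) Y 0 := by
      simpa using ((hasDerivAt_id (0 : ℝ)).smul_const Y).const_add A
    exact HasFDerivAt.comp_hasDerivAt_of_eq (0 : ℝ)
      (((liftExt_spec k hf g).1.differentiableAt (by simp)).hasFDerivAt) h0 hA0.symm
  rw [h6.unique h5]
  simp only [hA0, comp_apply]
  rw [← comp_apply (f := f), rowMap_div, comp_apply, ofComplex_apply]
  have hX : X.1 1 1 = -X.1 0 0 := traceless_one_one X
  have hdet : ((g.1 0 0 : ℝ) : ℂ) * g.1 1 1 - g.1 0 1 * g.1 1 0 = 1 := by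
    exact_mod_cast det_entries g
  -- The numerator of the quotient rule is `det g` times the velocity at `i`; this is where
  -- determinant one enters.
  have hnum : rowMap 0 Y * rowMap 1 A - rowMap 0 A * rowMap 1 Y =
      2 * X.1 0 0 * Complex.I + X.1 0 1 + X.1 1 0 := by
    simp only [rowMap_apply, Y, mulR_apply, A, entries, hX]
    push_cast
    linear_combination (2 * X.1 0 0 * Complex.I + X.1 0 1 + X.1 1 0) * hdet +
      (g.1 0 0 * g.1 1 1 - g.1 0 1 * g.1 1 0) * (X.1 1 0) * (-Complex.I_sq)
  have hY : rowMap 1 Y = ((g.1 1 0 * X.1 0 0 + g.1 1 1 * X.1 1 0) * Complex.I +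
          (g.1 1 0 * X.1 0 1 - g.1 1 1 * X.1 0 0)) := by
    simp only [rowMap_apply, Y, mulR_apply, A, entries, hX]
    push_cast
    ring
  rw [hnum, hY]
  rw [show rowMap 1 A = den g I from rfl]
  push_cast
  ring

/-- The Wirtinger derivative `∂f/∂τ`. -/
def dz (f : ℍ → ℂ) (τ : ℍ) : ℂ :=
  (fderiv ℝ (f ∘ ofComplex) τ 1 - Complex.I * fderiv ℝ (f ∘ ofComplex) τ Complex.I) / 2

/-- The Wirtinger derivative `∂f/∂τ̄`. -/
def dzbar (f : ℍ → ℂ) (τ : ℍ) : ℂ :=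
  (fderiv ℝ (f ∘ ofComplex) τ 1 + Complex.I * fderiv ℝ (f ∘ ofComplex) τ Complex.I) / 2

lemma fderiv_eq_dz_dzbar (f : ℍ → ℂ) (τ : ℍ) (w : ℂ) :
    fderiv ℝ (f ∘ ofComplex) τ w = dz f τ * w + dzbar f τ * (starRingEnd ℂ) w := by
  have h : w = w.re • (1 : ℂ) + w.im • Complex.I := by
    simp
  have hc : (starRingEnd ℂ) w = w.re - w.im * Complex.I := by
    apply Complex.ext <;> simp
  have hw : w = w.re + w.im * Complex.I := (Complex.re_add_im w).symm
  nth_rewrite 1 [h]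
  rw [map_add, map_smul, map_smul, hc, dz, dzbar, Complex.real_smul, Complex.real_smul]
  nth_rewrite 3 [hw]
  linear_combination ((w.im : ℂ) * fderiv ℝ (f ∘ ofComplex) τ Complex.I) * Complex.I_sq

/-- The lowering operator `-2 i y² ∂/∂τ̄`. -/
def lowerOp (f : ℍ → ℂ) (τ : ℍ) : ℂ := -2 * Complex.I * τ.im ^ 2 * dzbar f τ

/-- The raising operator `2 i ∂/∂τ + k / y` in weight `k`. -/
def raiseOp (k : ℤ) (f : ℍ → ℂ) (τ : ℍ) : ℂ := 2 * Complex.I * dz f τ + k * (τ.im : ℂ)⁻¹ * f τ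

lemma RSmooth.of_eventuallyEq {f : ℍ → ℂ} {F : ℂ → ℂ}
    (hF : ∀ τ : ℍ, ContDiffAt ℝ ∞ F τ) (h : ∀ τ : ℍ, f τ = F τ) : RSmooth f := by
  intro τ
  refine (hF τ).congr_of_eventuallyEq ?_
  filter_upwards [isOpen_upperHalfPlaneSet.mem_nhds τ.im_pos] with z hz
  rw [comp_apply, ofComplex_apply_of_im_pos hz, h]

lemma contDiffAt_im (z : ℂ) : ContDiffAt ℝ ∞ (fun w : ℂ => (w.im : ℂ)) z :=
  (Complex.ofRealCLM.contDiff.comp Complex.imCLM.contDiff).contDiffAt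

lemma RSmooth.fderiv_apply {f : ℍ → ℂ} (hf : RSmooth f) (τ : ℍ) (v : ℂ) :
    ContDiffAt ℝ ∞ (fun z => fderiv ℝ (f ∘ ofComplex) z v) (τ : ℂ) :=
  ((hf τ).fderiv_right (by simp)).clm_apply contDiffAt_const

lemma RSmooth.lowerOp {f : ℍ → ℂ} (hf : RSmooth f) : RSmooth (lowerOp f) := by
  refine RSmooth.of_eventuallyEq (F := fun z => -2 * Complex.I * (z.im : ℂ) ^ 2 *
    ((fderiv ℝ (f ∘ ofComplex) z 1 + Complex.I * fderiv ℝ (f ∘ ofComplex) z Complex.I) * 2⁻¹))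
    (fun τ => ?_) fun τ => rfl
  exact (contDiffAt_const.mul ((contDiffAt_im _).pow 2)).mul (((hf.fderiv_apply τ 1).add
    (contDiffAt_const.mul (hf.fderiv_apply τ Complex.I))).mul contDiffAt_const)

lemma RSmooth.raiseOp {f : ℍ → ℂ} (hf : RSmooth f) (k : ℤ) : RSmooth (raiseOp k f) := by
  refine RSmooth.of_eventuallyEq (F := fun z => 2 * Complex.I *
    ((fderiv ℝ (f ∘ ofComplex) z 1 - Complex.I * fderiv ℝ (f ∘ ofComplex) z Complex.I) * 2⁻¹) +
    k * (z.im : ℂ)⁻¹ * (f ∘ ofComplex) z) (fun τ => ?_) fun τ => by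
      rw [comp_apply, ofComplex_apply]; rfl
  have hy : (((τ : ℂ).im : ℝ) : ℂ) ≠ 0 := by exact_mod_cast τ.im_pos.ne'
  exact (contDiffAt_const.mul (((hf.fderiv_apply τ 1).sub
    (contDiffAt_const.mul (hf.fderiv_apply τ Complex.I))).mul contDiffAt_const)).add
    ((contDiffAt_const.mul ((contDiffAt_im _).inv hy)).mul (hf τ))

lemma im_smul_I_inv (g : SL(2, ℝ)) :
    (((g • I : ℍ).im : ℝ) : ℂ)⁻¹ = den g I * (starRingEnd ℂ) (den g I) := by
  rw [im_smul_SL, Complex.mul_conj]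
  simp

lemma lie_apply_smoothFn (X : 𝔤) (Φ : SmoothFn) (g : SL(2, ℝ)) :
    (⁅X, Φ⁆ : SmoothFn).1 g =
      derivAlong (rePart X) Φ.1 g + Complex.I * derivAlong (imPart X) Φ.1 g := rfl

/-- On functions of weight `k`, the element `L` acts by the lowering operator. -/
theorem lie_L_lift (k : ℤ) {f : ℍ → ℂ} (hf : RSmooth f) :
    ⁅L, lift k f hf⁆ = lift (k - 2) (lowerOp f) hf.lowerOp := by
  refine Subtype.ext (funext fun g => ?_)
  rw [lie_apply_smoothFn, derivAlong_lift, derivAlong_lift, fderiv_eq_dz_dzbar, fderiv_eq_dz_dzbar,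
    lift_apply]
  have hD := den_ne_zero g I
  have hDc : (starRingEnd ℂ) (den g I) ≠ 0 := (map_ne_zero _).mpr hD
  have hy : (((g • I : ℍ).im : ℝ) : ℂ) = (den g I * (starRingEnd ℂ) (den g I))⁻¹ := by
    rw [← im_smul_I_inv, inv_inv]
  have e1 : (rePart L).1 0 0 = 1 / 2 ∧ (rePart L).1 0 1 = 0 ∧ (rePart L).1 1 0 = 0 := by
    simp [rePart, L, tracelessMat]
  have e2 : (imPart L).1 0 0 = 0 ∧ (imPart L).1 0 1 = -1 / 2 ∧ (imPart L).1 1 0 = -1 / 2 := by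
    simp [imPart, L, tracelessMat]
  obtain ⟨a1, a2, a3⟩ := e1
  obtain ⟨b1, b2, b3⟩ := e2
  rw [a1, a2, a3, b1, b2, b3, lowerOp, hy]
  have hz : den g I ^ (-(k - 2)) = den g I ^ (-k) * den g I ^ 2 := by
    rw [← zpow_natCast, ← zpow_add₀ hD]; congr 1; push_cast; ring
  have hz1 : den g I ^ (-k - 1) = den g I ^ (-k) * (den g I)⁻¹ := by
    rw [zpow_sub_one₀ hD]
  rw [hz, hz1]
  simp only [map_div₀, map_add, map_mul, map_pow, Complex.conj_I, Complex.conj_ofReal, map_ofNat]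
  have hden : den g I = g.1 1 0 * Complex.I + g.1 1 1 := rfl
  generalize starRingEnd ℂ (den g I) = Dc at *
  push_cast
  field_simp
  ring_nf
  simp only [Complex.I_sq]
  ring

/-- On functions of weight `k`, the element `R` acts by the raising operator. -/
theorem lie_R_lift (k : ℤ) {f : ℍ → ℂ} (hf : RSmooth f) :
    ⁅R, lift k f hf⁆ = lift (k + 2) (raiseOp k f) (hf.raiseOp k) := by
  refine Subtype.ext (funext fun g => ?_)
  rw [lie_apply_smoothFn, derivAlong_lift, derivAlong_lift, fderiv_eq_dz_dzbar, fderiv_eq_dz_dzbar,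
    lift_apply]
  have hD := den_ne_zero g I
  have hDc : (starRingEnd ℂ) (den g I) ≠ 0 := (map_ne_zero _).mpr hD
  have e1 : (rePart R).1 0 0 = 1 / 2 ∧ (rePart R).1 0 1 = 0 ∧ (rePart R).1 1 0 = 0 := by
    simp [rePart, R, tracelessMat]
  have e2 : (imPart R).1 0 0 = 0 ∧ (imPart R).1 0 1 = 1 / 2 ∧ (imPart R).1 1 0 = 1 / 2 := by
    simp [imPart, R, tracelessMat]
  obtain ⟨a1, a2, a3⟩ := e1
  obtain ⟨b1, b2, b3⟩ := e2
  rw [a1, a2, a3, b1, b2, b3, raiseOp, im_smul_I_inv]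
  have hz : den g I ^ (-(k + 2)) = den g I ^ (-k) * (den g I ^ 2)⁻¹ := by
    rw [← zpow_natCast, ← zpow_neg, ← zpow_add₀ hD]; congr 1; push_cast; ring
  have hz1 : den g I ^ (-k - 1) = den g I ^ (-k) * (den g I)⁻¹ := by
    rw [zpow_sub_one₀ hD]
  rw [hz, hz1]
  simp only [map_div₀, map_add, map_mul, map_pow, Complex.conj_I, Complex.conj_ofReal, map_ofNat]
  have hconj : starRingEnd ℂ (den g I) = - g.1 1 0 * Complex.I + g.1 1 1 := by
    simp [den]
  rw [hconj] at hDc ⊢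
  push_cast
  field_simp
  ring_nf
  simp only [Complex.I_sq]
  ring

end Lift
end NFin

end

noncomputable section

namespace NFin

open UpperHalfPlane Filter Asymptotics Function ModularForm Matrix.SpecialLinearGroup
open scoped Topology Real Manifold

/-! ### Weight vectors on the group and functions on the upper half plane. -/

section Weights

lemma rot_surjective (k : K) : ∃ θ : ℝ, rot θ = k := by
  obtain ⟨h1, h2⟩ := K_entries k
  have hr := DPlus.K_relation k
  obtain ⟨θ, hc, hs⟩ : ∃ θ : ℝ, Real.cos θ = k.1.1 0 0 ∧ Real.sin θ = k.1.1 0 1 := by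
    refine ⟨Complex.arg (k.1.1 0 0 + k.1.1 0 1 * Complex.I), ?_, ?_⟩
    · have hn : ‖((k.1.1 0 0 : ℂ) + k.1.1 0 1 * Complex.I)‖ = 1 := by
        rw [Complex.norm_add_mul_I, hr, Real.sqrt_one]
      rw [Complex.cos_arg (norm_ne_zero_iff.mp (by rw [hn]; exact one_ne_zero)), hn]; simp
    · have hn : ‖((k.1.1 0 0 : ℂ) + k.1.1 0 1 * Complex.I)‖ = 1 := by
        rw [Complex.norm_add_mul_I, hr, Real.sqrt_one]
      rw [Complex.sin_arg, hn]; simp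
  refine ⟨θ, Subtype.ext (Subtype.ext ?_)⟩
  ext i j
  fin_cases i <;> fin_cases j
  · exact hc
  · exact hs
  · exact (congrArg Neg.neg hs).trans h2.symm
  · exact hc.trans h1.symm

lemma chi_rot_zpow (θ : ℝ) (m : ℤ) : chi (rot θ) ^ m = Complex.exp (m * θ * Complex.I) := by
  rw [chi_rot, ← Complex.exp_int_mul]
  ring_nf

lemma mem_weightSpace_iff_chi {V : Type} [AddCommGroup V] [Module ℂ V] [LieRingModule 𝔤 V]
    [GKRep V] {m : ℤ} {v : V} :
    v ∈ weightSpace V m ↔ ∀ k : K, GKRep.rho k v = chi k ^ m • v := by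
  constructor
  · intro h k
    obtain ⟨θ, rfl⟩ := rot_surjective k
    rw [chi_rot_zpow]
    exact h θ
  · intro h θ
    rw [← chi_rot_zpow]
    exact h _

/-- The automorphy factor of `r(θ)` at `i` is `cos θ - i sin θ = e^{-iθ}`. Its power `-k` is the
character of weight `k`. -/
lemma chi_conj_mul (k : K) : den k.1 I * chi k = 1 := by
  obtain ⟨h1, h2⟩ := K_entries k
  have hr : ((k.1.1 0 0 : ℝ) : ℂ) ^ 2 + ((k.1.1 0 1 : ℝ) : ℂ) ^ 2 = 1 := by
    exact_mod_cast DPlus.K_relation k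
  change ((k.1.1 1 0 : ℂ) * Complex.I + k.1.1 1 1) * (k.1.1 0 0 + k.1.1 0 1 * Complex.I) = 1
  rw [h1, h2]
  push_cast
  linear_combination hr - (k.1.1 0 1 : ℂ) ^ 2 * Complex.I_sq

lemma den_K (k : K) : den k.1 I = (chi k)⁻¹ := eq_inv_of_mul_eq_one_left (chi_conj_mul k)

lemma smul_I_of_mem_K (k : K) : k.1 • I = I := by
  obtain ⟨h1, h2⟩ := K_entries k
  apply UpperHalfPlane.ext
  rw [coe_smul_SL, div_eq_iff (den_ne_zero _ _)]
  change (k.1.1 0 0 : ℂ) * Complex.I + k.1.1 0 1 =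
    Complex.I * ((k.1.1 1 0 : ℂ) * Complex.I + k.1.1 1 1)
  rw [h1, h2]
  push_cast
  linear_combination (k.1.1 0 1 : ℂ) * Complex.I_sq

lemma lift_mem_weightSpace (k : ℤ) {f : ℍ → ℂ} (hf : RSmooth f) :
    lift k f hf ∈ weightSpace SmoothFn k := by
  rw [mem_weightSpace_iff_chi]
  intro κ
  refine Subtype.ext (funext fun g => ?_)
  change den (g * κ.1) I ^ (-k) * f ((g * κ.1) • I) = chi κ ^ k * (den g I ^ (-k) * f (g • I))
  rw [den_mul, mul_smul, smul_I_of_mem_K, den_K, mul_zpow, inv_zpow, zpow_neg (chi κ), inv_inv]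
  ring

lemma apply_eq_chi_mul {k : ℤ} {Φ : SmoothFn} (hΦ : Φ ∈ weightSpace SmoothFn k) (g : SL(2, ℝ))
    (κ : K) : Φ.1 (g * κ.1) = chi κ ^ k * Φ.1 g :=
  congrFun (congrArg Subtype.val (mem_weightSpace_iff_chi.mp hΦ κ)) g

/-- The Iwasawa decomposition. -/
lemma exists_eq_sectionMat_mul (g : SL(2, ℝ)) : ∃ κ : K, g = sectionMat (g • I) * κ.1 := by
  set s := sectionMat (g • I)
  have h1 : (s⁻¹ * g) • I = I := by
    rw [mul_smul, inv_smul_eq_iff, sectionMat_smul_I]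
  refine ⟨⟨s⁻¹ * g, ?_⟩, by simp⟩
  set κ := s⁻¹ * g
  change κ.1 * κ.1.transpose = 1
  have h2 := coe_smul_SL κ I
  rw [h1, eq_div_iff (den_ne_zero _ _)] at h2
  change Complex.I * ((κ.1 1 0 : ℂ) * Complex.I + κ.1 1 1) =
    (κ.1 0 0 : ℂ) * Complex.I + κ.1 0 1 at h2
  have h3 := congrArg Complex.re h2
  have h4 := congrArg Complex.im h2
  simp at h3 h4
  have hd := det_entries κ
  rw [← h3, h4] at hd
  ext i j
  fin_cases i <;> fin_cases j <;> simp [Matrix.mul_apply, Fin.sum_univ_two] <;> simp only [← h3, h4] <;>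
    first | linear_combination hd | ring

lemma sqrt_zpow_eq_rpow {y : ℝ} (hy : 0 < y) (k : ℤ) : (Real.sqrt y)⁻¹ ^ (-k) = y ^ ((k : ℝ) / 2) := by
  rw [inv_zpow, zpow_neg, inv_inv, Real.sqrt_eq_rpow, ← Real.rpow_intCast, ← Real.rpow_mul hy.le]
  ring_nf

/-- A function of weight `k` is recovered from the function `tilde k Φ` on the upper half plane. -/
lemma slash_tilde {k : ℤ} {Φ : SmoothFn} (hΦ : Φ ∈ weightSpace SmoothFn k) (g : SL(2, ℝ)) :
    slash k (tilde k Φ.1) g I = Φ.1 g := by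
  obtain ⟨κ, hκ⟩ := exists_eq_sectionMat_mul g
  set τ := g • I
  have hy : 0 < τ.im := τ.im_pos
  rw [slash_eq, tilde]
  change den g I ^ (-k) * (((τ.im ^ (-(k : ℝ) / 2) : ℝ) : ℂ) * Φ.1 (sectionMat τ)) = _
  rw [hκ, apply_eq_chi_mul hΦ, den_mul, smul_I_of_mem_K, den_K, den_sectionMat, mul_zpow,
    inv_zpow, zpow_neg (chi κ), inv_inv, ← Complex.ofReal_zpow, sqrt_zpow_eq_rpow hy]
  have h : ((τ.im ^ ((k : ℝ) / 2) : ℝ) : ℂ) * ((τ.im ^ (-(k : ℝ) / 2) : ℝ) : ℂ) = 1 := by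
    rw [← Complex.ofReal_mul, ← Real.rpow_add hy]
    ring_nf
    simp
  linear_combination (chi κ ^ k * Φ.1 (sectionMat τ)) * h

lemma tilde_slash (k : ℤ) (f : ℍ → ℂ) : tilde k (fun g => slash k f g I) = f := by
  funext τ
  have hy : 0 < τ.im := τ.im_pos
  rw [tilde, slash_eq, den_sectionMat, sectionMat_smul_I, ← Complex.ofReal_zpow,
    sqrt_zpow_eq_rpow hy, ← mul_assoc, ← Complex.ofReal_mul, ← Real.rpow_add hy]
  ring_nf
  simp

lemma tilde_lift (k : ℤ) {f : ℍ → ℂ} (hf : RSmooth f) : tilde k (lift k f hf).1 = f :=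
  tilde_slash k f

lemma rsmooth_tilde (k : ℤ) (Φ : SmoothFn) : RSmooth (tilde k Φ.1) := by
  obtain ⟨F, hF⟩ := Φ.2
  refine RSmooth.of_eventuallyEq (F := fun z => ((z.im ^ (-(k : ℝ) / 2) : ℝ) : ℂ) *
    F (fun i j => (!![Real.sqrt z.im, z.re / Real.sqrt z.im; 0, 1 / Real.sqrt z.im] :
      Matrix (Fin 2) (Fin 2) ℝ) i j)) (fun τ => ?_) fun τ => by
      rw [tilde, ← (hF _).2]; rfl
  have hy : (τ : ℂ).im ≠ 0 := τ.im_pos.ne'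
  have him : ContDiffAt ℝ ∞ (fun z : ℂ => z.im) τ := Complex.imCLM.contDiff.contDiffAt
  have hre : ContDiffAt ℝ ∞ (fun z : ℂ => z.re) τ := Complex.reCLM.contDiff.contDiffAt
  have hs : ContDiffAt ℝ ∞ (fun z : ℂ => Real.sqrt z.im) τ := him.sqrt hy
  have hs0 : Real.sqrt (τ : ℂ).im ≠ 0 := (Real.sqrt_pos.mpr τ.im_pos).ne'
  refine ContDiffAt.mul ?_ ?_
  · exact Complex.ofRealCLM.contDiff.contDiffAt.comp (τ : ℂ) (him.rpow_const_of_ne hy)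
  · refine ContDiffAt.comp (τ : ℂ) (hF (sectionMat τ)).1 ?_
    refine contDiffAt_pi.mpr fun i => contDiffAt_pi.mpr fun j => ?_
    fin_cases i <;> fin_cases j
    · exact hs
    · exact hre.div hs hs0
    · exact contDiffAt_const
    · exact contDiffAt_const.div hs hs0

lemma lift_tilde {k : ℤ} {Φ : SmoothFn} (hΦ : Φ ∈ weightSpace SmoothFn k) :
    lift k (tilde k Φ.1) (rsmooth_tilde k Φ) = Φ :=
  Subtype.ext (funext fun g => slash_tilde hΦ g)

/-- `H` is a multiple of the generator of the stabilizer of `i`, so the point `g • i` does not move.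
Only the automorphy factor is differentiated, and this yields the factor `k`. -/
lemma lie_H_lift (k : ℤ) {f : ℍ → ℂ} (hf : RSmooth f) :
    ⁅H, lift k f hf⁆ = (k : ℂ) • lift k f hf := by
  refine Subtype.ext (funext fun g => ?_)
  rw [lie_apply_smoothFn, derivAlong_lift, derivAlong_lift]
  change _ = (k : ℂ) * (den g I ^ (-k) * f (g • I))
  have hD := den_ne_zero g I
  have e1 : (rePart H).1 0 0 = 0 ∧ (rePart H).1 0 1 = 0 ∧ (rePart H).1 1 0 = 0 := by
    simp [rePart, H, tracelessMat]
  have e2 : (imPart H).1 0 0 = 0 ∧ (imPart H).1 0 1 = -1 ∧ (imPart H).1 1 0 = 1 := by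
    simp [imPart, H, tracelessMat]
  obtain ⟨a1, a2, a3⟩ := e1
  obtain ⟨b1, b2, b3⟩ := e2
  rw [a1, a2, a3, b1, b2, b3, zpow_sub_one₀ hD]
  have hden : g.1 1 1 = den g I - g.1 1 0 * Complex.I := by simp [den]
  have h0 : (2 * ((0 : ℝ) : ℂ) * Complex.I + ((-1 : ℝ) : ℂ) + ((1 : ℝ) : ℂ)) / den g I ^ 2 = 0 := by
    simp
  rw [h0]
  simp only [hden, Complex.ofReal_zero, mul_zero, zero_mul, add_zero, zero_div, map_zero]
  push_cast
  field_simp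
  linear_combination (k * den g I ^ (-k) * f (g • I) * (Complex.I * g.1 1 0 - den g I)) *
    Complex.I_sq

end Weights
end NFin

end

noncomputable section

namespace NFin

open UpperHalfPlane Filter Asymptotics Function ModularForm Matrix.SpecialLinearGroup
open scoped Topology Real Manifold

/-! ### Finite-dimensional `K`-stable spaces are sums of weight spaces. -/

section KFinite

lemma lie_H_of_mem_weightSpace {m : ℤ} {Φ : SmoothFn} (hΦ : Φ ∈ weightSpace SmoothFn m) :
    ⁅H, Φ⁆ = (m : ℂ) • Φ := by
  rw [← lift_tilde hΦ]; exact lie_H_lift m _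

/-- The infinitesimal form of `exp(tY) k = k exp(tX)`, valid because `Y = k X k⁻¹`. -/
lemma derivAlong_rightTranslate (k : SL(2, ℝ)) (X Y : 𝔤ℝ) (h : Y.1 * k.1 = k.1 * X.1)
    (Φ : SmoothFn) (g : SL(2, ℝ)) :
    derivAlong Y (rightTranslate k Φ).1 g = derivAlong X Φ.1 (g * k) := by
  obtain ⟨F, hF⟩ := Φ.2
  have hF' : ∀ g : SL(2, ℝ), ContDiffAt ℝ ∞ (fun A => F (mulR k.1 A)) (entries g) ∧
      F (mulR k.1 (entries g)) = (rightTranslate k Φ).1 g := by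
    intro g
    have h := hF (g * k)
    rw [entries_mul] at h
    exact ⟨ContDiffAt.comp (entries g) h.1 (mulR k.1).contDiff.contDiffAt, h.2⟩
  refine (derivAlong_eq hF' Y g).trans (Eq.trans ?_ (derivAlong_eq hF X (g * k)).symm)
  have h1 : HasFDerivAt F (fderiv ℝ F (entries (g * k))) (mulR k.1 (entries g)) := by
    rw [← entries_mul]
    exact ((hF (g * k)).1.differentiableAt (by simp)).hasFDerivAt
  have h2 := h1.comp (entries g) (mulR k.1).hasFDerivAt
  have h3 : fderiv ℝ (fun A => F (mulR k.1 A)) (entries g) =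
      (fderiv ℝ F (entries (g * k))).comp (mulR k.1) := h2.fderiv
  rw [h3, ContinuousLinearMap.comp_apply]
  congr 1
  rw [entries_mul]
  funext i j
  have h00 := congrFun (congrFun h 0) j
  have h10 := congrFun (congrFun h 1) j
  simp only [Matrix.mul_apply, Fin.sum_univ_two] at h00 h10
  simp only [mulR_apply]
  linear_combination entries g i 0 * h00 + entries g i 1 * h10

lemma rho_lie_smoothFn (k : K) (X : 𝔤) (Φ : SmoothFn) :
    GKRep.rho k ⁅X, Φ⁆ = ⁅Ad k X, GKRep.rho k Φ⁆ := by
  refine Subtype.ext (funext fun g => ?_)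
  change (⁅X, Φ⁆ : SmoothFn).1 (g * k.1) = (⁅Ad k X, rightTranslate k.1 Φ⁆ : SmoothFn).1 g
  have hmul : (Ad k X).1 * k.1.1.map Complex.ofReal = k.1.1.map Complex.ofReal * X.1 := by
    have h1 : (k⁻¹).1.1 * k.1.1 = 1 := by
      rw [← Matrix.SpecialLinearGroup.coe_mul, ← Subgroup.coe_mul, inv_mul_cancel]; simp
    have h2 := Matrix.map_mul (L := (k⁻¹).1.1) (M := k.1.1) (f := Complex.ofRealHom)
    rw [h1] at h2
    change k.1.1.map Complex.ofReal * X.1 * (k⁻¹).1.1.map Complex.ofReal *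
      k.1.1.map Complex.ofReal = _
    rw [Matrix.mul_assoc]
    have h3 : (k⁻¹).1.1.map Complex.ofReal * k.1.1.map Complex.ofReal = 1 := by
      refine h2.symm.trans ?_
      simp
    rw [h3, Matrix.mul_one]
  -- Because `k` is a real matrix, the intertwining relation splits into its real and imaginary
  -- parts.
  have hre : (rePart (Ad k X)).1 * k.1.1 = k.1.1 * (rePart X).1 := by
    ext i j
    have := congrArg Complex.re (congrFun (congrFun hmul i) j)
    simp only [Matrix.mul_apply, Fin.sum_univ_two, Matrix.map_apply, Complex.add_re,
      Complex.re_mul_ofReal, Complex.re_ofReal_mul] at this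
    simp only [Matrix.mul_apply, Fin.sum_univ_two]
    exact this
  have him : (imPart (Ad k X)).1 * k.1.1 = k.1.1 * (imPart X).1 := by
    ext i j
    have := congrArg Complex.im (congrFun (congrFun hmul i) j)
    simp only [Matrix.mul_apply, Fin.sum_univ_two, Matrix.map_apply, Complex.add_im,
      Complex.im_mul_ofReal, Complex.im_ofReal_mul] at this
    simp only [Matrix.mul_apply, Fin.sum_univ_two]
    exact this
  rw [lie_apply_smoothFn, lie_apply_smoothFn, derivAlong_rightTranslate k.1 _ _ hre,
    derivAlong_rightTranslate k.1 _ _ him]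

/-- `H` is `-i` times the derivative of the right translation by `r(θ)`. -/
lemma hasDerivAt_rot (Φ : SmoothFn) (g : SL(2, ℝ)) (θ : ℝ) :
    HasDerivAt (fun t : ℝ => Φ.1 (g * (rot t).1))
      (Complex.I * (⁅H, Φ⁆ : SmoothFn).1 (g * (rot θ).1)) θ := by
  obtain ⟨F, hF⟩ := Φ.2
  have hH : Complex.I * (⁅H, Φ⁆ : SmoothFn).1 (g * (rot θ).1) =
      fderiv ℝ F (entries (g * (rot θ).1)) (mulR !![0, 1; -1, 0] (entries (g * (rot θ).1))) := by
    rw [lie_apply_smoothFn, derivAlong_eq hF, derivAlong_eq hF]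
    have h1 : mulR (rePart H).1 (entries (g * (rot θ).1)) = 0 := by
      funext i j
      fin_cases j <;> simp [mulR_apply, rePart, H, tracelessMat]
    have h2 : mulR (imPart H).1 (entries (g * (rot θ).1)) =
        -mulR !![0, 1; -1, 0] (entries (g * (rot θ).1)) := by
      funext i j
      fin_cases j <;> simp [mulR_apply, imPart, H, tracelessMat]
    rw [h1, h2, map_zero, map_neg]
    linear_combination (-fderiv ℝ F (entries (g * (rot θ).1))
      (mulR !![0, 1; -1, 0] (entries (g * (rot θ).1)))) * Complex.I_sq
  rw [hH]
  have hcurve : HasDerivAt (fun t : ℝ => entries (g * (rot t).1))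
      (mulR !![0, 1; -1, 0] (entries (g * (rot θ).1))) θ := by
    refine hasDerivAt_pi.mpr fun i => hasDerivAt_pi.mpr fun j => ?_
    have hc := Real.hasDerivAt_cos θ
    have hs := Real.hasDerivAt_sin θ
    simp only [entries_mul, mulR_apply]
    fin_cases j
    · refine ((hc.const_mul (entries g i 0)).add (hs.neg.const_mul (entries g i 1))).congr_deriv ?_
      simp [rot]; ring
    · refine ((hs.const_mul (entries g i 0)).add (hc.const_mul (entries g i 1))).congr_deriv ?_
      simp [rot]
  have h3 : HasFDerivAt F (fderiv ℝ F (entries (g * (rot θ).1))) (entries (g * (rot θ).1)) :=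
    ((hF _).1.differentiableAt (by simp)).hasFDerivAt
  refine (h3.comp_hasDerivAt θ hcurve).congr_of_eventuallyEq (Eventually.of_forall fun t => ?_)
  exact (hF _).2.symm

lemma rot_zero : (rot 0).1 = 1 := by
  apply Subtype.ext
  ext i j
  fin_cases i <;> fin_cases j <;> simp [rot]

lemma rot_two_pi : (rot (2 * π)).1 = 1 := by
  apply Subtype.ext
  ext i j
  fin_cases i <;> fin_cases j <;> simp [rot]

/-- Along `θ ↦ g r(θ)` the eigenvalue equation is the differential equation `y' = i c y`, and
`e^{-icθ} y` is constant for its solutions. -/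
lemma apply_mul_rot_of_eigen {c : ℂ} {Ψ : SmoothFn} (hΨ : ⁅H, Ψ⁆ = c • Ψ) (g : SL(2, ℝ)) (θ : ℝ) :
    Complex.exp (-c * θ * Complex.I) * Ψ.1 (g * (rot θ).1) = Ψ.1 g := by
  have hd : ∀ t : ℝ, HasDerivAt
      (fun t : ℝ => Complex.exp (-c * t * Complex.I) * Ψ.1 (g * (rot t).1)) 0 t := by
    intro t
    have he : HasDerivAt (fun t : ℝ => Complex.exp (-c * t * Complex.I))
        (Complex.exp (-c * t * Complex.I) * (-c * Complex.I)) t := by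
      have h1 : HasDerivAt (fun t : ℝ => (t : ℂ)) 1 t := Complex.ofRealCLM.hasDerivAt
      exact (((h1.const_mul (-c)).mul_const Complex.I).cexp).congr_deriv (by ring)
    refine (he.mul (hasDerivAt_rot Ψ g t)).congr_deriv ?_
    rw [hΨ]
    change _ + _ * (Complex.I * (c * Ψ.1 (g * (rot t).1))) = 0
    ring
  have := is_const_of_deriv_eq_zero (fun t => (hd t).differentiableAt) (fun t => (hd t).deriv) θ 0
  simpa [rot_zero] using this

/-- Since `r(2π) = 1`, the solution `e^{icθ}` of the preceding equation must be `2π`-periodic. -/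
lemma exists_int_of_eigen {c : ℂ} {Ψ : SmoothFn} (hΨ : ⁅H, Ψ⁆ = c • Ψ) (h0 : Ψ ≠ 0) :
    ∃ m : ℤ, c = m := by
  obtain ⟨g, hg⟩ : ∃ g, Ψ.1 g ≠ 0 := by
    by_contra! h
    exact h0 (Subtype.ext (funext h))
  have h := apply_mul_rot_of_eigen hΨ g (2 * π)
  rw [rot_two_pi, mul_one] at h
  have h1 : Complex.exp (-c * (2 * π : ℝ) * Complex.I) = 1 := mul_right_cancel₀ hg (by rw [h, one_mul])
  obtain ⟨n, hn⟩ := Complex.exp_eq_one_iff.mp h1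
  refine ⟨-n, ?_⟩
  push_cast at hn ⊢
  have hpi : (2 * π * Complex.I : ℂ) ≠ 0 := Complex.two_pi_I_ne_zero
  have : (2 * π * Complex.I : ℂ) * (-c) = (2 * π * Complex.I) * n := by linear_combination hn
  linear_combination -(mul_left_cancel₀ hpi this)

lemma mem_weightSpace_of_eigen {m : ℤ} {Ψ : SmoothFn} (hΨ : ⁅H, Ψ⁆ = (m : ℂ) • Ψ) :
    Ψ ∈ weightSpace SmoothFn m := by
  intro θ
  refine Subtype.ext (funext fun g => ?_)
  change Ψ.1 (g * (rot θ).1) = Complex.exp (m * θ * Complex.I) * Ψ.1 g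
  rw [← apply_mul_rot_of_eigen hΨ g θ, ← mul_assoc, ← Complex.exp_add]
  ring_nf
  simp

/-- Generalized eigenvectors of `H` are eigenvectors. -/
lemma eigen_of_generalized {c : ℂ} {Φ Ψ : SmoothFn} (hΦ : ⁅H, Φ⁆ = c • Φ + Ψ)
    (hΨ : ⁅H, Ψ⁆ = c • Ψ) : Ψ = 0 := by
  by_contra h0
  obtain ⟨m, rfl⟩ := exists_int_of_eigen hΨ h0
  refine h0 (Subtype.ext (funext fun g => ?_))
  -- A Jordan block would produce linear growth in `t`: the function below is constant. Comparing `t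
  -- = 0` with `t = 2π`, where everything else is periodic, leaves `2πi Ψ(g) = 0`.
  have hd : ∀ t : ℝ, HasDerivAt (fun t : ℝ => Complex.exp (-(m : ℂ) * t * Complex.I) *
      Φ.1 (g * (rot t).1) - Complex.I * t * Ψ.1 g) 0 t := by
    intro t
    have h1 : HasDerivAt (fun t : ℝ => (t : ℂ)) 1 t := Complex.ofRealCLM.hasDerivAt
    have he : HasDerivAt (fun t : ℝ => Complex.exp (-(m : ℂ) * t * Complex.I))
        (Complex.exp (-(m : ℂ) * t * Complex.I) * (-(m : ℂ) * Complex.I)) t :=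
      (((h1.const_mul (-(m : ℂ))).mul_const Complex.I).cexp).congr_deriv (by ring)
    refine ((he.mul (hasDerivAt_rot Φ g t)).sub
      ((h1.const_mul Complex.I).mul_const (Ψ.1 g))).congr_deriv ?_
    rw [hΦ, ← apply_mul_rot_of_eigen hΨ g t]
    change _ + _ * (Complex.I * ((m : ℂ) * Φ.1 (g * (rot t).1) + Ψ.1 (g * (rot t).1))) - _ = 0
    ring
  have := is_const_of_deriv_eq_zero (fun t => (hd t).differentiableAt) (fun t => (hd t).deriv)
    (2 * π) 0
  simp only [rot_two_pi, rot_zero] at this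
  have h1 : Complex.exp (-(m : ℂ) * (2 * π : ℝ) * Complex.I) = 1 :=
    Complex.exp_eq_one_iff.mpr ⟨-m, by push_cast; ring⟩
  rw [h1] at this
  simpa using this

/-- A finite-dimensional space of smooth functions that is stable under `K` is stable under `H`. -/
lemma lie_H_mem_of_finiteDimensional (W : Submodule ℂ SmoothFn) [FiniteDimensional ℂ W]
    (hW : ∀ k : K, ∀ Φ ∈ W, GKRep.rho k Φ ∈ W) {Φ : SmoothFn} (hΦ : Φ ∈ W) : ⁅H, Φ⁆ ∈ W := by
  set W' : Submodule ℂ (SL(2, ℝ) → ℂ) := W.map smoothFunctions.subtype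
  -- Finite-dimensional subspaces are closed for pointwise convergence, so the limit `iHΦ` of the
  -- difference quotients of the `K`-action stays in the space.
  have hclosed : IsClosed (W' : Set (SL(2, ℝ) → ℂ)) := W'.closed_of_finiteDimensional
  have hlim : Tendsto (fun t : ℝ => (t⁻¹ : ℝ) • ((GKRep.rho (rot t) Φ - Φ : SmoothFn).1))
      (𝓝[≠] 0) (𝓝 (Complex.I • (⁅H, Φ⁆ : SmoothFn).1)) := by
    rw [tendsto_pi_nhds]
    intro g
    have h := (hasDerivAt_rot Φ g 0).tendsto_slope_zero
    simp only [zero_add, rot_zero, mul_one] at h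
    exact h
  have hmem : Complex.I • (⁅H, Φ⁆ : SmoothFn).1 ∈ W' := by
    refine hclosed.mem_of_tendsto hlim (Eventually.of_forall fun t => ?_)
    have h1 : ((t⁻¹ : ℝ) : ℂ) • (GKRep.rho (rot t) Φ - Φ) ∈ W :=
      W.smul_mem _ (W.sub_mem (hW _ _ hΦ) hΦ)
    refine ⟨_, h1, ?_⟩
    funext g
    change ((t⁻¹ : ℝ) : ℂ) * _ = (t⁻¹ : ℝ) • _
    rw [Complex.real_smul]
  obtain ⟨Ψ, hΨ, hΨ'⟩ := hmem
  have : Ψ = Complex.I • ⁅H, Φ⁆ := Subtype.ext hΨ'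
  have h2 : ⁅H, Φ⁆ = (-Complex.I) • Ψ := by
    rw [this, smul_smul]; simp
  rw [h2]
  exact W.smul_mem _ hΨ

/-- An endomorphism of a finite-dimensional space without generalized eigenvectors of rank two is
diagonalizable. -/
lemma iSup_eigenspace_eq_top {V : Type*} [AddCommGroup V] [Module ℂ V] [FiniteDimensional ℂ V]
    (T : Module.End ℂ V) (hT : ∀ (c : ℂ) (w v : V), T w = c • w + v → T v = c • v → v = 0) :
    ⨆ c : ℂ, T.eigenspace c = ⊤ := by
  have hgen : ∀ (c : ℂ) (n : ℕ) (w : V), ((T - algebraMap ℂ (Module.End ℂ V) c) ^ n) w = 0 →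
      T w = c • w := by
    intro c n
    induction n with
    | zero => intro w hw; rw [pow_zero] at hw; have : w = 0 := hw; simp [this]
    | succ n ih =>
      intro w hw
      rw [pow_succ] at hw
      have h1 := ih _ hw
      set v := (T - algebraMap ℂ (Module.End ℂ V) c) w with hv
      have h2 : T w = c • w + v := by
        rw [hv, LinearMap.sub_apply, Module.algebraMap_end_apply]; abel
      rw [h2, hT c w v h2 h1, add_zero]
  rw [eq_top_iff, ← Module.End.iSup_maxGenEigenspace_eq_top T]
  refine iSup_mono fun c w hw => ?_
  rw [Module.End.mem_maxGenEigenspace] at hw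
  obtain ⟨n, hn⟩ := hw
  rw [Module.End.mem_eigenspace_iff]
  exact hgen c n w hn

/-- A finite-dimensional space of smooth functions that is stable under `K` is the sum of its
weight spaces. -/
theorem le_iSup_weightSpace (W : Submodule ℂ SmoothFn) [FiniteDimensional ℂ W]
    (hW : ∀ k : K, ∀ Φ ∈ W, GKRep.rho k Φ ∈ W) :
    W ≤ ⨆ m : ℤ, weightSpace SmoothFn m ⊓ W := by
  let T : W →ₗ[ℂ] W := LinearMap.restrict (LieModule.toEnd ℂ 𝔤 SmoothFn H)
    fun Φ hΦ => lie_H_mem_of_finiteDimensional W hW hΦ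
  have hT : ∀ w : W, (T w : SmoothFn) = ⁅H, (w : SmoothFn)⁆ := fun w => rfl
  have htop := iSup_eigenspace_eq_top (V := W) T (fun c w v h1 h2 => by
      have h1' : ⁅H, (w : SmoothFn)⁆ = c • (w : SmoothFn) + (v : SmoothFn) := by
        rw [← hT, h1]; rfl
      have h2' : ⁅H, (v : SmoothFn)⁆ = c • (v : SmoothFn) := by
        rw [← hT, h2]; rfl
      exact Subtype.ext (eigen_of_generalized h1' h2'))
  intro Φ hΦ
  have hmem : (⟨Φ, hΦ⟩ : W) ∈ (⊤ : Submodule ℂ W) := trivial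
  rw [← htop] at hmem
  refine (iSup_le (a := (⨆ m : ℤ, weightSpace SmoothFn m ⊓ W).comap W.subtype)
    fun c w hw => ?_ : _ ≤ (⨆ m : ℤ, weightSpace SmoothFn m ⊓ W).comap W.subtype) hmem
  rw [Module.End.mem_eigenspace_iff] at hw
  have h1 : ⁅H, w.1⁆ = c • w.1 := by rw [← hT, hw]; rfl
  by_cases h0 : w.1 = 0
  · rw [Submodule.mem_comap, Submodule.subtype_apply, h0]; exact Submodule.zero_mem _
  · obtain ⟨m, rfl⟩ := exists_int_of_eigen h1 h0
    exact Submodule.mem_iSup_of_mem m ⟨mem_weightSpace_of_eigen h1, w.2⟩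

end KFinite
end NFin

end

noncomputable section

namespace NFin

open UpperHalfPlane Filter Asymptotics Function ModularForm Matrix.SpecialLinearGroup
open scoped Topology Real Manifold

/-! ### Raising and lowering operators on `y^{-j} g` with `g` holomorphic. -/

section Wirtinger

lemma differentiableAt_of_mdiff {g : ℍ → ℂ} (hg : MDiff g) (τ : ℍ) :
    DifferentiableAt ℂ (g ∘ ofComplex) (τ : ℂ) :=
  (UpperHalfPlane.mdifferentiable_iff.mp hg).differentiableAt
    (isOpen_upperHalfPlaneSet.mem_nhds τ.im_pos)

lemma rsmooth_of_mdiff {g : ℍ → ℂ} (hg : MDiff g) : RSmooth g := fun τ =>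
  (((UpperHalfPlane.mdifferentiable_iff.mp hg).contDiffOn isOpen_upperHalfPlaneSet).contDiffAt
    (isOpen_upperHalfPlaneSet.mem_nhds τ.im_pos)).restrict_scalars ℝ

/-- The derivative of a function on the upper half plane. -/
def cderiv (g : ℍ → ℂ) (τ : ℍ) : ℂ := deriv (g ∘ ofComplex) (τ : ℂ)

lemma mdiff_cderiv {g : ℍ → ℂ} (hg : MDiff g) : MDiff (cderiv g) := by
  rw [UpperHalfPlane.mdifferentiable_iff]
  refine ((UpperHalfPlane.mdifferentiable_iff.mp hg).deriv isOpen_upperHalfPlaneSet).congr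
    fun z hz => ?_
  rw [comp_apply, cderiv, ofComplex_apply_of_im_pos hz]

lemma hasFDerivAt_of_mdiff {g : ℍ → ℂ} (hg : MDiff g) (τ : ℍ) :
    HasFDerivAt (g ∘ ofComplex) ((ContinuousLinearMap.toSpanSingleton ℂ (cderiv g τ)).restrictScalars ℝ)
      (τ : ℂ) :=
  (differentiableAt_of_mdiff hg τ).hasDerivAt.hasFDerivAt.restrictScalars ℝ

/-- Without its `τ̄`-part the real differential is multiplication by `dz f`, hence complex linear.
-/
lemma mdiff_of_dzbar_eq_zero {f : ℍ → ℂ} (hf : RSmooth f) (h : ∀ τ, dzbar f τ = 0) : MDiff f := by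
  rw [UpperHalfPlane.mdifferentiable_iff]
  intro z hz
  have hd : HasFDerivAt (f ∘ ofComplex) (fderiv ℝ (f ∘ ofComplex) z) z :=
    ((hf ⟨z, hz⟩).differentiableAt (by simp)).hasFDerivAt
  have h2 : HasFDerivAt (f ∘ ofComplex) (ContinuousLinearMap.toSpanSingleton ℂ (dz f ⟨z, hz⟩)) z := by
    refine hasFDerivAt_of_restrictScalars ℝ hd (ContinuousLinearMap.ext fun w => ?_)
    have := fderiv_eq_dz_dzbar f ⟨z, hz⟩ w
    rw [h, zero_mul, add_zero] at this
    refine Eq.trans ?_ this.symm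
    simp [mul_comm]
  exact h2.differentiableAt.differentiableWithinAt

lemma dz_add {f g : ℍ → ℂ} (hf : RSmooth f) (hg : RSmooth g) (τ : ℍ) :
    dz (f + g) τ = dz f τ + dz g τ := by
  have h : fderiv ℝ ((f + g) ∘ ofComplex) τ =
      fderiv ℝ (f ∘ ofComplex) τ + fderiv ℝ (g ∘ ofComplex) τ :=
    fderiv_add ((hf τ).differentiableAt (by simp)) ((hg τ).differentiableAt (by simp))
  simp only [dz, h, add_apply]
  ring

lemma dzbar_add {f g : ℍ → ℂ} (hf : RSmooth f) (hg : RSmooth g) (τ : ℍ) :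
    dzbar (f + g) τ = dzbar f τ + dzbar g τ := by
  have h : fderiv ℝ ((f + g) ∘ ofComplex) τ =
      fderiv ℝ (f ∘ ofComplex) τ + fderiv ℝ (g ∘ ofComplex) τ :=
    fderiv_add ((hf τ).differentiableAt (by simp)) ((hg τ).differentiableAt (by simp))
  simp only [dzbar, h, add_apply]
  ring

lemma fderiv_const_smul_comp {f : ℍ → ℂ} (hf : RSmooth f) (c : ℂ) (τ : ℍ) :
    fderiv ℝ ((c • f) ∘ ofComplex) τ = c • fderiv ℝ (f ∘ ofComplex) τ :=
  fderiv_const_smul ((hf τ).differentiableAt (by simp)) c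

lemma dz_smul {f : ℍ → ℂ} (hf : RSmooth f) (c : ℂ) (τ : ℍ) : dz (c • f) τ = c * dz f τ := by
  simp only [dz, fderiv_const_smul_comp hf, smul_apply, smul_eq_mul]
  ring

lemma dzbar_smul {f : ℍ → ℂ} (hf : RSmooth f) (c : ℂ) (τ : ℍ) :
    dzbar (c • f) τ = c * dzbar f τ := by
  simp only [dzbar, fderiv_const_smul_comp hf, smul_apply, smul_eq_mul]
  ring

lemma RSmooth.add {f g : ℍ → ℂ} (hf : RSmooth f) (hg : RSmooth g) : RSmooth (f + g) :=
  fun τ => (hf τ).add (hg τ)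

lemma RSmooth.smul {f : ℍ → ℂ} (hf : RSmooth f) (c : ℂ) : RSmooth (c • f) :=
  fun τ => contDiffAt_const.smul (hf τ)

lemma RSmooth.zero : RSmooth 0 := fun _ => contDiffAt_const

lemma lowerOp_add {f g : ℍ → ℂ} (hf : RSmooth f) (hg : RSmooth g) :
    NFin.lowerOp (f + g) = NFin.lowerOp f + NFin.lowerOp g := by
  funext τ
  simp only [NFin.lowerOp, dzbar_add hf hg, Pi.add_apply]
  ring

lemma lowerOp_smul {f : ℍ → ℂ} (hf : RSmooth f) (c : ℂ) :
    NFin.lowerOp (c • f) = c • NFin.lowerOp f := by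
  funext τ
  simp only [NFin.lowerOp, dzbar_smul hf, Pi.smul_apply, smul_eq_mul]
  ring

lemma raiseOp_add (k : ℤ) {f g : ℍ → ℂ} (hf : RSmooth f) (hg : RSmooth g) :
    NFin.raiseOp k (f + g) = NFin.raiseOp k f + NFin.raiseOp k g := by
  funext τ
  simp only [NFin.raiseOp, dz_add hf hg, Pi.add_apply]
  ring

lemma raiseOp_smul (k : ℤ) {f : ℍ → ℂ} (hf : RSmooth f) (c : ℂ) :
    NFin.raiseOp k (c • f) = c • NFin.raiseOp k f := by
  funext τ
  simp only [NFin.raiseOp, dz_smul hf, Pi.smul_apply, smul_eq_mul]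
  ring

/-- The function `y^{-j} g`. -/
def imPowMul (j : ℕ) (g : ℍ → ℂ) (τ : ℍ) : ℂ := ((τ.im : ℂ)⁻¹) ^ j * g τ

lemma imPowMul_smul (j : ℕ) (c : ℂ) (g : ℍ → ℂ) : imPowMul j (c • g) = c • imPowMul j g := by
  funext τ; simp [imPowMul, mul_left_comm]

lemma hasFDerivAt_imPowMul (j : ℕ) {g : ℍ → ℂ} (hg : MDiff g) (τ : ℍ) :
    HasFDerivAt (imPowMul j g ∘ ofComplex)
      ((((τ.im : ℂ)⁻¹) ^ j * cderiv g τ) • ContinuousLinearMap.restrictScalars ℝ (1 : ℂ →L[ℂ] ℂ) +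
        (-j * ((τ.im : ℂ)⁻¹) ^ (j + 1) * g τ) • (Complex.ofRealCLM ∘L Complex.imCLM)) (τ : ℂ) := by
  have hy : (((τ : ℂ).im : ℝ) : ℂ) ≠ 0 := by exact_mod_cast τ.im_pos.ne'
  have h0 : HasFDerivAt (fun z : ℂ => (z.im : ℂ)) (Complex.ofRealCLM ∘L Complex.imCLM) (τ : ℂ) :=
    (Complex.ofRealCLM ∘L Complex.imCLM).hasFDerivAt
  have h1 : HasDerivAt (fun w : ℂ => (w⁻¹) ^ j) (-j * (((τ : ℂ).im : ℂ)⁻¹) ^ (j + 1))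
      (((τ : ℂ).im : ℝ) : ℂ) := by
    refine ((hasDerivAt_inv hy).pow j).congr_deriv ?_
    rcases j with _ | j
    · simp
    · rw [Nat.add_sub_cancel]
      push_cast
      ring
  have h2 := (h1.hasFDerivAt.restrictScalars ℝ).comp (τ : ℂ) h0
  have h3 := h2.mul (hasFDerivAt_of_mdiff hg τ)
  refine (h3.congr_fderiv ?_).congr_of_eventuallyEq ?_
  · refine ContinuousLinearMap.ext fun w => ?_
    simp
    ring
  · filter_upwards [isOpen_upperHalfPlaneSet.mem_nhds τ.im_pos] with z hz
    simp only [Pi.mul_apply, comp_apply, imPowMul, ofComplex_apply_of_im_pos hz]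
    rfl

lemma rsmooth_imPowMul (j : ℕ) {g : ℍ → ℂ} (hg : MDiff g) : RSmooth (imPowMul j g) := by
  refine RSmooth.of_eventuallyEq (F := fun z => ((z.im : ℂ)⁻¹) ^ j * (g ∘ ofComplex) z)
    (fun τ => ?_) fun τ => by rw [comp_apply, ofComplex_apply]; rfl
  have hy : (((τ : ℂ).im : ℝ) : ℂ) ≠ 0 := by exact_mod_cast τ.im_pos.ne'
  exact (((contDiffAt_im _).inv hy).pow j).mul (rsmooth_of_mdiff hg τ)

lemma dz_imPowMul (j : ℕ) {g : ℍ → ℂ} (hg : MDiff g) (τ : ℍ) :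
    dz (imPowMul j g) τ = ((τ.im : ℂ)⁻¹) ^ j * cderiv g τ +
      j * (Complex.I / 2) * ((τ.im : ℂ)⁻¹) ^ (j + 1) * g τ := by
  rw [dz, (hasFDerivAt_imPowMul j hg τ).fderiv]
  simp
  linear_combination (-((τ.im : ℂ)⁻¹) ^ j * cderiv g τ / 2) * Complex.I_sq

lemma dzbar_imPowMul (j : ℕ) {g : ℍ → ℂ} (hg : MDiff g) (τ : ℍ) :
    dzbar (imPowMul j g) τ = -j * (Complex.I / 2) * ((τ.im : ℂ)⁻¹) ^ (j + 1) * g τ := by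
  rw [dzbar, (hasFDerivAt_imPowMul j hg τ).fderiv]
  simp
  linear_combination (((τ.im : ℂ)⁻¹) ^ j * cderiv g τ / 2) * Complex.I_sq

lemma lowerOp_imPowMul_zero {g : ℍ → ℂ} (hg : MDiff g) : NFin.lowerOp (imPowMul 0 g) = 0 := by
  funext τ
  simp [NFin.lowerOp, dzbar_imPowMul 0 hg]

/-- Only `y^{-(j+1)}` depends on `τ̄`. The factor `y²` in the operator offsets the rise of the
exponent caused by differentiation, so the power of `1/y` drops by exactly one. -/
lemma lowerOp_imPowMul_succ (j : ℕ) {g : ℍ → ℂ} (hg : MDiff g) :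
    NFin.lowerOp (imPowMul (j + 1) g) = (-(j + 1 : ℂ)) • imPowMul j g := by
  funext τ
  have hy : (τ.im : ℂ) ≠ 0 := by exact_mod_cast τ.im_pos.ne'
  simp only [NFin.lowerOp, dzbar_imPowMul (j + 1) hg, Pi.smul_apply, imPowMul, smul_eq_mul]
  have h : (τ.im : ℂ) ^ 2 * ((τ.im : ℂ)⁻¹) ^ (j + 1 + 1) = ((τ.im : ℂ)⁻¹) ^ j := by
    simp only [inv_pow]
    field_simp
    ring
  push_cast
  linear_combination ((j + 1) * Complex.I ^ 2 * g τ) * h +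
    ((j + 1) * ((τ.im : ℂ)⁻¹) ^ j * g τ) * Complex.I_sq

lemma raiseOp_imPowMul (k : ℤ) (j : ℕ) {g : ℍ → ℂ} (hg : MDiff g) :
    NFin.raiseOp k (imPowMul j g) =
      (2 * Complex.I) • imPowMul j (cderiv g) + (k - j : ℂ) • imPowMul (j + 1) g := by
  funext τ
  simp only [NFin.raiseOp, dz_imPowMul j hg, Pi.add_apply, Pi.smul_apply, imPowMul, smul_eq_mul]
  linear_combination (j * ((τ.im : ℂ)⁻¹) ^ (j + 1) * g τ) * Complex.I_sq

lemma imPowMul_zero (g : ℍ → ℂ) : imPowMul 0 g = g := by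
  funext τ; simp [imPowMul]

lemma mdiff_iff_lowerOp_eq_zero {f : ℍ → ℂ} (hf : RSmooth f) :
    MDiff f ↔ NFin.lowerOp f = 0 := by
  constructor
  · intro h
    rw [← imPowMul_zero f]
    exact lowerOp_imPowMul_zero h
  · intro h
    refine mdiff_of_dzbar_eq_zero hf fun τ => ?_
    have hy : (τ.im : ℂ) ≠ 0 := by exact_mod_cast τ.im_pos.ne'
    have h1 : -2 * Complex.I * (τ.im : ℂ) ^ 2 * dzbar f τ = 0 := congrFun h τ
    simpa [hy] using h1

end Wirtinger

/-! ### Nearly holomorphic functions and the growth of their coefficients. -/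

section NearlyHolomorphic

/-- A function annihilated by a power of the lowering operator is a polynomial in `1 / y` with
holomorphic coefficients. -/
lemma exists_sum_of_iterate_lowerOp_eq_zero (v : ℕ) {f : ℍ → ℂ} (hf : RSmooth f)
    (h : (NFin.lowerOp^[v]) f = 0) :
    ∃ g : ℕ → ℍ → ℂ, (∀ j, MDiff (g j)) ∧ f = ∑ j ∈ Finset.range v, imPowMul j (g j) := by
  induction v generalizing f with
  | zero => exact ⟨fun _ => 0, fun _ => mdifferentiable_const, by simpa using h⟩
  | succ v ih =>
    obtain ⟨g, hg, hfg⟩ := ih hf.lowerOp (by rwa [← iterate_succ_apply])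
    -- The coefficients are chosen such that lowering `G` gives the negative of the lowered `f`.
    -- Hence `f + G` is holomorphic, and it becomes the constant coefficient.
    set G : ℍ → ℂ := ∑ j ∈ Finset.range v, imPowMul (j + 1) ((j + 1 : ℂ)⁻¹ • g j) with hG
    have hg' : ∀ j : ℕ, MDiff ((j + 1 : ℂ)⁻¹ • g j) := fun j => (hg j).const_smul _
    have hind : ∀ n, RSmooth (∑ j ∈ Finset.range n, imPowMul (j + 1) ((j + 1 : ℂ)⁻¹ • g j)) ∧
        NFin.lowerOp (∑ j ∈ Finset.range n, imPowMul (j + 1) ((j + 1 : ℂ)⁻¹ • g j)) =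
          -∑ j ∈ Finset.range n, imPowMul j (g j) := by
      intro n
      induction n with
      | zero => 
        refine ⟨RSmooth.zero, ?_⟩
        have := lowerOp_smul RSmooth.zero 0
        simpa using this
      | succ n ihn =>
        rw [Finset.sum_range_succ, Finset.sum_range_succ,
          lowerOp_add ihn.1 (rsmooth_imPowMul _ (hg' n)), ihn.2,
          lowerOp_imPowMul_succ n (hg' n), imPowMul_smul n, smul_smul]
        refine ⟨ihn.1.add (rsmooth_imPowMul _ (hg' n)), ?_⟩
        have : (n + 1 : ℂ) ≠ 0 := by exact_mod_cast Nat.succ_ne_zero n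
        rw [neg_mul, mul_inv_cancel₀ this]
        module
    obtain ⟨hGs, hGl⟩ := hind v
    have hhol : MDiff (f + G) := by
      rw [mdiff_iff_lowerOp_eq_zero (hf.add hGs), lowerOp_add hf hGs, hGl, ← hfg, add_neg_cancel]
    refine ⟨fun j => Nat.casesOn j (f + G) fun j => -((j + 1 : ℂ)⁻¹ • g j), ?_, ?_⟩
    · rintro (_ | j)
      · exact hhol
      · exact (hg' j).neg
    · rw [Finset.sum_range_succ']
      simp only [imPowMul_zero]
      have : ∀ j : ℕ, imPowMul (j + 1) (-((j + 1 : ℂ)⁻¹ • g j)) =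
          -imPowMul (j + 1) ((j + 1 : ℂ)⁻¹ • g j) := fun j => by
        funext τ; simp [imPowMul]
      simp only [this, Finset.sum_neg_distrib, ← hG]
      change f = -G + (f + G)
      abel

/-- The disc of radius `y/2` about `τ` is the one used for Cauchy's estimate and for the maximum
principle. On it the height and the size change only by bounded factors. -/
lemma size_le_of_mem_closedBall {τ w : ℍ} (h : ‖(w : ℂ) - τ‖ ≤ τ.im / 2) :
    τ.im / 2 ≤ w.im ∧ w.im ≤ 3 / 2 * τ.im ∧ size w ≤ 4 * size τ := by
  have h0 := τ.im_pos
  have h1 : |w.im - τ.im| ≤ τ.im / 2 := (Complex.abs_im_le_norm ((w : ℂ) - τ)).trans h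
  have h2 : |w.re - τ.re| ≤ τ.im / 2 := (Complex.abs_re_le_norm ((w : ℂ) - τ)).trans h
  rw [abs_le] at h1 h2
  refine ⟨by linarith, by linarith, ?_⟩
  have hre : w.re ^ 2 ≤ 2 * τ.re ^ 2 + τ.im ^ 2 / 2 := by
    nlinarith [sq_nonneg (w.re - 2 * τ.re)]
  have h3 : (w.re ^ 2 + 1) / w.im ≤ (2 * τ.re ^ 2 + τ.im ^ 2 / 2 + 1) / (τ.im / 2) := by
    gcongr
    linarith
  have h4 : (2 * τ.re ^ 2 + τ.im ^ 2 / 2 + 1) / (τ.im / 2) =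
      4 * (τ.re ^ 2 / τ.im) + τ.im + 2 / τ.im := by field_simp; ring
  have h5 : 0 < 1 / τ.im := by positivity
  have h6 : 2 / τ.im = 2 * (1 / τ.im) := by ring
  unfold size
  rw [add_div]
  rw [add_div] at h3
  rw [add_div]
  linarith

lemma im_pos_of_norm_sub_le {τ : ℍ} {z : ℂ} (h : ‖z - τ‖ ≤ τ.im / 2) : 0 < z.im := by
  have h1 : |z.im - τ.im| ≤ τ.im / 2 := (Complex.abs_im_le_norm (z - τ)).trans h
  rw [abs_le] at h1
  linarith [τ.im_pos]

lemma diffContOnCl_of_mdiff {g : ℍ → ℂ} (hg : MDiff g) (τ : ℍ) :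
    DiffContOnCl ℂ (g ∘ ofComplex) (Metric.ball (τ : ℂ) (τ.im / 2)) := by
  refine DifferentiableOn.diffContOnCl ?_
  rw [closure_ball _ (by linarith [τ.im_pos])]
  refine (UpperHalfPlane.mdifferentiable_iff.mp hg).mono fun z hz => ?_
  rw [Metric.mem_closedBall, dist_eq_norm] at hz
  exact im_pos_of_norm_sub_le hz

/-- Cauchy's estimate on the circle of radius `y/2`. Dividing by the radius costs `2/y ≤ 2 size τ`,
hence the exponent `N + 1`. -/
lemma ModerateGrowth.cderiv {g : ℍ → ℂ} (hg : MDiff g) (h : ModerateGrowth g) :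
    ModerateGrowth (cderiv g) := by
  obtain ⟨C, N, hC⟩ := h
  have hC0 := ModerateGrowth.nonneg_of_bound hC
  refine ⟨C * 4 ^ N * 2, N + 1, fun τ => ?_⟩
  have hr : 0 < τ.im / 2 := by linarith [τ.im_pos]
  have := Complex.norm_deriv_le_of_forall_mem_sphere_norm_le hr (diffContOnCl_of_mdiff hg τ)
    (C := C * (4 * size τ) ^ N) (fun z hz => by
      have hz' : ‖z - τ‖ ≤ τ.im / 2 := by rw [← dist_eq_norm]; exact hz.le
      have hp := im_pos_of_norm_sub_le hz'
      rw [comp_apply, ofComplex_apply_of_im_pos hp]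
      refine (hC _).trans ?_
      have := (size_le_of_mem_closedBall (w := ⟨z, hp⟩) hz').2.2
      have := size_pos ⟨z, hp⟩
      gcongr)
  refine this.trans ?_
  rw [mul_pow, pow_succ, div_eq_mul_inv, inv_div, div_eq_mul_inv]
  have h1 := inv_im_le_size τ
  have h2 := size_pos τ
  calc C * (4 ^ N * size τ ^ N) * (2 * τ.im⁻¹) ≤ C * (4 ^ N * size τ ^ N) * (2 * size τ) := by gcongr
    _ = _ := by ring

/-- If a polynomial in `1 / y` with holomorphic coefficients has moderate growth, then so has its
constant coefficient. -/
lemma moderateGrowth_coeff_zero (n : ℕ) {g : ℕ → ℍ → ℂ} (hg : ∀ j, MDiff (g j))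
    (h : ModerateGrowth (∑ j ∈ Finset.range (n + 1), imPowMul j (g j))) : ModerateGrowth (g 0) := by
  obtain ⟨C, N, hC⟩ := h
  have hC0 := ModerateGrowth.nonneg_of_bound hC
  -- Here `6` is the quotient of the bound `3r²` for `|(z - τ) Im z|` on the circle by the value
  -- `r²/2` of `|Y|` at the centre; `4` compares sizes on the disc.
  refine ⟨6 ^ n * C * 4 ^ N, N, fun τ => ?_⟩
  set r : ℝ := τ.im / 2 with hr
  have hy0 := τ.im_pos
  have hr0 : 0 < r := by linarith
  -- On the circle `|z - τ| = r` the conjugate of `z - τ` is `r²/(z - τ)`. So `(z - τ) Im z` agrees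
  -- there with the polynomial `Y`. Multiplying the sum by `((z - τ) Im z)^n` clears all powers of
  -- `1/y` and gives boundary values of the holomorphic function `G`.
  set Y : ℂ → ℂ := fun z => τ.im * (z - τ) + ((z - τ) ^ 2 - (r : ℂ) ^ 2) / (2 * Complex.I) with hY
  set G : ℂ → ℂ := fun z => ∑ j ∈ Finset.range (n + 1),
    (z - τ) ^ j * Y z ^ (n - j) * (g j ∘ ofComplex) z with hG
  have hYd : Differentiable ℂ Y := by
    intro z
    simp only [hY]
    fun_prop
  have hGd : DiffContOnCl ℂ G (Metric.ball (τ : ℂ) r) := by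
    refine DifferentiableOn.diffContOnCl ?_
    rw [closure_ball _ hr0.ne']
    intro z hz
    rw [Metric.mem_closedBall, dist_eq_norm] at hz
    have hp := im_pos_of_norm_sub_le hz
    refine DifferentiableAt.differentiableWithinAt ?_
    refine DifferentiableAt.fun_sum fun j _ => ?_
    refine ((by fun_prop : DifferentiableAt ℂ (fun z : ℂ => (z - τ) ^ j) z).mul
      ((hYd z).pow (n - j))).mul ?_
    exact differentiableAt_of_mdiff (hg j) ⟨z, hp⟩
  have hbound : ∀ z ∈ frontier (Metric.ball (τ : ℂ) r),
      ‖G z‖ ≤ (r * (3 * r)) ^ n * (C * (4 * size τ) ^ N) := by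
    intro z hz
    rw [frontier_ball _ hr0.ne', mem_sphere_iff_norm] at hz
    have hp := im_pos_of_norm_sub_le hz.le
    obtain ⟨hs1, hs2, hs3⟩ := size_le_of_mem_closedBall (w := ⟨z, hp⟩) hz.le
    have hYz : Y z = z.im * (z - τ) := by
      have hconj : (r : ℂ) ^ 2 = (z - τ) * (starRingEnd ℂ) (z - τ) := by
        rw [Complex.mul_conj, Complex.normSq_eq_norm_sq, hz]; push_cast; rfl
      have him : (z - τ) - (starRingEnd ℂ) (z - τ) = 2 * Complex.I * (z.im - τ.im) := by
        rw [Complex.sub_conj]; simp; ring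
      simp only [hY]
      rw [hconj, sq, ← mul_sub, him]
      have hI := Complex.I_ne_zero
      rw [show (z - τ) * (2 * Complex.I * (z.im - τ.im)) / (2 * Complex.I) =
        (z - τ) * (z.im - τ.im) by field_simp]
      ring
    have hzim : (z.im : ℂ) ≠ 0 := by exact_mod_cast hp.ne'
    have hGz : G z = ((z - τ) * z.im) ^ n *
        (∑ j ∈ Finset.range (n + 1), imPowMul j (g j)) ⟨z, hp⟩ := by
      simp only [hG]
      rw [Finset.sum_apply, Finset.mul_sum]
      refine Finset.sum_congr rfl fun j hj => ?_
      have hj' : j ≤ n := by rw [Finset.mem_range] at hj; omega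
      obtain ⟨m, rfl⟩ := Nat.exists_eq_add_of_le hj'
      rw [hYz, comp_apply, ofComplex_apply_of_im_pos hp, Nat.add_sub_cancel_left]
      simp only [imPowMul]
      change _ = _ * (((z.im : ℂ)⁻¹) ^ j * _)
      rw [inv_pow]
      generalize z - τ = w
      field_simp
      ring
    rw [hGz, norm_mul, norm_pow, norm_mul, hz, Complex.norm_real, Real.norm_of_nonneg hp.le]
    have h1 := size_pos ⟨z, hp⟩
    have h2 : z.im ≤ 3 * r := by
      have : z.im ≤ 3 / 2 * τ.im := hs2
      linarith
    refine mul_le_mul (by gcongr) ((hC _).trans (by gcongr)) (norm_nonneg _) (by positivity)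
  -- The maximum principle bounds `G` at the centre, where the factors `(z - τ)^j` leave only the
  -- term `j = 0`.
  have hmain := Complex.norm_le_of_forall_mem_frontier_norm_le Metric.isBounded_ball hGd hbound
    (subset_closure (Metric.mem_ball_self hr0))
  have hG0 : G τ = (-(r : ℂ) ^ 2 / (2 * Complex.I)) ^ n * g 0 τ := by
    simp only [hG]
    rw [Finset.sum_range_succ', Finset.sum_eq_zero (fun j _ => by simp), zero_add]
    simp [hY]
  rw [hG0, norm_mul, norm_pow, norm_div, norm_neg, norm_pow, Complex.norm_real,
    Real.norm_of_nonneg hr0.le] at hmain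
  have h2I : ‖(2 : ℂ) * Complex.I‖ = 2 := by simp
  rw [h2I] at hmain
  have hpos : 0 < (r ^ 2 / 2) ^ n := by positivity
  rw [← mul_le_mul_iff_right₀ hpos]
  refine hmain.trans (le_of_eq ?_)
  rw [show r * (3 * r) = (r ^ 2 / 2) * 6 by ring, mul_pow, mul_pow]
  ring

/-- Once the constant coefficient is known to have moderate growth, subtracting it and multiplying
by `y` yields a shorter polynomial of moderate growth with the coefficients shifted by one. -/
lemma moderateGrowth_coeff (n : ℕ) {g : ℕ → ℍ → ℂ} (hg : ∀ j, MDiff (g j))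
    (h : ModerateGrowth (∑ j ∈ Finset.range n, imPowMul j (g j))) :
    ∀ j < n, ModerateGrowth (g j) := by
  induction n generalizing g with
  | zero => intro j hj; omega
  | succ n ih =>
    have h0 := moderateGrowth_coeff_zero n hg h
    have h1 : ModerateGrowth (∑ j ∈ Finset.range n, imPowMul j (g (j + 1))) := by
      refine ((h.sub h0).mul ModerateGrowth.im).mono fun τ => le_of_eq ?_
      congr 1
      rw [Finset.sum_range_succ', imPowMul_zero, Pi.add_apply, add_sub_cancel_right,
        Finset.sum_apply, Finset.sum_apply, Finset.sum_mul]
      refine Finset.sum_congr rfl fun j _ => ?_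
      have hy : (τ.im : ℂ) ≠ 0 := by exact_mod_cast τ.im_pos.ne'
      simp only [imPowMul, inv_pow]
      field_simp
      ring
    rintro (_ | j) hj
    · exact h0
    · exact ih (fun j => hg (j + 1)) h1 j (by omega)

/-- The nearly holomorphic functions of moderate growth: polynomials in `1 / y` whose coefficients
are holomorphic functions of moderate growth. -/
def nearlyHol : Submodule ℂ (ℍ → ℂ) :=
  Submodule.span ℂ {f | ∃ (j : ℕ) (g : ℍ → ℂ), MDiff g ∧ ModerateGrowth g ∧ f = imPowMul j g}

lemma imPowMul_mem_nearlyHol (j : ℕ) {g : ℍ → ℂ} (hg : MDiff g) (hg' : ModerateGrowth g) :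
    imPowMul j g ∈ nearlyHol := Submodule.subset_span ⟨j, g, hg, hg', rfl⟩

/-- Moderate growth alone does not pass to derivatives of smooth functions. It does for this space,
because raising a generator differentiates a holomorphic coefficient, where Cauchy's estimate
applies, or multiplies by `1/y`. -/
lemma nearlyHol_spec {f : ℍ → ℂ} (hf : f ∈ nearlyHol) (k : ℤ) :
    RSmooth f ∧ ModerateGrowth f ∧ NFin.raiseOp k f ∈ nearlyHol := by
  induction hf using Submodule.span_induction with
  | mem f hf =>
    obtain ⟨j, g, hg, hg', rfl⟩ := hf
    refine ⟨rsmooth_imPowMul j hg, (ModerateGrowth.im_inv.pow j).mul hg', ?_⟩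
    rw [raiseOp_imPowMul k j hg]
    exact add_mem (Submodule.smul_mem _ _ (imPowMul_mem_nearlyHol j (mdiff_cderiv hg)
      (hg'.cderiv hg))) (Submodule.smul_mem _ _ (imPowMul_mem_nearlyHol (j + 1) hg hg'))
  | zero =>
    refine ⟨RSmooth.zero, ModerateGrowth.const 0, ?_⟩
    have := raiseOp_smul k RSmooth.zero 0
    rw [zero_smul, zero_smul] at this
    rw [this]
    exact zero_mem _
  | add f g _ _ hf hg =>
    refine ⟨hf.1.add hg.1, hf.2.1.add hg.2.1, ?_⟩
    rw [raiseOp_add k hf.1 hg.1]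
    exact add_mem hf.2.2 hg.2.2
  | smul c f _ hf =>
    refine ⟨hf.1.smul c, hf.2.1.const_mul c, ?_⟩
    rw [raiseOp_smul k hf.1]
    exact Submodule.smul_mem _ _ hf.2.2

/-- If `f` has moderate growth and is annihilated by a power of the lowering operator, then the last
non-zero function in the sequence of its images is holomorphic of moderate growth. -/
lemma iterate_lowerOp_of_moderateGrowth (v : ℕ) {f : ℍ → ℂ} (hf : RSmooth f) (hf' : ModerateGrowth f)
    (h : (NFin.lowerOp^[v + 1]) f = 0) :
    MDiff ((NFin.lowerOp^[v]) f) ∧ ModerateGrowth ((NFin.lowerOp^[v]) f) := by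
  obtain ⟨g, hg, hfg⟩ := exists_sum_of_iterate_lowerOp_eq_zero (v + 1) hf h
  rw [hfg] at hf'
  have hmg := moderateGrowth_coeff (v + 1) hg hf'
  clear hf' h
  induction v generalizing f g with
  | zero =>
    have : f = g 0 := by rw [hfg]; simp [imPowMul_zero]
    rw [iterate_zero_apply, this]
    exact ⟨hg 0, hmg 0 (by omega)⟩
  | succ v ih =>
    rw [iterate_succ_apply]
    -- Lowering shifts the coefficients and multiplies them by constants, so after all steps only a
    -- multiple of the top coefficient is left.
    have hlow : NFin.lowerOp f =
        ∑ j ∈ Finset.range (v + 1), imPowMul j ((-(j + 1 : ℂ)) • g (j + 1)) := by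
      rw [hfg]
      have hind : ∀ n, RSmooth (∑ j ∈ Finset.range (n + 1), imPowMul j (g j)) ∧
          NFin.lowerOp (∑ j ∈ Finset.range (n + 1), imPowMul j (g j)) =
          ∑ j ∈ Finset.range n, imPowMul j ((-(j + 1 : ℂ)) • g (j + 1)) := by
        intro n
        induction n with
        | zero =>
          simp only [zero_add, Finset.sum_range_one, Finset.range_zero, Finset.sum_empty]
          exact ⟨rsmooth_imPowMul 0 (hg 0), lowerOp_imPowMul_zero (hg 0)⟩
        | succ n ihn =>
          rw [Finset.sum_range_succ _ (n + 1), lowerOp_add ihn.1 (rsmooth_imPowMul _ (hg _)), ihn.2,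
            lowerOp_imPowMul_succ n (hg _), Finset.sum_range_succ (fun j : ℕ => imPowMul j ((-(j + 1 : ℂ)) • g (j + 1))) n,
            imPowMul_smul n]
          exact ⟨ihn.1.add (rsmooth_imPowMul _ (hg _)), rfl⟩
      exact (hind (v + 1)).2
    exact ih hf.lowerOp (g := fun j => (-(j + 1 : ℂ)) • g (j + 1))
      (fun j => (hg (j + 1)).const_smul _) hlow
      fun j hj => (hmg (j + 1) (by omega)).const_mul _

end NearlyHolomorphic
end NFin

end

noncomputable section

namespace NFin

open UpperHalfPlane Filter Asymptotics Function ModularForm Matrix.SpecialLinearGroup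
open scoped Topology Real Manifold

/-! ### Invariance and growth under the dictionary. -/

section Automorphy

/-- Left translations commute with the right translations from which the derivations are built. -/
lemma isLeftInvariant_lie {Γ : Subgroup SL(2, ℤ)} {Φ : SmoothFn} (h : IsLeftInvariant Γ Φ.1)
    (X : 𝔤) : IsLeftInvariant Γ (⁅X, Φ⁆ : SmoothFn).1 := by
  intro γ hγ g
  have key : ∀ Y : 𝔤ℝ, derivAlong Y Φ.1 (toReal γ * g) = derivAlong Y Φ.1 g := by
    intro Y
    refine congrArg (fun F : ℝ → ℂ => deriv F 0) (funext fun t => ?_)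
    rw [mul_assoc]
    exact h γ hγ _
  rw [lie_apply_smoothFn, lie_apply_smoothFn]
  change derivAlong _ Φ.1 (toReal γ * g) + _ * derivAlong _ Φ.1 (toReal γ * g) = _
  rw [key, key]

lemma isLeftInvariant_lift_iff {Γ : Subgroup SL(2, ℤ)} {k : ℤ} {f : ℍ → ℂ} (hf : RSmooth f) :
    IsLeftInvariant Γ (lift k f hf).1 ↔ ∀ γ ∈ Γ, slash k f (toReal γ) = f := by
  constructor
  · intro h γ hγ
    rw [← tilde_slash k (slash k f (toReal γ))]
    conv_rhs => rw [← tilde_slash k f]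
    congr 1
    funext g
    rw [slash_mul]
    exact h γ hγ g
  · intro h γ hγ g
    change slash k f (toReal γ * g) I = slash k f g I
    rw [← slash_mul, h γ hγ]

/-- Since `|ci+d|² = 1/Im(g • i)` lies between the inverse of the size and the size, and the size is
at least `1`, both `|ci+d|` and its inverse are at most the size. -/
lemma norm_den_zpow_le (g : SL(2, ℝ)) (n : ℤ) : ‖den g I ^ n‖ ≤ size (g • I) ^ n.natAbs := by
  have h0 := norm_pos_iff.mpr (den_ne_zero g I)
  have h1 : ‖den g I‖ ^ 2 = ((g • I).im)⁻¹ := by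
    rw [im_smul_SL, ← Complex.normSq_eq_norm_sq]; simp
  have hs := one_le_size (g • I)
  have h2 : ‖den g I‖ ≤ size (g • I) := by
    refine (pow_le_pow_iff_left₀ h0.le (by linarith) two_ne_zero).mp ?_
    rw [h1]
    nlinarith [inv_im_le_size (g • I)]
  have h3 : ‖den g I‖⁻¹ ≤ size (g • I) := by
    refine (pow_le_pow_iff_left₀ (inv_pos.mpr h0).le (by linarith) two_ne_zero).mp ?_
    rw [inv_pow, h1, inv_inv]
    nlinarith [im_le_size (g • I)]
  rw [norm_zpow]
  rcases n with n | n
  · simpa using pow_le_pow_left₀ h0.le h2 n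
  · rw [zpow_negSucc, ← inv_pow, Int.natAbs_negSucc]
    exact pow_le_pow_left₀ (inv_pos.mpr h0).le h3 (n + 1)

lemma isSlowlyIncreasing_lift_iff {k : ℤ} {f : ℍ → ℂ} (hf : RSmooth f) :
    IsSlowlyIncreasing (lift k f hf).1 ↔ ModerateGrowth f := by
  constructor
  · rintro ⟨C, N, hC⟩
    refine ⟨C, k.natAbs + N, fun τ => ?_⟩
    set s := sectionMat τ with hs
    have hsI : s • I = τ := sectionMat_smul_I τ
    have hfs : f τ = den s I ^ k * (lift k f hf).1 s := by
      rw [lift_apply, ← mul_assoc, ← zpow_add₀ (den_ne_zero s I), add_neg_cancel, zpow_zero,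
        one_mul, hsI]
    have h1 := norm_den_zpow_le s k
    have h2 := hC s
    change ‖(lift k f hf).1 s‖ ≤ C * Real.sqrt (sqNorm s) ^ N at h2
    rw [sqNorm_eq_size, hsI] at h2
    rw [hsI] at h1
    have hs1 := one_le_size τ
    have h3 : Real.sqrt (size τ) ≤ size τ := by
      rw [Real.sqrt_le_left (by linarith)]; nlinarith
    have hC0 : 0 ≤ C := by
      by_contra hneg
      exact absurd ((norm_nonneg _).trans h2)
        (not_le.mpr (mul_neg_of_neg_of_pos (not_le.mp hneg) (by positivity)))
    rw [hfs, norm_mul, pow_add]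
    calc ‖den s I ^ k‖ * ‖(lift k f hf).1 s‖ ≤ size τ ^ k.natAbs * (C * size τ ^ N) := by
          refine mul_le_mul h1 (h2.trans ?_) (norm_nonneg _) (by positivity)
          gcongr
      _ = _ := by ring
  · rintro ⟨C, N, hC⟩
    have hC0 := ModerateGrowth.nonneg_of_bound hC
    -- The factor `2` appears because `size (g • I)` is the square of the norm of `g`.
    refine ⟨C, 2 * ((-k).natAbs + N), fun g => ?_⟩
    change _ ≤ C * Real.sqrt (sqNorm g) ^ _
    have hs := size_pos (g • I)
    rw [pow_mul, sqNorm_eq_size, Real.sq_sqrt hs.le, lift_apply, norm_mul, pow_add]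
    calc ‖den g I ^ (-k)‖ * ‖f (g • I)‖ ≤ size (g • I) ^ (-k).natAbs * (C * size (g • I) ^ N) :=
          mul_le_mul (norm_den_zpow_le g _) (hC _) (norm_nonneg _) (by positivity)
      _ = _ := by ring

end Automorphy

/-! ### The Eisenstein series of weight `2` and the constant function. -/

section Eisenstein

lemma tsum_sigma_eq (τ : ℍ) :
    ∑' n : ℕ, (ArithmeticFunction.sigma 1 (n + 1) : ℂ) *
      Complex.exp (2 * Real.pi * Complex.I * ((n + 1 : ℕ) : ℂ) * (τ : ℂ)) =
    ∑' n : ℕ+, (ArithmeticFunction.sigma 1 n : ℂ) *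
      Complex.exp (2 * Real.pi * Complex.I * (τ : ℂ)) ^ (n : ℕ) := by
  rw [tsum_pnat_eq_tsum_succ (f := fun n : ℕ => (ArithmeticFunction.sigma 1 n : ℂ) *
      Complex.exp (2 * Real.pi * Complex.I * (τ : ℂ)) ^ n)]
  refine tsum_congr fun n => ?_
  rw [← Complex.exp_nat_mul]
  congr 2
  push_cast
  ring

lemma E2_eq (τ : ℍ) : E2 τ = EisensteinSeries.E2 τ + (-3 / (π : ℂ)) * (τ.im : ℂ)⁻¹ := by
  rw [E2, tsum_sigma_eq, EisensteinSeries.E2_eq_tsum_cexp]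
  have : (τ.im : ℂ) ≠ 0 := by exact_mod_cast τ.im_pos.ne'
  have : (π : ℂ) ≠ 0 := by exact_mod_cast Real.pi_ne_zero
  field_simp
  ring

/-- The holomorphic series transforms with the defect `-6ic / (π(cτ+d))`. The term `-3/(πy)`
contributes the opposite defect, because the conjugate of `cτ+d` is `cτ + d - 2icy`. -/
lemma slash_E2 (γ : SL(2, ℤ)) : slash 2 E2 (toReal γ) = E2 := by
  have h := EisensteinSeries.E2_slash_action γ
  rw [slash_toReal] at h
  funext τ
  have hτ := congrFun h τ
  rw [slash_eq] at hτ ⊢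
  have hd := den_ne_zero (toReal γ) τ
  have hy : (τ.im : ℂ) ≠ 0 := by exact_mod_cast τ.im_pos.ne'
  have hpi : (π : ℂ) ≠ 0 := by exact_mod_cast Real.pi_ne_zero
  rw [E2_eq, E2_eq, mul_add, hτ]
  have hD2 : EisensteinSeries.D2 γ τ = 2 * π * Complex.I * (toReal γ).1 1 0 / den (toReal γ) τ := by
    rw [EisensteinSeries.D2]
    congr 1
  have him : (((toReal γ • τ : ℍ).im : ℝ) : ℂ)⁻¹ =
      den (toReal γ) τ * (starRingEnd ℂ) (den (toReal γ) τ) * (τ.im : ℂ)⁻¹ := by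
    rw [im_smul_SL, Complex.mul_conj]
    push_cast
    field_simp
  have hconj : (starRingEnd ℂ) (den (toReal γ) τ) =
      den (toReal γ) τ - 2 * Complex.I * (toReal γ).1 1 0 * τ.im := by
    have h1 := Complex.sub_conj (den (toReal γ) τ)
    have h2 : (den (toReal γ) τ).im = (toReal γ).1 1 0 * τ.im := by simp [den]
    rw [h2] at h1
    push_cast at h1
    linear_combination -h1
  rw [him, hconj, Pi.sub_apply, Pi.smul_apply, hD2, riemannZeta_two, smul_eq_mul,
    show (-2 : ℤ) = -(2 : ℕ) from rfl, zpow_neg, zpow_natCast]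
  field_simp
  ring

/-- The coefficients satisfy `σ₁(n+1) ≤ (n+1)² ≤ 2 C(n+2, 2)`, so the `q`-series is dominated by
`2/(1-|q|)³`. From `|q| = e^{-2πy} ≤ 1/(1+y)` follows `1/(1-|q|) ≤ 1 + 1/y`. -/
lemma moderateGrowth_holomorphic_E2 : ModerateGrowth EisensteinSeries.E2 := by
  have key : ∀ τ : ℍ, ‖EisensteinSeries.E2 τ‖ ≤ 1 + 48 * (1 + τ.im⁻¹) ^ 3 := by
    intro τ
    have hy := τ.im_pos
    set q : ℂ := Complex.exp (2 * π * Complex.I * τ) with hq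
    have hqn : ‖q‖ = Real.exp (-(2 * π * τ.im)) := by
      rw [hq, Complex.norm_exp]
      congr 1
      simp
    have hq1 : ‖q‖ ≤ (1 + τ.im)⁻¹ := by
      rw [hqn, Real.exp_neg]
      gcongr
      have := Real.add_one_le_exp (2 * π * τ.im)
      nlinarith [Real.pi_gt_three]
    have hq2 : ‖q‖ < 1 := hq1.trans_lt (inv_lt_one_of_one_lt₀ (by linarith))
    have hsum := hasSum_choose_mul_geometric_of_norm_lt_one 2
      (show ‖(‖q‖ : ℝ)‖ < 1 by rwa [norm_norm])
    have hbound : ‖∑' n : ℕ+, (ArithmeticFunction.sigma 1 n : ℂ) * q ^ (n : ℕ)‖ ≤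
        2 * (1 / (1 - ‖q‖) ^ (2 + 1)) := by
      rw [tsum_pnat_eq_tsum_succ (f := fun n : ℕ => (ArithmeticFunction.sigma 1 n : ℂ) * q ^ n)]
      refine tsum_of_norm_bounded (hsum.mul_left 2) fun n => ?_
      rw [norm_mul, norm_pow, Complex.norm_natCast, ← mul_assoc]
      have h1 : (ArithmeticFunction.sigma 1 (n + 1) : ℝ) ≤ 2 * ((n + 2).choose 2 : ℝ) := by
        have h2 : ArithmeticFunction.sigma 1 (n + 1) ≤ (n + 1) ^ 2 :=
          ArithmeticFunction.sigma_le_pow_succ 1 (n + 1)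
        have h3 : (n + 2).choose 2 * 2 = (n + 2) * (n + 1) := by
          rw [Nat.choose_two_right, Nat.div_mul_cancel]
          · rfl
          · exact (Nat.even_mul_pred_self (n + 2)).two_dvd
        have : ArithmeticFunction.sigma 1 (n + 1) ≤ 2 * (n + 2).choose 2 := by nlinarith
        exact_mod_cast this
      have h4 : ‖q‖ ^ (n + 1) ≤ ‖q‖ ^ n := pow_le_pow_of_le_one (norm_nonneg _) hq2.le (by omega)
      exact mul_le_mul h1 h4 (by positivity) (by positivity)
    have hinv : 1 / (1 - ‖q‖) ≤ 1 + τ.im⁻¹ := by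
      rw [div_le_iff₀ (by linarith)]
      have : 1 = (1 + τ.im⁻¹) * (1 - (1 + τ.im)⁻¹) := by field_simp; ring
      calc (1 : ℝ) = (1 + τ.im⁻¹) * (1 - (1 + τ.im)⁻¹) := this
        _ ≤ _ := by gcongr
    rw [EisensteinSeries.E2_eq_tsum_cexp]
    refine (norm_sub_le _ _).trans ?_
    rw [norm_one, norm_mul, Complex.norm_ofNat]
    refine add_le_add le_rfl ?_
    calc 24 * ‖∑' n : ℕ+, (ArithmeticFunction.sigma 1 n : ℂ) * q ^ (n : ℕ)‖
        ≤ 24 * (2 * (1 / (1 - ‖q‖) ^ (2 + 1))) := by gcongr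
      _ = 48 * (1 / (1 - ‖q‖)) ^ 3 := by rw [div_pow, one_pow]; ring
      _ ≤ _ := by
        have : 0 < 1 / (1 - ‖q‖) := one_div_pos.mpr (by linarith)
        gcongr
  have h : ModerateGrowth fun τ => (1 : ℂ) + 48 * (1 + (τ.im : ℂ)⁻¹) ^ 3 :=
    (ModerateGrowth.const 1).add ((((ModerateGrowth.const 1).add ModerateGrowth.im_inv).pow 3).const_mul 48)
  refine h.mono fun τ => (key τ).trans (le_of_eq ?_)
  have hy := τ.im_pos
  have : (1 : ℂ) + 48 * (1 + (τ.im : ℂ)⁻¹) ^ 3 = ((1 + 48 * (1 + τ.im⁻¹) ^ 3 : ℝ) : ℂ) := by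
    push_cast; rfl
  rw [this, Complex.norm_real, Real.norm_of_nonneg (by positivity)]

lemma E2_eq_imPowMul : E2 = imPowMul 0 EisensteinSeries.E2 +
    (-3 / (π : ℂ)) • imPowMul 1 fun _ => (1 : ℂ) := by
  funext τ
  rw [E2_eq]
  simp [imPowMul]

lemma mdiff_one : MDiff fun _ : ℍ => (1 : ℂ) := mdifferentiable_const

lemma E2_mem_nearlyHol : E2 ∈ nearlyHol := by
  rw [E2_eq_imPowMul]
  exact add_mem (imPowMul_mem_nearlyHol 0 E2_mdifferentiable
    moderateGrowth_holomorphic_E2) (Submodule.smul_mem _ _ (imPowMul_mem_nearlyHol 1 mdiff_one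
      (ModerateGrowth.const 1)))

lemma rsmooth_E2 : RSmooth E2 := (nearlyHol_spec E2_mem_nearlyHol 0).1

lemma rsmooth_one : RSmooth fun _ => (1 : ℂ) := rsmooth_of_mdiff mdiff_one

/-- Only the term `-3/(πy)` is not holomorphic. That the result is a non-zero constant ties `Φ₂` to
the constants and prevents a splitting. -/
lemma lowerOp_E2 : NFin.lowerOp E2 = (3 / (π : ℂ)) • fun _ : ℍ => (1 : ℂ) := by
  have h0 := rsmooth_imPowMul 0 E2_mdifferentiable
  have h1 := rsmooth_imPowMul 1 mdiff_one
  rw [E2_eq_imPowMul, lowerOp_add h0 (h1.smul _), lowerOp_smul h1,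
    lowerOp_imPowMul_zero E2_mdifferentiable, lowerOp_imPowMul_succ 0 mdiff_one,
    imPowMul_zero, smul_smul, zero_add]
  congr 1
  push_cast
  ring

/-- The function of weight `2` on `SL(2, ℝ)` that corresponds to `E₂`. -/
def Phi2 : SmoothFn := lift 2 E2 rsmooth_E2

/-- The constant function `1` on `SL(2, ℝ)`. -/
def oneFn : SmoothFn := lift 0 (fun _ => (1 : ℂ)) rsmooth_one

lemma oneFn_apply (g : SL(2, ℝ)) : oneFn.1 g = 1 := by
  rw [oneFn, lift_apply]; simp

lemma lift_congr {k l : ℤ} {f g : ℍ → ℂ} (hf : RSmooth f) (hg : RSmooth g) (hkl : k = l)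
    (hfg : f = g) : lift k f hf = lift l g hg := by
  subst hkl; subst hfg; rfl

lemma lift_smul (k : ℤ) {f : ℍ → ℂ} (hf : RSmooth f) (c : ℂ) :
    lift k (c • f) (hf.smul c) = c • lift k f hf := by
  refine Subtype.ext (funext fun g => ?_)
  change den g I ^ (-k) * (c * f (g • I)) = c * (den g I ^ (-k) * f (g • I))
  ring

lemma lift_add (k : ℤ) {f g : ℍ → ℂ} (hf : RSmooth f) (hg : RSmooth g) :
    lift k (f + g) (hf.add hg) = lift k f hf + lift k g hg := by
  refine Subtype.ext (funext fun x => ?_)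
  exact mul_add (den x I ^ (-k)) (f (x • I)) (g (x • I))

lemma lift_eq_zero (k : ℤ) {f : ℍ → ℂ} (hf : RSmooth f) (h : f = 0) : lift k f hf = 0 := by
  refine Subtype.ext (funext fun x => ?_)
  rw [lift_apply, h, Pi.zero_apply, mul_zero]
  rfl

lemma lie_L_Phi2 : ⁅L, Phi2⁆ = (3 / (π : ℂ)) • oneFn := by
  rw [Phi2, lie_L_lift, oneFn, ← lift_smul]
  exact lift_congr _ _ (by norm_num) lowerOp_E2

lemma lie_H_Phi2 : ⁅H, Phi2⁆ = (2 : ℂ) • Phi2 := by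
  rw [Phi2, lie_H_lift]; norm_num

lemma lie_L_oneFn : ⁅L, oneFn⁆ = 0 := by
  rw [oneFn, lie_L_lift]
  refine lift_eq_zero _ _ ?_
  rw [← imPowMul_zero (fun _ : ℍ => (1 : ℂ))]
  exact lowerOp_imPowMul_zero mdiff_one

lemma lie_H_oneFn : ⁅H, oneFn⁆ = 0 := by
  rw [oneFn, lie_H_lift]; simp

lemma lie_R_oneFn : ⁅R, oneFn⁆ = 0 := by
  rw [oneFn, lie_R_lift]
  refine lift_eq_zero _ _ ?_
  have h := raiseOp_imPowMul 0 0 mdiff_one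
  rw [imPowMul_zero] at h
  rw [h]
  funext τ
  simp [imPowMul, cderiv, comp_def]

lemma slash_one (g : SL(2, ℝ)) : slash 0 (fun _ => (1 : ℂ)) g = fun _ => 1 := by
  funext τ; simp [slash_eq]

end Eisenstein
end NFin

end

set_option linter.unusedSectionVars false

noncomputable section

namespace NFin

/-! ### Linear algebra of locally nilpotent operators, and `𝔰𝔩₂`-calculus. -/

section Algebra

variable {V : Type} [AddCommGroup V] [Module ℂ V]

/-- If a vector in the span of eigenvectors is an eigenvector, then it lies in the span of those with
the same eigenvalue. -/
lemma mem_span_of_eigenvector {ι : Type*} (T : Module.End ℂ V) {x : ι → V} {c : ι → ℂ}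
    (hx : ∀ i, T (x i) = c i • x i) {v : V} (hv : v ∈ Submodule.span ℂ (Set.range x)) {d : ℂ}
    (hd : T v = d • v) : v ∈ Submodule.span ℂ {w | ∃ i, c i = d ∧ w = x i} := by
  have hle : Submodule.span ℂ (Set.range x) ≤ Submodule.span ℂ {w | ∃ i, c i = d ∧ w = x i} ⊔
      ⨆ e : ℂ, ⨆ _ : e ≠ d, T.eigenspace e := by
    rw [Submodule.span_le]
    rintro _ ⟨i, rfl⟩
    by_cases h : c i = d
    · exact Submodule.mem_sup_left (Submodule.subset_span ⟨i, h, rfl⟩)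
    · exact Submodule.mem_sup_right (Submodule.mem_iSup_of_mem (c i) (Submodule.mem_iSup_of_mem h
        (Module.End.mem_eigenspace_iff.mpr (hx i))))
  obtain ⟨a, ha, b, hb, rfl⟩ := Submodule.mem_sup.mp (hle hv)
  have ha' : a ∈ T.eigenspace d := by
    refine (Submodule.span_le.mpr ?_ : _ ≤ T.eigenspace d) ha
    rintro _ ⟨i, rfl, rfl⟩
    exact Module.End.mem_eigenspace_iff.mpr (hx i)
  have hb' : b ∈ T.eigenspace d := by
    have := Submodule.sub_mem _ (Module.End.mem_eigenspace_iff.mpr hd) ha'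
    rwa [add_sub_cancel_left] at this
  have := (Module.End.eigenspaces_iSupIndep T d).le_bot ⟨hb', hb⟩
  rw [Submodule.mem_bot] at this
  rw [this, add_zero]
  exact ha

/-- A linear map that commutes with locally nilpotent operators is injective if it is injective on
the kernel of the operator. -/
lemma injective_of_locally_nilpotent {W : Type} [AddCommGroup W] [Module ℂ W] (S : Module.End ℂ V)
    (T : Module.End ℂ W) (f : V →ₗ[ℂ] W) (hf : ∀ v, f (S v) = T (f v))
    (hS : ∀ v, ∃ n : ℕ, (S ^ n) v = 0) (hker : ∀ v, S v = 0 → f v = 0 → v = 0) :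
    Function.Injective f := by
  rw [injective_iff_map_eq_zero]
  intro v hv
  obtain ⟨n, hn⟩ := hS v
  induction n generalizing v with
  | zero => exact hn
  | succ n ih =>
    rw [pow_succ] at hn
    exact hker v (ih (S v) (by rw [hf, hv, map_zero]) hn) hv

/-- Submodules that are stable under a locally nilpotent operator and meet its kernel in
independent submodules are independent. -/
lemma iSupIndep_of_locally_nilpotent {ι : Type*} (S T : Module.End ℂ V) (N : ι → Submodule ℂ V)
    (hN : ∀ i, ∀ v ∈ N i, S v ∈ N i) (hS : ∀ i, ∀ v ∈ N i, ∃ n : ℕ, (S ^ n) v = 0) (c : ι → ℂ)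
    (hc : Function.Injective c) (hker : ∀ i, ∀ v ∈ N i, S v = 0 → T v = c i • v) :
    iSupIndep N := by
  classical
  have hind : iSupIndep fun i => T.eigenspace (c i) := (Module.End.eigenspaces_iSupIndep T).comp hc
  -- Induction on a common nilpotency order: by the case of `S x_i`, a relation among the `x_i` only
  -- involves vectors killed by `S`. These are eigenvectors of `T` for distinct eigenvalues.
  have key : ∀ (n : ℕ) (s : Finset ι) (x : ι → V), (∀ i, x i ∈ N i) → (∀ i, (S ^ n) (x i) = 0) →
      ∑ i ∈ s, x i = 0 → ∀ i ∈ s, x i = 0 := by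
    intro n
    induction n with
    | zero => intro s x _ hn _ i _; exact hn i
    | succ n ih =>
      intro s x hx hn hsum
      have h1 : ∀ i ∈ s, S (x i) = 0 := ih s (fun i => S (x i)) (fun i => hN i _ (hx i))
        (fun i => by have := hn i; rwa [pow_succ] at this) (by rw [← map_sum, hsum, map_zero])
      have h2 : ∀ i ∈ s, x i ∈ T.eigenspace (c i) := fun i hi =>
        Module.End.mem_eigenspace_iff.mpr (hker i _ (hx i) (h1 i hi))
      intro i hi
      have h3 : x i = -∑ j ∈ s.erase i, x j := by
        rw [← Finset.add_sum_erase s x hi] at hsum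
        exact eq_neg_of_add_eq_zero_left hsum
      have h4 : x i ∈ ⨆ j, ⨆ _ : j ≠ i, T.eigenspace (c j) := by
        rw [h3]
        refine neg_mem (sum_mem fun j hj => ?_)
        exact Submodule.mem_iSup_of_mem j (Submodule.mem_iSup_of_mem (Finset.ne_of_mem_erase hj)
          (h2 j (Finset.mem_of_mem_erase hj)))
      exact (Submodule.mem_bot ℂ).mp ((hind i).le_bot ⟨h2 i hi, h4⟩)
  refine iSupIndep_of_dfinsupp_lsum_injective N ?_
  rw [injective_iff_map_eq_zero]
  intro m hm
  have hm' : ∑ i ∈ m.support, (m i : V) = 0 := by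
    rw [DFinsupp.lsum_apply_apply, DFinsupp.sumAddHom_apply] at hm
    exact hm
  choose n hn using fun i => hS i (m i : V) (m i).2
  have hn' : ∀ i, (S ^ (m.support.sup n)) (m i : V) = 0 := by
    intro i
    by_cases hi : i ∈ m.support
    · obtain ⟨d, hd⟩ := Nat.exists_eq_add_of_le (Finset.le_sup (f := n) hi)
      rw [hd, add_comm, pow_add, Module.End.mul_apply, hn, map_zero]
    · rw [DFinsupp.notMem_support_iff.mp hi, ZeroMemClass.coe_zero, map_zero]
  refine DFinsupp.ext fun i => ?_
  by_cases hi : i ∈ m.support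
  · exact Subtype.ext (key _ m.support (fun i => (m i : V)) (fun i => (m i).2) hn' hm' i hi)
  · exact DFinsupp.notMem_support_iff.mp hi

section Ladder

variable {M : Type*} [AddCommGroup M] [Module ℂ M]

/-- A sequence of linear maps on which an operator acts by lowering the index. -/
structure IsLadder (S : Module.End ℂ V) (T : ℕ → M →ₗ[ℂ] V) (a : ℕ → ℂ) : Prop where
  zero : ∀ m, S (T 0 m) = 0
  succ : ∀ j m, S (T (j + 1) m) = a j • T j m
  ne_zero : ∀ j, a j ≠ 0
  injective : Function.Injective (T 0)

variable {S : Module.End ℂ V} {T : ℕ → M →ₗ[ℂ] V} {a : ℕ → ℂ}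

lemma IsLadder.map_sum (h : IsLadder S T a) (n : ℕ) (m : ℕ → M) :
    S (∑ j ∈ Finset.range (n + 1), T j (m j)) =
      ∑ j ∈ Finset.range n, T j (a j • m (j + 1)) := by
  rw [_root_.map_sum, Finset.sum_range_succ', h.zero, add_zero]
  exact Finset.sum_congr rfl fun j _ => by rw [h.succ, map_smul]

/-- Applying `S` shifts the relation down by one rung; by induction all coefficients above the
bottom vanish, and the bottom map is injective. -/
lemma IsLadder.eq_zero_of_sum (h : IsLadder S T a) (n : ℕ) (m : ℕ → M)
    (hm : ∑ j ∈ Finset.range n, T j (m j) = 0) : ∀ j < n, m j = 0 := by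
  induction n generalizing m with
  | zero => intro j hj; omega
  | succ n ih =>
    have h1 := h.map_sum n m
    rw [hm, map_zero] at h1
    have h2 : ∀ j < n, m (j + 1) = 0 := fun j hj =>
      (smul_eq_zero.mp (ih _ h1.symm j hj)).resolve_left (h.ne_zero j)
    have h3 : ∀ j, j + 1 < n + 1 → m (j + 1) = 0 := fun j hj => h2 j (by omega)
    rw [Finset.sum_range_succ', Finset.sum_eq_zero fun j hj => by
      rw [h2 j (Finset.mem_range.mp hj), map_zero], zero_add] at hm
    rintro (_ | j) hj
    · exact h.injective (by rw [hm, map_zero])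
    · exact h3 j hj

/-- The span of the images of a sequence of linear maps. -/
def ladderSpan (T : ℕ → M →ₗ[ℂ] V) : Submodule ℂ V :=
  Submodule.span ℂ (Set.range fun x : ℕ × M => T x.1 x.2)

lemma mem_ladderSpan (T : ℕ → M →ₗ[ℂ] V) (j : ℕ) (m : M) : T j m ∈ ladderSpan T :=
  Submodule.subset_span ⟨(j, m), rfl⟩

lemma exists_sum_of_mem_ladderSpan {v : V} (hv : v ∈ ladderSpan T) :
    ∃ (n : ℕ) (m : ℕ → M), v = ∑ j ∈ Finset.range n, T j (m j) := by
  induction hv using Submodule.span_induction with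
  | mem v hv =>
    obtain ⟨⟨j, m⟩, rfl⟩ := hv
    refine ⟨j + 1, Pi.single j m, ?_⟩
    rw [Finset.sum_range_succ, Pi.single_eq_same, Finset.sum_eq_zero, zero_add]
    intro i hi
    rw [Pi.single_eq_of_ne (Finset.mem_range.mp hi).ne, map_zero]
  | zero => exact ⟨0, 0, by simp⟩
  | add v w _ _ hv hw =>
    obtain ⟨n, m, rfl⟩ := hv
    obtain ⟨n', m', rfl⟩ := hw
    have key : ∀ (n N : ℕ) (m : ℕ → M), n ≤ N → ∑ j ∈ Finset.range n, T j (m j) =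
        ∑ j ∈ Finset.range N, T j (if j < n then m j else 0) := by
      intro n N m hN
      rw [← Finset.sum_subset (Finset.range_mono hN)]
      · exact Finset.sum_congr rfl fun j hj => by rw [if_pos (Finset.mem_range.mp hj)]
      · intro j _ hj
        rw [if_neg (fun h => hj (Finset.mem_range.mpr h)), map_zero]
    refine ⟨max n n', fun j => (if j < n then m j else 0) + (if j < n' then m' j else 0), ?_⟩
    rw [key n _ m (le_max_left n n'), key n' _ m' (le_max_right n n'), ← Finset.sum_add_distrib]
    exact Finset.sum_congr rfl fun j _ => (map_add _ _ _).symm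
  | smul c v _ hv =>
    obtain ⟨n, m, rfl⟩ := hv
    exact ⟨n, fun j => c • m j, by
      rw [Finset.smul_sum]; exact Finset.sum_congr rfl fun j _ => (map_smul _ _ _).symm⟩

/-- The shifted relation `S v = 0` forces all coefficients above the bottom rung to vanish. So the
kernel of `S` on the ladder is exactly the bottom rung. -/
lemma IsLadder.eq_apply_zero (h : IsLadder S T a) {v : V} (hv : v ∈ ladderSpan T) (hS : S v = 0) :
    ∃ m, v = T 0 m := by
  obtain ⟨n, m, rfl⟩ := exists_sum_of_mem_ladderSpan hv
  rcases n with _ | n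
  · exact ⟨0, by simp⟩
  · rw [h.map_sum] at hS
    have h1 := h.eq_zero_of_sum n _ hS
    refine ⟨m 0, ?_⟩
    rw [Finset.sum_range_succ', Finset.sum_eq_zero fun j hj => ?_, zero_add]
    rw [(smul_eq_zero.mp (h1 j (Finset.mem_range.mp hj))).resolve_left (h.ne_zero j), map_zero]

lemma IsLadder.apply_mem (h : IsLadder S T a) {v : V} (hv : v ∈ ladderSpan T) :
    S v ∈ ladderSpan T := by
  refine (Submodule.span_le.mpr ?_ : ladderSpan T ≤ (ladderSpan T).comap S) hv
  rintro _ ⟨⟨j, m⟩, rfl⟩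
  change S (T j m) ∈ ladderSpan T
  rcases j with _ | j
  · rw [h.zero]; exact zero_mem _
  · rw [h.succ]; exact Submodule.smul_mem _ _ (mem_ladderSpan T j m)

lemma IsLadder.pow_apply (h : IsLadder S T a) (j : ℕ) (m : M) : (S ^ (j + 1)) (T j m) = 0 := by
  induction j with
  | zero => rw [zero_add, pow_one, h.zero]
  | succ j ih => rw [pow_succ, Module.End.mul_apply, h.succ, map_smul, ih, smul_zero]

lemma IsLadder.pow_self (h : IsLadder S T a) (j : ℕ) : ∃ c : ℂ, c ≠ 0 ∧
    ∀ m, (S ^ j) (T j m) = c • T 0 m := by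
  induction j with
  | zero => exact ⟨1, one_ne_zero, fun m => by simp⟩
  | succ j ih =>
    obtain ⟨c, hc, hcm⟩ := ih
    refine ⟨a j * c, mul_ne_zero (h.ne_zero j) hc, fun m => ?_⟩
    rw [pow_succ, Module.End.mul_apply, h.succ, map_smul, hcm, smul_smul]

lemma exists_pow_eq_zero_of_mem_span (S : Module.End ℂ V) {s : Set V}
    (hs : ∀ v ∈ s, ∃ n : ℕ, (S ^ n) v = 0) {v : V} (hv : v ∈ Submodule.span ℂ s) :
    ∃ n : ℕ, (S ^ n) v = 0 := by
  induction hv using Submodule.span_induction with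
  | mem v hv => exact hs v hv
  | zero => exact ⟨0, map_zero _⟩
  | add v w _ _ hv hw =>
    obtain ⟨n, hn⟩ := hv
    obtain ⟨n', hn'⟩ := hw
    refine ⟨n + n', ?_⟩
    rw [map_add, pow_add, Module.End.mul_apply, Module.End.mul_apply, hn', map_zero, add_zero,
      ← Module.End.mul_apply, ← pow_add, add_comm, pow_add, Module.End.mul_apply, hn, map_zero]
  | smul c v _ hv =>
    obtain ⟨n, hn⟩ := hv
    exact ⟨n, by rw [map_smul, hn, smul_zero]⟩

lemma IsLadder.exists_pow_eq_zero (h : IsLadder S T a) {v : V} (hv : v ∈ ladderSpan T) :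
    ∃ n : ℕ, (S ^ n) v = 0 := by
  refine exists_pow_eq_zero_of_mem_span S ?_ hv
  rintro _ ⟨⟨j, m⟩, rfl⟩
  exact ⟨j + 1, h.pow_apply j m⟩

end Ladder

variable [LieRingModule 𝔤 V] [LieModule ℂ 𝔤 V]

/-- The vector `R^j v`. -/
def raisePow (j : ℕ) : V →ₗ[ℂ] V := LieModule.toEnd ℂ 𝔤 V R ^ j

lemma raisePow_zero (v : V) : raisePow 0 v = v := rfl

lemma raisePow_succ (j : ℕ) (v : V) : raisePow (j + 1) v = ⁅R, raisePow j v⁆ := by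
  rw [raisePow, pow_succ']; rfl

lemma lie_H_raisePow {c : ℂ} {v : V} (hH : ⁅H, v⁆ = c • v) (j : ℕ) :
    ⁅H, raisePow j v⁆ = (c + 2 * j) • raisePow j v := by
  induction j with
  | zero => simpa [raisePow_zero] using hH
  | succ j ih =>
    rw [raisePow_succ, leibniz_lie, lie_H_R, ih, smul_lie, lie_smul]
    push_cast
    module

lemma lie_L_lie_R (v : V) : ⁅L, ⁅R, v⁆⁆ = ⁅R, ⁅L, v⁆⁆ - ⁅H, v⁆ := by
  rw [← lie_R_L, lie_lie]; abel

/-- Moving `L` past the factors `R` produces `-∑_{i ≤ j} (c + 2i) = -(j+1)(c+j)`. The hypothesis is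
`R L v = 0` rather than `L v = 0` so that `v = Φ₂` is covered: there `L v` is a constant function,
which `R` kills. -/
lemma lie_L_raisePow_succ {c : ℂ} {v : V} (hH : ⁅H, v⁆ = c • v) (hR : ⁅R, ⁅L, v⁆⁆ = 0) (j : ℕ) :
    ⁅L, raisePow (j + 1) v⁆ = (-(j + 1 : ℂ) * (c + j)) • raisePow j v := by
  induction j with
  | zero =>
    rw [raisePow_succ, raisePow_zero, lie_L_lie_R, hR, hH]
    push_cast
    module
  | succ j ih =>
    rw [raisePow_succ (j + 1), lie_L_lie_R, ih, lie_smul, ← raisePow_succ, lie_H_raisePow hH]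
    push_cast
    module

/-- A subspace stable under `H`, `R` and `L` is stable under `𝔤`. -/
lemma lie_mem_of_basis {N : Submodule ℂ V} (hH : ∀ v ∈ N, ⁅H, v⁆ ∈ N) (hR : ∀ v ∈ N, ⁅R, v⁆ ∈ N)
    (hL : ∀ v ∈ N, ⁅L, v⁆ ∈ N) (X : 𝔤) {v : V} (hv : v ∈ N) : ⁅X, v⁆ ∈ N := by
  rw [eq_coeff X, add_lie, add_lie, smul_lie, smul_lie, smul_lie]
  exact add_mem (add_mem (N.smul_mem _ (hH v hv)) (N.smul_mem _ (hR v hv)))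
    (N.smul_mem _ (hL v hv))

lemma lie_mem_span {s : Set V} (X : 𝔤) (h : ∀ v ∈ s, ⁅X, v⁆ ∈ Submodule.span ℂ s) {v : V}
    (hv : v ∈ Submodule.span ℂ s) : ⁅X, v⁆ ∈ Submodule.span ℂ s :=
  (Submodule.span_le.mpr h :
    Submodule.span ℂ s ≤ (Submodule.span ℂ s).comap (LieModule.toEnd ℂ 𝔤 V X)) hv

section Rho

variable [GKRep V]

lemma rho_mem_span {s : Set V} (h : ∀ v ∈ s, ∃ m : ℤ, v ∈ weightSpace V m) (k : K) {v : V}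
    (hv : v ∈ Submodule.span ℂ s) : GKRep.rho k v ∈ Submodule.span ℂ s := by
  suffices hle : Submodule.span ℂ s ≤ (Submodule.span ℂ s).comap (GKRep.rho k) from hle hv
  refine Submodule.span_le.mpr fun w hw => ?_
  obtain ⟨m, hm⟩ := h w hw
  change GKRep.rho k w ∈ Submodule.span ℂ s
  rw [mem_weightSpace_iff_chi.mp hm k]
  exact Submodule.smul_mem _ _ (Submodule.subset_span hw)

/-- The stable subspace spanned by a set of weight vectors. -/
def GKSubmodule.span (s : Set V) (hK : ∀ v ∈ s, ∃ m : ℤ, v ∈ weightSpace V m)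
    (hH : ∀ v ∈ s, ⁅H, v⁆ ∈ Submodule.span ℂ s) (hR : ∀ v ∈ s, ⁅R, v⁆ ∈ Submodule.span ℂ s)
    (hL : ∀ v ∈ s, ⁅L, v⁆ ∈ Submodule.span ℂ s) : GKSubmodule V where
  toSubmodule := Submodule.span ℂ s
  lie_mem := fun {X} {_} hv => lie_mem_of_basis (fun _ => lie_mem_span H hH)
    (fun _ => lie_mem_span R hR) (fun _ => lie_mem_span L hL) X hv
  rho_mem := fun k _ hv => rho_mem_span hK k hv

lemma mem_weightSpace_coe (N : GKSubmodule V) (m : ℤ) (v : N.toLieSubmodule) :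
    v ∈ weightSpace N.toLieSubmodule m ↔ (v : V) ∈ weightSpace V m := by
  constructor
  · intro h θ
    have := congrArg Subtype.val (h θ)
    exact this
  · intro h θ
    exact Subtype.ext (h θ)

variable {W : Type} [AddCommGroup W] [Module ℂ W] [LieRingModule 𝔤 W] [LieModule ℂ 𝔤 W] [GKRep W]

/-- A linear map that commutes with `H`, `R`, `L` and preserves weights is a homomorphism. -/
def GKHom.ofSpan (s : Set V) (hs : Submodule.span ℂ s = ⊤) (T : V →ₗ[ℂ] W)
    (hK : ∀ v ∈ s, ∃ m : ℤ, v ∈ weightSpace V m ∧ T v ∈ weightSpace W m)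
    (hH : ∀ v ∈ s, T ⁅H, v⁆ = ⁅H, T v⁆) (hR : ∀ v ∈ s, T ⁅R, v⁆ = ⁅R, T v⁆)
    (hL : ∀ v ∈ s, T ⁅L, v⁆ = ⁅L, T v⁆) : GKHom V W where
  toLinearMap := T
  map_lie' := by
    intro X v
    have key : ∀ Y : 𝔤, (∀ v ∈ s, T ⁅Y, v⁆ = ⁅Y, T v⁆) → ∀ v, T ⁅Y, v⁆ = ⁅Y, T v⁆ := fun Y hY v =>
      LinearMap.congr_fun (f := T ∘ₗ LieModule.toEnd ℂ 𝔤 V Y) (g := LieModule.toEnd ℂ 𝔤 W Y ∘ₗ T)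
        (LinearMap.ext_on hs hY) v
    change T ⁅X, v⁆ = ⁅X, T v⁆
    rw [eq_coeff X]
    simp only [add_lie, smul_lie, map_add, map_smul, key H hH, key R hR, key L hL]
  map_rho := by
    intro k v
    refine LinearMap.congr_fun (f := T ∘ₗ GKRep.rho k) (g := GKRep.rho k ∘ₗ T)
      (LinearMap.ext_on hs fun v hv => ?_) v
    obtain ⟨m, h1, h2⟩ := hK v hv
    change T (GKRep.rho k v) = GKRep.rho k (T v)
    rw [mem_weightSpace_iff_chi.mp h1 k, mem_weightSpace_iff_chi.mp h2 k, map_smul]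

lemma GKHom.map_weightSpace (T : GKHom V W) {m : ℤ} {v : V} (hv : v ∈ weightSpace V m) :
    T.toLieModuleHom v ∈ weightSpace W m := by
  intro θ
  have h := T.map_rho (rot θ) v
  rw [hv θ] at h
  exact h.symm.trans (map_smul T.toLieModuleHom _ _)

end Rho

/-- A subalgebra of the universal enveloping algebra that contains `𝔤` is everything. -/
lemma mem_of_toU_mem (S : Subalgebra ℂ U) (hS : ∀ X : 𝔤, toU X ∈ S) (u : U) : u ∈ S := by
  let _ : LieRing U := LieRing.ofAssociativeRing
  let _ : LieRing S := LieRing.ofAssociativeRing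
  let _ : LieAlgebra ℂ S := LieAlgebra.ofAssociativeAlgebra
  let φ : 𝔤 →ₗ⁅ℂ⁆ S :=
    { toFun := fun X => ⟨toU X, hS X⟩
      map_add' := fun X Y => Subtype.ext (map_add _ X Y)
      map_smul' := fun c X => Subtype.ext (map_smul _ c X)
      map_lie' := fun {X Y} => Subtype.ext (toU_lie X Y) }
  have h : S.val.comp (UniversalEnvelopingAlgebra.lift ℂ φ) = AlgHom.id ℂ U := by
    apply UniversalEnvelopingAlgebra.hom_ext
    refine LieHom.ext fun X => ?_
    change ((UniversalEnvelopingAlgebra.lift ℂ φ (UniversalEnvelopingAlgebra.ι ℂ X) : S) : U) =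
      UniversalEnvelopingAlgebra.ι ℂ X
    rw [UniversalEnvelopingAlgebra.lift_ι_apply]
    rfl
  have h1 := congrArg (fun f : U →ₐ[ℂ] U => f u) h
  change ((UniversalEnvelopingAlgebra.lift ℂ φ u : S) : U) = u at h1
  rw [← h1]
  exact Subtype.property _

/-- The action of the universal enveloping algebra on a `𝔤`-module. -/
def envelopingAction (V : Type) [AddCommGroup V] [Module ℂ V] [LieRingModule 𝔤 V]
    [LieModule ℂ 𝔤 V] : U →ₐ[ℂ] Module.End ℂ V :=
  UniversalEnvelopingAlgebra.lift ℂ (LieModule.toEnd ℂ 𝔤 V)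

lemma envelopingAction_toU (X : 𝔤) (v : V) : envelopingAction V (toU X) v = ⁅X, v⁆ := by
  rw [envelopingAction, toU, UniversalEnvelopingAlgebra.lift_ι_apply]
  rfl

lemma envelopingAction_mem {N : Submodule ℂ V} (hN : ∀ (X : 𝔤), ∀ v ∈ N, ⁅X, v⁆ ∈ N) (u : U) :
    ∀ v ∈ N, envelopingAction V u v ∈ N := by
  let S : Subalgebra ℂ U :=
    { carrier := {u | ∀ v ∈ N, envelopingAction V u v ∈ N}
      mul_mem' := fun {a b} ha hb v hv => by
        rw [map_mul]; exact ha _ (hb v hv)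
      add_mem' := fun {a b} ha hb v hv => by
        rw [map_add]; exact add_mem (ha v hv) (hb v hv)
      algebraMap_mem' := fun c v hv => by
        rw [AlgHom.commutes]; exact N.smul_mem c hv }
  exact mem_of_toU_mem S (fun X v hv => by rw [envelopingAction_toU]; exact hN X v hv) u

/-- In a module spanned by weight vectors with distinct weights, the center of the universal
enveloping algebra acts on them by scalars. -/
lemma center_mem_span {x : ℕ → V} {c : ℕ → ℂ} (hc : Function.Injective c)
    (hx : ∀ j, ⁅H, x j⁆ = c j • x j)
    (hN : ∀ (X : 𝔤), ∀ v ∈ Submodule.span ℂ (Set.range x), ⁅X, v⁆ ∈ Submodule.span ℂ (Set.range x))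
    {z : U} (hz : z ∈ Subalgebra.center ℂ U) (j : ℕ) :
    envelopingAction V z (x j) ∈ Submodule.span ℂ {x j} := by
  have h1 := envelopingAction_mem hN z (x j) (Submodule.subset_span ⟨j, rfl⟩)
  -- A central element commutes with `H`, so it preserves the weight of `x j`; the weights being
  -- distinct, that weight occurs in the span only along `x j`.
  have h2 : LieModule.toEnd ℂ 𝔤 V H (envelopingAction V z (x j)) =
      c j • envelopingAction V z (x j) := by
    change ⁅H, envelopingAction V z (x j)⁆ = _
    rw [← envelopingAction_toU, ← Module.End.mul_apply, ← map_mul,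
      Subalgebra.mem_center_iff.mp hz, map_mul, Module.End.mul_apply, envelopingAction_toU, hx,
      map_smul]
  refine Submodule.span_mono ?_ (mem_span_of_eigenvector (LieModule.toEnd ℂ 𝔤 V H) hx h1 h2)
  rintro _ ⟨i, hi, rfl⟩
  rw [hc hi]
  rfl

end Algebra
end NFin

end

noncomputable section

namespace NFin

open UpperHalfPlane Filter Asymptotics Function ModularForm Matrix.SpecialLinearGroup
open scoped Topology Real Manifold

/-! ### The two kinds of ladders and the proof that they span. -/

section Generators

/-- The lowering operator on smooth functions. -/
abbrev lowerEnd : Module.End ℂ SmoothFn := LieModule.toEnd ℂ 𝔤 SmoothFn L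

/-- The holomorphic modular forms as functions on `SL(2, ℝ)`. -/
def modLift (Γ : Subgroup SL(2, ℤ)) (k : ℤ) : M Γ k →ₗ[ℂ] SmoothFn where
  toFun f := lift k f (rsmooth_of_mdiff f.holo')
  map_add' f g := lift_add k (rsmooth_of_mdiff f.holo') (rsmooth_of_mdiff g.holo')
  map_smul' c f := lift_smul k (rsmooth_of_mdiff f.holo') c

lemma tilde_modLift {Γ : Subgroup SL(2, ℤ)} {k : ℤ} (f : M Γ k) :
    tilde k (modLift Γ k f).1 = f := tilde_lift k (rsmooth_of_mdiff f.holo')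

lemma modLift_injective (Γ : Subgroup SL(2, ℤ)) (k : ℤ) : Injective (modLift Γ k) := by
  intro f g h
  have : (f : ℍ → ℂ) = g := by rw [← tilde_modLift f, h, tilde_modLift]
  exact DFunLike.coe_injective this

lemma lie_L_modLift {Γ : Subgroup SL(2, ℤ)} {k : ℤ} (f : M Γ k) : ⁅L, modLift Γ k f⁆ = 0 :=
  (lie_L_lift k (rsmooth_of_mdiff f.holo')).trans
    (lift_eq_zero _ _ ((mdiff_iff_lowerOp_eq_zero (rsmooth_of_mdiff f.holo')).mp f.holo'))

lemma lie_H_modLift {Γ : Subgroup SL(2, ℤ)} {k : ℤ} (f : M Γ k) :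
    ⁅H, modLift Γ k f⁆ = (k : ℂ) • modLift Γ k f :=
  lie_H_lift k (rsmooth_of_mdiff f.holo')

lemma modLift_mem_weightSpace {Γ : Subgroup SL(2, ℤ)} {k : ℤ} (f : M Γ k) :
    modLift Γ k f ∈ weightSpace SmoothFn k := lift_mem_weightSpace k (rsmooth_of_mdiff f.holo')

/-- The maps `f ↦ R^j f` on modular forms of weight `p + 1`. -/
def modLadder (Γ : Subgroup SL(2, ℤ)) (p j : ℕ) : M Γ (p + 1) →ₗ[ℂ] SmoothFn :=
  raisePow j ∘ₗ modLift Γ (p + 1)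

lemma modLadder_zero (Γ : Subgroup SL(2, ℤ)) (p : ℕ) (f : M Γ (p + 1)) :
    modLadder Γ p 0 f = modLift Γ (p + 1) f := rfl

lemma lie_R_modLadder (Γ : Subgroup SL(2, ℤ)) (p j : ℕ) (f : M Γ (p + 1)) :
    ⁅R, modLadder Γ p j f⁆ = modLadder Γ p (j + 1) f := (raisePow_succ j _).symm

lemma lie_H_modLadder (Γ : Subgroup SL(2, ℤ)) (p j : ℕ) (f : M Γ (p + 1)) :
    ⁅H, modLadder Γ p j f⁆ = ((p : ℂ) + 1 + 2 * j) • modLadder Γ p j f :=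
  lie_H_raisePow (by rw [lie_H_modLift]; push_cast; rfl) j

lemma lie_L_modLadder_succ (Γ : Subgroup SL(2, ℤ)) (p j : ℕ) (f : M Γ (p + 1)) :
    ⁅L, modLadder Γ p (j + 1) f⁆ = (-(j + 1 : ℂ) * ((p : ℂ) + 1 + j)) • modLadder Γ p j f :=
  lie_L_raisePow_succ (by rw [lie_H_modLift]; push_cast; rfl) (by rw [lie_L_modLift, lie_zero]) j

/-- The coefficients do not vanish because the lowest weight `p + 1` is positive; this fails in
weight `0`, where `Φ₂` has to be brought in. -/
lemma isLadder_modLadder (Γ : Subgroup SL(2, ℤ)) (p : ℕ) :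
    IsLadder lowerEnd (modLadder Γ p) fun j => -(j + 1 : ℂ) * ((p : ℂ) + 1 + j) where
  zero f := lie_L_modLift f
  succ j f := lie_L_modLadder_succ Γ p j f
  ne_zero j := by
    refine mul_ne_zero (neg_ne_zero.mpr (by exact_mod_cast Nat.succ_ne_zero j)) ?_
    have : (p : ℂ) + 1 + j = ((p + j + 1 : ℕ) : ℂ) := by push_cast; ring
    rw [this]
    exact Nat.cast_ne_zero.mpr (by omega)
  injective := modLift_injective Γ (p + 1)

lemma lie_smul_smoothFn (X : 𝔤) (c : ℂ) (Φ : SmoothFn) : ⁅X, c • Φ⁆ = c • ⁅X, Φ⁆ := lie_smul c X Φ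

/-- The vectors `1, Φ₂, R Φ₂, R² Φ₂, …`. -/
def eisVec : ℕ → SmoothFn
  | 0 => oneFn
  | j + 1 => raisePow j Phi2

/-- The maps `c ↦ c v_j`, where `v_0, v_1, …` are the vectors `1, Φ₂, R Φ₂, R² Φ₂, …`. -/
def eisLadder (j : ℕ) : ℂ →ₗ[ℂ] SmoothFn := LinearMap.toSpanSingleton ℂ SmoothFn (eisVec j)

lemma eisLadder_one (j : ℕ) : eisLadder j 1 = eisVec j := one_smul ℂ _

/-- The coefficients of the action of `L` on the vectors `1, Φ₂, R Φ₂, R² Φ₂, …`. -/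
def eisCoeff : ℕ → ℂ
  | 0 => 3 / (π : ℂ)
  | j + 1 => -(j + 1 : ℂ) * (2 + j)

/-- The lowest step is the analytic fact `L Φ₂ = 3/π`; all higher steps are formal, with `Φ₂` of
weight `2`. -/
lemma lie_L_eisVec_succ (j : ℕ) : ⁅L, eisVec (j + 1)⁆ = eisCoeff j • eisVec j := by
  rcases j with _ | j
  · exact lie_L_Phi2
  · exact lie_L_raisePow_succ lie_H_Phi2 (by rw [lie_L_Phi2, lie_smul_smoothFn, lie_R_oneFn, smul_zero]) j

lemma lie_H_eisVec (j : ℕ) : ⁅H, eisVec j⁆ = (2 * j : ℂ) • eisVec j := by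
  rcases j with _ | j
  · simpa [eisVec] using lie_H_oneFn
  · refine (lie_H_raisePow lie_H_Phi2 j).trans ?_
    congr 1
    push_cast
    ring

lemma eisCoeff_ne_zero (j : ℕ) : eisCoeff j ≠ 0 := by
  rcases j with _ | j
  · exact div_ne_zero three_ne_zero (by exact_mod_cast Real.pi_ne_zero)
  · refine mul_ne_zero (neg_ne_zero.mpr (by exact_mod_cast Nat.succ_ne_zero j)) ?_
    have : (2 : ℂ) + j = ((j + 2 : ℕ) : ℂ) := by push_cast; ring
    rw [this]
    exact Nat.cast_ne_zero.mpr (by omega)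

lemma oneFn_ne_zero : oneFn ≠ 0 := by
  intro h
  have := oneFn_apply 1
  rw [h] at this
  exact zero_ne_one this

lemma isLadder_eisLadder : IsLadder lowerEnd eisLadder eisCoeff where
  zero c := by
    change ⁅L, c • oneFn⁆ = 0
    rw [lie_smul_smoothFn, lie_L_oneFn, smul_zero]
  succ j c := by
    change ⁅L, c • eisVec (j + 1)⁆ = eisCoeff j • c • eisVec j
    rw [lie_smul_smoothFn, lie_L_eisVec_succ, smul_comm]
  ne_zero := eisCoeff_ne_zero
  injective := smul_left_injective ℂ oneFn_ne_zero

/-- Keeping the function within `nearlyHol` is what secures moderate growth for all the `R^j f`. -/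
lemma raisePow_lift_mem (k : ℤ) {f : ℍ → ℂ} (hf : f ∈ nearlyHol) (j : ℕ) :
    ∃ g : ℍ → ℂ, ∃ hg : g ∈ nearlyHol, raisePow j (lift k f (nearlyHol_spec hf 0).1) =
      lift (k + 2 * j) g (nearlyHol_spec hg 0).1 := by
  induction j with
  | zero => exact ⟨f, hf, lift_congr (nearlyHol_spec hf 0).1 _ (by simp) rfl⟩
  | succ j ih =>
    obtain ⟨g, hg, h⟩ := ih
    refine ⟨raiseOp (k + 2 * j) g, (nearlyHol_spec hg _).2.2, ?_⟩
    rw [raisePow_succ, h, lie_R_lift]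
    exact lift_congr _ _ (by push_cast; ring) rfl

lemma isLeftInvariant_raisePow {Γ : Subgroup SL(2, ℤ)} {Φ : SmoothFn} (h : IsLeftInvariant Γ Φ.1)
    (j : ℕ) : IsLeftInvariant Γ (raisePow j Φ).1 := by
  induction j with
  | zero => exact h
  | succ j ih => rw [raisePow_succ]; exact isLeftInvariant_lie ih R

lemma isSlowlyIncreasing_add {Φ Ψ : SL(2, ℝ) → ℂ} (hΦ : IsSlowlyIncreasing Φ)
    (hΨ : IsSlowlyIncreasing Ψ) : IsSlowlyIncreasing (Φ + Ψ) := by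
  obtain ⟨C, N, hC⟩ := hΦ
  obtain ⟨D, N', hD⟩ := hΨ
  have h1 : ∀ g : SL(2, ℝ), 1 ≤ Real.sqrt (∑ i, ∑ j, g.1 i j ^ 2) := fun g => by
    rw [Real.one_le_sqrt]
    exact (one_le_size _).trans_eq (sqNorm_eq_size g).symm
  refine ⟨|C| + |D|, max N N', fun g => (norm_add_le _ _).trans ?_⟩
  rw [add_mul]
  refine add_le_add ((hC g).trans ?_) ((hD g).trans ?_)
  · exact mul_le_mul (le_abs_self C) (pow_le_pow_right₀ (h1 g) (le_max_left _ _))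
      (by positivity) (abs_nonneg C)
  · exact mul_le_mul (le_abs_self D) (pow_le_pow_right₀ (h1 g) (le_max_right _ _))
      (by positivity) (abs_nonneg D)

lemma isSlowlyIncreasing_smul {Φ : SL(2, ℝ) → ℂ} (hΦ : IsSlowlyIncreasing Φ) (c : ℂ) :
    IsSlowlyIncreasing (c • Φ) := by
  obtain ⟨C, N, hC⟩ := hΦ
  refine ⟨‖c‖ * C, N, fun g => ?_⟩
  rw [Pi.smul_apply, norm_smul, mul_assoc]
  exact mul_le_mul_of_nonneg_left (hC g) (norm_nonneg c)

lemma isSlowlyIncreasing_zero : IsSlowlyIncreasing 0 := ⟨0, 0, fun g => by simp⟩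

/-- The left invariant slowly increasing functions of weight `m`. -/
def autWeight (Γ : Subgroup SL(2, ℤ)) (m : ℤ) : Submodule ℂ SmoothFn where
  carrier := {Φ | IsLeftInvariant Γ Φ.1 ∧ IsSlowlyIncreasing Φ.1 ∧ Φ ∈ weightSpace SmoothFn m}
  add_mem' := fun {_ _} hΦ hΨ => ⟨fun γ hγ g => congrArg₂ (· + ·) (hΦ.1 γ hγ g) (hΨ.1 γ hγ g),
    isSlowlyIncreasing_add hΦ.2.1 hΨ.2.1, add_mem hΦ.2.2 hΨ.2.2⟩
  zero_mem' := ⟨fun _ _ _ => rfl, isSlowlyIncreasing_zero, zero_mem _⟩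
  smul_mem' := fun c _ hΦ => ⟨fun γ hγ g => congrArg (c * ·) (hΦ.1 γ hγ g),
    isSlowlyIncreasing_smul hΦ.2.1 c, Submodule.smul_mem _ c hΦ.2.2⟩

lemma raisePow_lift_mem_autWeight {Γ : Subgroup SL(2, ℤ)} {k : ℤ} {f : ℍ → ℂ} (hf : f ∈ nearlyHol)
    (hΓ : ∀ γ ∈ Γ, slash k f (toReal γ) = f) (j : ℕ) :
    raisePow j (lift k f (nearlyHol_spec hf 0).1) ∈ autWeight Γ (k + 2 * j) := by
  refine ⟨isLeftInvariant_raisePow ((isLeftInvariant_lift_iff _).mpr hΓ) j, ?_⟩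
  obtain ⟨g, hg, h⟩ := raisePow_lift_mem k hf j
  rw [h]
  exact ⟨(isSlowlyIncreasing_lift_iff _).mpr (nearlyHol_spec hg 0).2.1, lift_mem_weightSpace _ _⟩

lemma slash_modularForm {Γ : Subgroup SL(2, ℤ)} {k : ℤ} (f : M Γ k) (γ : SL(2, ℤ)) (hγ : γ ∈ Γ) :
    slash k f (toReal γ) = f := by
  rw [← slash_toReal]
  exact f.slash_action_eq' _ ⟨γ, hγ, rfl⟩

lemma modularForm_mem_nearlyHol {Γ : Subgroup SL(2, ℤ)} [Γ.FiniteIndex] {k : ℤ} (hk : 0 ≤ k)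
    (f : M Γ k) : (f : ℍ → ℂ) ∈ nearlyHol := by
  rw [← imPowMul_zero (f : ℍ → ℂ)]
  exact imPowMul_mem_nearlyHol 0 f.holo' (moderateGrowth_modularForm hk f)

lemma modLadder_mem_autWeight (Γ : Subgroup SL(2, ℤ)) [Γ.FiniteIndex] (p j : ℕ) (f : M Γ (p + 1)) :
    modLadder Γ p j f ∈ autWeight Γ (p + 1 + 2 * j) :=
  raisePow_lift_mem_autWeight (modularForm_mem_nearlyHol (by positivity) f) (slash_modularForm f) j

lemma eisVec_mem_autWeight (Γ : Subgroup SL(2, ℤ)) (j : ℕ) : eisVec j ∈ autWeight Γ (2 * j) := by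
  rcases j with _ | j
  · have h : (fun _ : ℍ => (1 : ℂ)) ∈ nearlyHol := by
      have := imPowMul_mem_nearlyHol 0 mdiff_one (ModerateGrowth.const 1)
      rwa [imPowMul_zero] at this
    exact raisePow_lift_mem_autWeight h (fun γ _ => slash_one (toReal γ)) 0
  · have := raisePow_lift_mem_autWeight (Γ := Γ) E2_mem_nearlyHol (fun γ _ => slash_E2 γ) j
    rwa [show (2 : ℤ) + 2 * j = 2 * (j + 1 : ℕ) by push_cast; ring] at this

/-- The spaces spanned by `1, Φ₂, R Φ₂, …` and by the functions `R^j f` with `f` a modular form of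
weight `p + 1`. -/
def component (Γ : Subgroup SL(2, ℤ)) : Option ℕ → Submodule ℂ SmoothFn
  | none => ladderSpan eisLadder
  | some p => ladderSpan (modLadder Γ p)

lemma iterate_lowerEnd_lift (v : ℕ) (k : ℤ) {f : ℍ → ℂ} (hf : RSmooth f) :
    ∃ h : RSmooth (lowerOp^[v] f), (lowerEnd ^ v) (lift k f hf) = lift (k - 2 * v) (lowerOp^[v] f) h := by
  induction v with
  | zero => exact ⟨hf, lift_congr hf hf (by simp) rfl⟩
  | succ v ih =>
    obtain ⟨h, hv⟩ := ih
    have heq : lowerOp^[v + 1] f = lowerOp (lowerOp^[v] f) := iterate_succ_apply' _ _ _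
    refine ⟨by rw [heq]; exact h.lowerOp, ?_⟩
    rw [pow_succ', Module.End.mul_apply, hv]
    refine (lie_L_lift _ h).trans (lift_congr _ _ ?_ heq.symm)
    push_cast
    ring

lemma lowerEnd_pow_mem_weight (v : ℕ) {Γ : Subgroup SL(2, ℤ)} {Φ : SmoothFn}
    (h : IsLeftInvariant Γ Φ.1) : IsLeftInvariant Γ ((lowerEnd ^ v) Φ).1 := by
  induction v with
  | zero => exact h
  | succ v ih => rw [pow_succ', Module.End.mul_apply]; exact isLeftInvariant_lie ih L

/-- The last non-zero vector in the sequence `Φ, L Φ, L² Φ, …` comes from a modular form. -/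
lemma exists_modularForm {Γ : Subgroup SL(2, ℤ)} [Γ.FiniteIndex] {m : ℤ} {Φ : SmoothFn}
    (hΦ : Φ ∈ autWeight Γ m) (v : ℕ) (hv : (lowerEnd ^ (v + 1)) Φ = 0) :
    ∃ f : M Γ (m - 2 * v), (lowerEnd ^ v) Φ = modLift Γ (m - 2 * v) f := by
  obtain ⟨hinv, hslow, hm⟩ := hΦ
  have hlift := lift_tilde hm
  set F := tilde m Φ.1
  have hF : RSmooth F := rsmooth_tilde m Φ
  rw [← hlift] at hslow hv hinv ⊢
  rw [isSlowlyIncreasing_lift_iff] at hslow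
  obtain ⟨h1, h2⟩ := iterate_lowerEnd_lift (v + 1) m hF
  obtain ⟨h3, h4⟩ := iterate_lowerEnd_lift v m hF
  have h0 : lowerOp^[v + 1] F = 0 := by
    have h5 := tilde_lift (m - 2 * (v + 1 : ℕ)) h1
    rw [← h2, hv] at h5
    rw [← h5]
    funext τ
    exact mul_zero _
  -- The function is now holomorphic of moderate growth; left invariance of `L^v Φ` gives its
  -- invariance in weight `m - 2v`, and the criterion for modularity applies.
  obtain ⟨h5, h6⟩ := iterate_lowerOp_of_moderateGrowth v hF hslow h0
  have h7 := lowerEnd_pow_mem_weight v hinv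
  rw [h4, isLeftInvariant_lift_iff] at h7
  exact ⟨modularFormOfModerateGrowth Γ (m - 2 * v) _ h5 h6 h7, h4⟩

/-- Every `𝔫`-finite left invariant slowly increasing function of a given weight is a sum of
functions in the spaces `component Γ o`. -/
theorem mem_iSup_component (Γ : Subgroup SL(2, ℤ)) [Γ.FiniteIndex] (v : ℕ) {m : ℤ} {Φ : SmoothFn}
    (hΦ : Φ ∈ autWeight Γ m) (hv : (lowerEnd ^ v) Φ = 0) : Φ ∈ ⨆ o, component Γ o := by
  induction v generalizing Φ with
  | zero =>
    have : Φ = 0 := hv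
    rw [this]; exact zero_mem _
  | succ v ih =>
    obtain ⟨f, hf⟩ := exists_modularForm hΦ v hv
    -- It is enough to find a known vector with the same image under `L^v`: the difference is killed
    -- by `L^v`, and the induction hypothesis applies to it.
    suffices h : ∃ Ψ ∈ autWeight Γ m, Ψ ∈ (⨆ o, component Γ o) ∧ (lowerEnd ^ v) Ψ = (lowerEnd ^ v) Φ by
      obtain ⟨Ψ, h1, h2, h3⟩ := h
      have h4 := ih (Φ := Φ - Ψ) (sub_mem hΦ h1) (by rw [map_sub, h3, sub_self])
      have := add_mem h4 h2
      rwa [sub_add_cancel] at this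
    generalize hk : m - 2 * (v : ℤ) = k at f hf
    rcases lt_trichotomy k 0 with hneg | rfl | hpos
    · refine ⟨0, zero_mem _, zero_mem _, ?_⟩
      rw [hf, ModularForm.isZero_of_neg_weight hneg f, map_zero, map_zero]
    -- In weight `0` the form is constant. The vector of weight `2v` among `1, Φ₂, R Φ₂, …` is
    -- lowered by `L^v` to `a • 1` with `a ≠ 0`, so it is rescaled by `c / a`.
    · obtain ⟨c, hc⟩ := ModularForm.eq_const_of_weight_zero f
      obtain ⟨a, ha, hav⟩ := isLadder_eisLadder.pow_self v
      have hm : m = 2 * v := by omega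
      have h0 : eisLadder v (a⁻¹ * c) = (a⁻¹ * c) • eisVec v := rfl
      refine ⟨eisLadder v (a⁻¹ * c), ?_, ?_, ?_⟩
      · rw [h0, hm]
        exact Submodule.smul_mem _ _ (eisVec_mem_autWeight Γ v)
      · exact Submodule.mem_iSup_of_mem none (mem_ladderSpan eisLadder v _)
      · rw [hav, hf]
        change a • (a⁻¹ * c) • oneFn = _
        rw [smul_smul, mul_inv_cancel_left₀ ha]
        refine Subtype.ext (funext fun g => ?_)
        change c * oneFn.1 g = den g I ^ (-(0 : ℤ)) * f (g • I)
        rw [oneFn_apply, hc]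
        simp
    · obtain ⟨p, rfl⟩ : ∃ p : ℕ, k = p + 1 := ⟨(k - 1).toNat, by omega⟩
      -- In positive weight `L^v R^v f = a f` with `a ≠ 0`, so `R^v (a⁻¹ f)` has the required image.
      obtain ⟨a, ha, hav⟩ := (isLadder_modLadder Γ p).pow_self v
      have hm : m = p + 1 + 2 * v := by omega
      refine ⟨modLadder Γ p v (a⁻¹ • f), ?_, ?_, ?_⟩
      · rw [hm]
        exact modLadder_mem_autWeight Γ p v _
      · exact Submodule.mem_iSup_of_mem (some p) (mem_ladderSpan (modLadder Γ p) v _)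
      · rw [hav, hf, modLadder_zero, ← map_smul, smul_smul, mul_inv_cancel₀ ha, one_smul]

end Generators
end NFin

end

noncomputable section

namespace NFin

open UpperHalfPlane Function Matrix.SpecialLinearGroup

/-! ### Identification of the space of `𝔫`-finite automorphic forms. -/

section Forms

/-- The vectors whose images under a set of operators span a finite-dimensional space. -/
def orbitFinite {V ι : Type*} [AddCommGroup V] [Module ℂ V] (f : ι → Module.End ℂ V) (s : Set ι) :
    Submodule ℂ V where
  carrier := {v | FiniteDimensional ℂ (Submodule.span ℂ ((fun i => f i v) '' s))}
  add_mem' := by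
    intro v w hv hw
    rw [Set.mem_ofPred_eq] at hv hw ⊢
    refine Submodule.finiteDimensional_of_le
      (S₂ := Submodule.span ℂ ((fun i => f i v) '' s) ⊔ Submodule.span ℂ ((fun i => f i w) '' s)) ?_
    rw [Submodule.span_le]
    rintro _ ⟨i, hi, rfl⟩
    simp only [map_add]
    exact add_mem (Submodule.mem_sup_left (Submodule.subset_span ⟨i, hi, rfl⟩))
      (Submodule.mem_sup_right (Submodule.subset_span ⟨i, hi, rfl⟩))
  zero_mem' := by
    rw [Set.mem_ofPred_eq]
    refine Submodule.finiteDimensional_of_le (S₂ := ⊥) ?_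
    rw [Submodule.span_le]
    rintro _ ⟨i, hi, rfl⟩
    simp
  smul_mem' := by
    intro c v hv
    rw [Set.mem_ofPred_eq] at hv ⊢
    refine Submodule.finiteDimensional_of_le (S₂ := Submodule.span ℂ ((fun i => f i v) '' s)) ?_
    rw [Submodule.span_le]
    rintro _ ⟨i, hi, rfl⟩
    simp only [map_smul]
    exact Submodule.smul_mem _ _ (Submodule.subset_span ⟨i, hi, rfl⟩)

lemma mem_orbitFinite_of_forall {V ι : Type*} [AddCommGroup V] [Module ℂ V]
    (f : ι → Module.End ℂ V) (s : Set ι) {v : V} (h : ∀ i ∈ s, f i v ∈ Submodule.span ℂ {v}) :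
    v ∈ orbitFinite f s := by
  change FiniteDimensional ℂ (Submodule.span ℂ ((fun i => f i v) '' s))
  refine Submodule.finiteDimensional_of_le (S₂ := Submodule.span ℂ {v}) ?_
  rw [Submodule.span_le]
  rintro _ ⟨i, hi, rfl⟩
  exact h i hi

lemma isKFinite_iff {Φ : SmoothFn} :
    IsKFinite Φ ↔ Φ ∈ orbitFinite (fun k : K => GKRep.rho (V := SmoothFn) k) Set.univ := by
  change _ ↔ FiniteDimensional ℂ (Submodule.span ℂ ((fun k : K => GKRep.rho k Φ) '' Set.univ))
  rw [Set.image_univ]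
  rfl

lemma isZFinite_iff {Φ : SmoothFn} :
    IsZFinite Φ ↔ Φ ∈ orbitFinite (fun z => actU z) (Subalgebra.center ℂ U : Set U) := Iff.rfl

lemma isNFinite_iff {Φ : SmoothFn} : IsNFinite Φ ↔ ∃ v : ℕ, (lowerEnd ^ v) Φ = 0 := by
  constructor
  · rintro ⟨v, hv⟩
    exact ⟨v, hv v le_rfl⟩
  · rintro ⟨v, hv⟩
    refine ⟨v, fun w hw => ?_⟩
    obtain ⟨d, rfl⟩ := Nat.exists_eq_add_of_le hw
    change (lowerEnd ^ (v + d)) Φ = 0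
    rw [add_comm, pow_add, Module.End.mul_apply, hv, map_zero]

/-- The `𝔫`-finite automorphic forms as a subspace of the smooth functions. -/
def nFiniteSubmodule (Γ : Subgroup SL(2, ℤ)) : Submodule ℂ SmoothFn where
  carrier := nFiniteForms Γ
  add_mem' := by
    rintro Φ Ψ ⟨h1, h2⟩ ⟨h3, h4⟩
    refine ⟨⟨fun γ hγ g => congrArg₂ (· + ·) (h1.left_invariant γ hγ g) (h3.left_invariant γ hγ g),
      isKFinite_iff.mpr (add_mem (isKFinite_iff.mp h1.kFinite) (isKFinite_iff.mp h3.kFinite)),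
      isZFinite_iff.mpr (add_mem (isZFinite_iff.mp h1.zFinite) (isZFinite_iff.mp h3.zFinite)),
      isSlowlyIncreasing_add h1.slowly_increasing h3.slowly_increasing⟩, ?_⟩
    rw [isNFinite_iff] at h2 h4 ⊢
    refine exists_pow_eq_zero_of_mem_span lowerEnd (s := {Φ, Ψ}) ?_
      (add_mem (Submodule.subset_span (by simp)) (Submodule.subset_span (by simp)))
    rintro _ (rfl | rfl)
    exacts [h2, h4]
  zero_mem' := by
    refine ⟨⟨fun _ _ _ => rfl, isKFinite_iff.mpr (zero_mem _), isZFinite_iff.mpr (zero_mem _),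
      isSlowlyIncreasing_zero⟩, isNFinite_iff.mpr ⟨0, rfl⟩⟩
  smul_mem' := by
    rintro c Φ ⟨h1, h2⟩
    refine ⟨⟨fun γ hγ g => congrArg (c * ·) (h1.left_invariant γ hγ g),
      isKFinite_iff.mpr (Submodule.smul_mem _ c (isKFinite_iff.mp h1.kFinite)),
      isZFinite_iff.mpr (Submodule.smul_mem _ c (isZFinite_iff.mp h1.zFinite)),
      isSlowlyIncreasing_smul h1.slowly_increasing c⟩, ?_⟩
    rw [isNFinite_iff] at h2 ⊢
    obtain ⟨v, hv⟩ := h2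
    exact ⟨v, by rw [map_smul, hv, smul_zero]⟩

/-- A sequence of vectors of distinct weights that is stable under `R` and `L` up to scalars spans a
stable subspace. -/
lemma lie_mem_span_range {V : Type} [AddCommGroup V] [Module ℂ V] [LieRingModule 𝔤 V]
    [LieModule ℂ 𝔤 V] {x : ℕ → V} {c : ℕ → ℂ} (hH : ∀ j, ⁅H, x j⁆ = c j • x j)
    (hR : ∀ j, ⁅R, x j⁆ ∈ Submodule.span ℂ (Set.range x))
    (hL : ∀ j, ⁅L, x j⁆ ∈ Submodule.span ℂ (Set.range x)) (X : 𝔤) (v : V)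
    (hv : v ∈ Submodule.span ℂ (Set.range x)) : ⁅X, v⁆ ∈ Submodule.span ℂ (Set.range x) := by
  refine lie_mem_of_basis (fun _ => lie_mem_span H ?_) (fun _ => lie_mem_span R ?_)
    (fun _ => lie_mem_span L ?_) X hv
  · rintro _ ⟨j, rfl⟩
    rw [hH]
    exact Submodule.smul_mem _ _ (Submodule.subset_span ⟨j, rfl⟩)
  · rintro _ ⟨j, rfl⟩; exact hR j
  · rintro _ ⟨j, rfl⟩; exact hL j

/-- A weight vector is `K`-finite because `K` acts on it by scalars. It is finite under the center
because the center acts by scalars on the members of a stable family with distinct weights. -/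
lemma mem_nFiniteForms {Γ : Subgroup SL(2, ℤ)} {x : ℕ → SmoothFn} {c : ℕ → ℂ} (hc : Injective c)
    (hH : ∀ j, ⁅H, x j⁆ = c j • x j) (hR : ∀ j, ⁅R, x j⁆ ∈ Submodule.span ℂ (Set.range x))
    (hL : ∀ j, ⁅L, x j⁆ ∈ Submodule.span ℂ (Set.range x)) {j : ℕ} {m : ℤ}
    (hm : x j ∈ autWeight Γ m) (hN : ∃ v : ℕ, (lowerEnd ^ v) (x j) = 0) : x j ∈ nFiniteForms Γ := by
  refine ⟨⟨hm.1, isKFinite_iff.mpr (mem_orbitFinite_of_forall _ _ fun k _ => ?_),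
    isZFinite_iff.mpr (mem_orbitFinite_of_forall _ _ fun z hz => ?_), hm.2.1⟩,
    isNFinite_iff.mpr hN⟩
  · rw [mem_weightSpace_iff_chi.mp hm.2.2 k]
    exact Submodule.smul_mem _ _ (Submodule.mem_span_singleton_self _)
  · exact center_mem_span hc hH (lie_mem_span_range hH hR hL) hz j

lemma lie_R_eisVec (j : ℕ) : ∃ r : ℂ, ⁅R, eisVec j⁆ = r • eisVec (j + 1) := by
  rcases j with _ | j
  · exact ⟨0, by rw [zero_smul]; exact lie_R_oneFn⟩
  · exact ⟨1, by rw [one_smul]; exact (raisePow_succ j _).symm⟩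

lemma lie_L_eisVec_zero : ⁅L, eisVec 0⁆ = 0 := lie_L_oneFn

lemma lie_R_eisVec_mem (j : ℕ) : ⁅R, eisVec j⁆ ∈ Submodule.span ℂ (Set.range eisVec) := by
  obtain ⟨r, hr⟩ := lie_R_eisVec j
  rw [hr]
  exact Submodule.smul_mem _ _ (Submodule.subset_span ⟨j + 1, rfl⟩)

lemma lie_L_eisVec_mem (j : ℕ) : ⁅L, eisVec j⁆ ∈ Submodule.span ℂ (Set.range eisVec) := by
  rcases j with _ | j
  · rw [lie_L_eisVec_zero]; exact zero_mem _
  · rw [lie_L_eisVec_succ]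
    exact Submodule.smul_mem _ _ (Submodule.subset_span ⟨j, rfl⟩)

lemma eisVec_mem_nFiniteForms (Γ : Subgroup SL(2, ℤ)) (j : ℕ) : eisVec j ∈ nFiniteForms Γ := by
  refine mem_nFiniteForms (c := fun j => (2 * j : ℂ)) ?_ lie_H_eisVec lie_R_eisVec_mem
    lie_L_eisVec_mem (eisVec_mem_autWeight Γ j) ⟨j + 1, ?_⟩
  · intro i j hij
    exact_mod_cast mul_left_cancel₀ (two_ne_zero (α := ℂ)) hij
  · rw [← eisLadder_one]; exact isLadder_eisLadder.pow_apply j 1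

lemma modLadder_mem_nFiniteForms (Γ : Subgroup SL(2, ℤ)) [Γ.FiniteIndex] (p j : ℕ)
    (f : M Γ (p + 1)) : modLadder Γ p j f ∈ nFiniteForms Γ := by
  refine mem_nFiniteForms (x := fun j => modLadder Γ p j f) (c := fun j => (p : ℂ) + 1 + 2 * j) ?_
    (fun j => lie_H_modLadder Γ p j f) (fun j => ?_) (fun j => ?_) (modLadder_mem_autWeight Γ p j f)
    ⟨j + 1, (isLadder_modLadder Γ p).pow_apply j f⟩
  · intro i j hij
    exact_mod_cast mul_left_cancel₀ (two_ne_zero (α := ℂ)) (add_left_cancel hij)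
  · rw [lie_R_modLadder]
    exact Submodule.subset_span ⟨j + 1, rfl⟩
  · rcases j with _ | j
    · rw [show ⁅L, modLadder Γ p 0 f⁆ = 0 from lie_L_modLift f]; exact zero_mem _
    · rw [lie_L_modLadder_succ]
      exact Submodule.smul_mem _ _ (Submodule.subset_span ⟨j, rfl⟩)

lemma component_le (Γ : Subgroup SL(2, ℤ)) [Γ.FiniteIndex] (o : Option ℕ) :
    component Γ o ≤ nFiniteSubmodule Γ := by
  rcases o with _ | p
  · refine Submodule.span_le.mpr ?_
    rintro _ ⟨⟨j, c⟩, rfl⟩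
    exact (nFiniteSubmodule Γ).smul_mem c (eisVec_mem_nFiniteForms Γ j)
  · refine Submodule.span_le.mpr ?_
    rintro _ ⟨⟨j, f⟩, rfl⟩
    exact modLadder_mem_nFiniteForms Γ p j f

lemma coeff_Ad_L (k : K) : Ad k L = (chi k ^ 2)⁻¹ • L := by
  obtain ⟨h1, h2, h3⟩ := DPlus.Ad_coeff k L
  have hc : coeffH L = 0 ∧ coeffR L = 0 ∧ coeffL L = 1 := by
    refine ⟨?_, ?_, ?_⟩ <;> simp [coeffH, coeffR, coeffL, L, tracelessMat]
    ring_nf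
  have h0 := pow_ne_zero 2 (chi_ne_zero k)
  rw [eq_coeff (Ad k L), h1, h2, hc.1, hc.2.1, zero_smul, mul_zero, zero_smul, zero_add, zero_add]
  congr 1
  rw [hc.2.2] at h3
  field_simp
  rw [eq_div_iff h0, mul_comm]; exact h3

/-- The adjoint action of `K` multiplies `L` by scalars, so it does not change the order of
nilpotency. -/
lemma lowerEnd_pow_rho (v : ℕ) (k : K) {Φ : SmoothFn} (h : (lowerEnd ^ v) Φ = 0) :
    (lowerEnd ^ v) (GKRep.rho k Φ) = 0 := by
  induction v generalizing Φ with
  | zero => rw [show Φ = 0 from h, map_zero, map_zero]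
  | succ v ih =>
    have h0 := pow_ne_zero 2 (chi_ne_zero k)
    have h1 : ⁅L, GKRep.rho k Φ⁆ = (chi k ^ 2) • GKRep.rho k ⁅L, Φ⁆ := by
      rw [rho_lie_smoothFn, coeff_Ad_L, smul_lie, smul_smul, mul_inv_cancel₀ h0, one_smul]
    rw [pow_succ, Module.End.mul_apply]
    change (lowerEnd ^ v) ⁅L, GKRep.rho k Φ⁆ = 0
    rw [h1, map_smul, ih (by rw [pow_succ] at h; exact h), smul_zero]

/-- The norm of `g` depends only on `g • i`, and `K` fixes `i`. -/
lemma isSlowlyIncreasing_rho (k : K) {Φ : SmoothFn} (h : IsSlowlyIncreasing Φ.1) :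
    IsSlowlyIncreasing (GKRep.rho k Φ : SmoothFn).1 := by
  obtain ⟨C, N, hC⟩ := h
  refine ⟨C, N, fun g => (hC (g * k.1)).trans_eq ?_⟩
  change C * Real.sqrt (sqNorm (g * k.1)) ^ N = C * Real.sqrt (sqNorm g) ^ N
  rw [sqNorm_eq_size, sqNorm_eq_size, mul_smul, smul_I_of_mem_K]

/-- The `𝔫`-finite automorphic forms are the sum of the spaces `component Γ o`. -/
theorem nFiniteSubmodule_eq (Γ : Subgroup SL(2, ℤ)) [Γ.FiniteIndex] :
    nFiniteSubmodule Γ = ⨆ o, component Γ o := by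
  refine le_antisymm ?_ (iSup_le (component_le Γ))
  rintro Φ ⟨h1, h2⟩
  obtain ⟨v, hv⟩ := isNFinite_iff.mp h2
  set W : Submodule ℂ SmoothFn := Submodule.span ℂ (Set.range fun k : K => GKRep.rho k Φ) with hW
  have : FiniteDimensional ℂ W := h1.kFinite
  have hWK : ∀ k : K, ∀ Ψ ∈ W, GKRep.rho k Ψ ∈ W := by
    intro k Ψ hΨ
    suffices hle : W ≤ W.comap (GKRep.rho k) from hle hΨ
    rw [hW, Submodule.span_le]
    rintro _ ⟨l, rfl⟩
    refine Submodule.subset_span ⟨k * l, ?_⟩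
    change GKRep.rho (k * l) Φ = GKRep.rho k (GKRep.rho l Φ)
    rw [map_mul]; rfl
  have hΦW : Φ ∈ W := Submodule.subset_span ⟨1, by
    change GKRep.rho 1 Φ = Φ
    rw [map_one]; rfl⟩
  -- These conditions are linear and pass from `Φ` to its `K`-translates, hence to the weight
  -- components of `Φ`, which lie in `W`.
  let P : Submodule ℂ SmoothFn :=
    { carrier := {Ψ | IsLeftInvariant Γ Ψ.1 ∧ IsSlowlyIncreasing Ψ.1 ∧ (lowerEnd ^ v) Ψ = 0}
      add_mem' := fun {_ _} hΦ hΨ =>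
        ⟨fun γ hγ g => congrArg₂ (· + ·) (hΦ.1 γ hγ g) (hΨ.1 γ hγ g),
          isSlowlyIncreasing_add hΦ.2.1 hΨ.2.1, by rw [map_add, hΦ.2.2, hΨ.2.2, add_zero]⟩
      zero_mem' := ⟨fun _ _ _ => rfl, isSlowlyIncreasing_zero, map_zero _⟩
      smul_mem' := fun c _ hΦ => ⟨fun γ hγ g => congrArg (c * ·) (hΦ.1 γ hγ g),
        isSlowlyIncreasing_smul hΦ.2.1 c, by rw [map_smul, hΦ.2.2, smul_zero]⟩ }
  have hWP : W ≤ P := by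
    rw [hW, Submodule.span_le]
    rintro _ ⟨k, rfl⟩
    refine ⟨fun γ hγ g => ?_, isSlowlyIncreasing_rho k h1.slowly_increasing,
      lowerEnd_pow_rho v k hv⟩
    change Φ.1 (toReal γ * g * k.1) = Φ.1 (g * k.1)
    rw [mul_assoc]
    exact h1.left_invariant γ hγ _
  refine (le_iSup_weightSpace W hWK).trans (iSup_le fun m => ?_) hΦW
  rintro Ψ ⟨hΨ, hΨW⟩
  obtain ⟨h3, h4, h5⟩ := hWP hΨW
  exact mem_iSup_component Γ v ⟨h3, h4, hΨ⟩ h5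

end Forms

/-! ### The spans as `(𝔤, K)`-modules. -/

section Modules

lemma modLadder_mem_weightSpace (Γ : Subgroup SL(2, ℤ)) (p j : ℕ) (f : M Γ (p + 1)) :
    modLadder Γ p j f ∈ weightSpace SmoothFn (p + 1 + 2 * j) :=
  mem_weightSpace_of_eigen (by rw [lie_H_modLadder]; push_cast; rfl)

lemma eisVec_mem_weightSpace (j : ℕ) : eisVec j ∈ weightSpace SmoothFn (2 * j) :=
  mem_weightSpace_of_eigen (by rw [lie_H_eisVec]; push_cast; rfl)

/-- The module spanned by `1, Φ₂, R Φ₂, …`. -/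
def eisModule : GKSubmodule SmoothFn :=
  GKSubmodule.span (Set.range fun x : ℕ × ℂ => eisLadder x.1 x.2)
    (by
      rintro _ ⟨⟨j, c⟩, rfl⟩
      exact ⟨2 * j, Submodule.smul_mem _ c (eisVec_mem_weightSpace j)⟩)
    (by
      rintro _ ⟨⟨j, c⟩, rfl⟩
      change ⁅H, c • eisVec j⁆ ∈ _
      rw [lie_smul_smoothFn, lie_H_eisVec]
      refine Submodule.smul_mem _ _ (Submodule.smul_mem _ _ ?_)
      rw [← eisLadder_one]; exact mem_ladderSpan eisLadder j 1)
    (by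
      rintro _ ⟨⟨j, c⟩, rfl⟩
      change ⁅R, c • eisVec j⁆ ∈ _
      obtain ⟨r, hr⟩ := lie_R_eisVec j
      rw [lie_smul_smoothFn, hr]
      refine Submodule.smul_mem _ _ (Submodule.smul_mem _ _ ?_)
      rw [← eisLadder_one]; exact mem_ladderSpan eisLadder (j + 1) 1)
    (by
      rintro _ ⟨⟨j, c⟩, rfl⟩
      exact isLadder_eisLadder.apply_mem (mem_ladderSpan eisLadder j c))

/-- The module spanned by the functions `R^j f` with `f` a modular form of weight `p + 1`. -/
def modModule (Γ : Subgroup SL(2, ℤ)) (p : ℕ) : GKSubmodule SmoothFn :=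
  GKSubmodule.span (Set.range fun x : ℕ × M Γ (p + 1) => modLadder Γ p x.1 x.2)
    (by
      rintro _ ⟨⟨j, f⟩, rfl⟩
      exact ⟨_, modLadder_mem_weightSpace Γ p j f⟩)
    (by
      rintro _ ⟨⟨j, f⟩, rfl⟩
      rw [lie_H_modLadder]
      exact Submodule.smul_mem _ _ (mem_ladderSpan (modLadder Γ p) j f))
    (by
      rintro _ ⟨⟨j, f⟩, rfl⟩
      rw [lie_R_modLadder]
      exact mem_ladderSpan (modLadder Γ p) (j + 1) f)
    (by
      rintro _ ⟨⟨j, f⟩, rfl⟩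
      exact (isLadder_modLadder Γ p).apply_mem (mem_ladderSpan (modLadder Γ p) j f))

/-- The `(𝔤, K)`-module of `𝔫`-finite automorphic forms. -/
def nFiniteModule (Γ : Subgroup SL(2, ℤ)) : GKSubmodule SmoothFn :=
  GKSubmodule.sum fun o : Option ℕ => o.elim eisModule (modModule Γ)

lemma nFiniteModule_toSubmodule (Γ : Subgroup SL(2, ℤ)) :
    (nFiniteModule Γ).toSubmodule = ⨆ o, component Γ o := by
  refine iSup_congr fun o => ?_
  rcases o with _ | p <;> rfl

theorem mem_nFiniteModule (Γ : Subgroup SL(2, ℤ)) [Γ.FiniteIndex] (Φ : SmoothFn) :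
    Φ ∈ (nFiniteModule Γ).toSubmodule ↔ Φ ∈ nFiniteForms Γ := by
  rw [nFiniteModule_toSubmodule, ← nFiniteSubmodule_eq]
  rfl

/-- A stable space of smooth functions that is contained in the sum of its weight spaces is a
`(𝔤, K)`-module. -/
lemma isGKModule_of_le (N : GKSubmodule SmoothFn)
    (h : N.toSubmodule ≤ ⨆ m : ℤ, weightSpace SmoothFn m ⊓ N.toSubmodule) :
    IsGKModule N.toLieSubmodule where
  rho_lie k X v := Subtype.ext (rho_lie_smoothFn k X v.1)
  iSup_weightSpace := by
    have hinj : Injective N.toSubmodule.subtype := Subtype.val_injective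
    apply Submodule.map_injective_of_injective hinj
    rw [Submodule.map_iSup, Submodule.map_subtype_top]
    refine le_antisymm (iSup_le fun m => ?_) (h.trans (iSup_mono fun m => ?_))
    · rintro _ ⟨w, -, rfl⟩
      exact w.2
    · rintro v ⟨hv, hvN⟩
      exact ⟨⟨v, hvN⟩, (mem_weightSpace_coe N m ⟨v, hvN⟩).mpr hv, rfl⟩
  lie_H m v hv := Subtype.ext (lie_H_of_mem_weightSpace ((mem_weightSpace_coe N m v).mp hv))

lemma component_le_iSup_weightSpace (Γ : Subgroup SL(2, ℤ)) (o : Option ℕ) :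
    component Γ o ≤ ⨆ m : ℤ, weightSpace SmoothFn m ⊓ component Γ o := by
  rcases o with _ | p
  · refine Submodule.span_le.mpr ?_
    rintro _ ⟨⟨j, c⟩, rfl⟩
    exact Submodule.mem_iSup_of_mem (2 * j) ⟨Submodule.smul_mem _ c (eisVec_mem_weightSpace j),
      mem_ladderSpan eisLadder j c⟩
  · refine Submodule.span_le.mpr ?_
    rintro _ ⟨⟨j, f⟩, rfl⟩
    exact Submodule.mem_iSup_of_mem (p + 1 + 2 * j) ⟨modLadder_mem_weightSpace Γ p j f,
      mem_ladderSpan (modLadder Γ p) j f⟩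

lemma isGKModule_nFiniteModule (Γ : Subgroup SL(2, ℤ)) :
    IsGKModule (nFiniteModule Γ).toLieSubmodule := by
  refine isGKModule_of_le _ ?_
  rw [nFiniteModule_toSubmodule]
  refine iSup_le fun o => (component_le_iSup_weightSpace Γ o).trans (iSup_mono fun m => ?_)
  exact inf_le_inf_left _ (le_iSup (component Γ) o)

/-- The module generated by `Φ₂` is spanned by `1, Φ₂, R Φ₂, …`. -/
lemma generatedBy_Phi2 : GKSubmodule.generatedBy {Phi2} = eisModule := by
  have hsub : (GKSubmodule.generatedBy {Phi2}).toSubmodule = eisModule.toSubmodule := by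
    refine le_antisymm (fun Φ hΦ => hΦ eisModule ?_) ?_
    · refine Submodule.span_le.mpr ?_
      rintro _ ⟨⟨j, c⟩, rfl⟩ N hN
      refine N.smul_mem' c ?_
      have h1 : Phi2 ∈ N.toSubmodule := hN rfl
      have h2 : ∀ j, raisePow j Phi2 ∈ N.toSubmodule := by
        intro j
        induction j with
        | zero => exact h1
        | succ j ih => rw [raisePow_succ]; exact N.lie_mem ih
      rcases j with _ | j
      · have h3 : ⁅L, Phi2⁆ ∈ N.toSubmodule := N.lie_mem h1
        -- The constants belong to the generated module because `L Φ₂ = 3/π` is not zero.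
        have h4 : oneFn = (3 / (Real.pi : ℂ))⁻¹ • ⁅L, Phi2⁆ := by
          rw [lie_L_Phi2]; exact (inv_smul_smul₀ (eisCoeff_ne_zero 0) oneFn).symm
        change oneFn ∈ N.toSubmodule
        rw [h4]
        exact N.toSubmodule.smul_mem _ h3
      · exact h2 j
    · rintro _ rfl
      have := mem_ladderSpan eisLadder 1 1
      rwa [eisLadder_one] at this
  have : ∀ N N' : GKSubmodule SmoothFn, N.toSubmodule = N'.toSubmodule → N = N' := by
    rintro ⟨⟨N, hN⟩, hN'⟩ ⟨⟨N', _⟩, _⟩ h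
    change N = N' at h
    subst h
    rfl
  exact this _ _ hsub

end Modules
end NFin

end

set_option linter.unusedSectionVars false

noncomputable section

namespace NFin

open UpperHalfPlane Function Matrix.SpecialLinearGroup

/-! ### Maps between ladders and homomorphisms of `(𝔤, K)`-modules. -/

section LadderMap

variable {V W M M' : Type} [AddCommGroup V] [Module ℂ V] [AddCommGroup W] [Module ℂ W]
  [AddCommGroup M] [Module ℂ M] [AddCommGroup M'] [Module ℂ M'] {S : Module.End ℂ V}
  {T : ℕ → M →ₗ[ℂ] V} {a a' : ℕ → ℂ} {S' : Module.End ℂ W} {T' : ℕ → M' →ₗ[ℂ] W}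

/-- By local nilpotency, injectivity need only be checked on the kernel of `S`. This is the bottom
rung, where `f` is given by `φ`. -/
lemma IsLadder.injective_of_comm (h : IsLadder S T a) (htop : ladderSpan T = ⊤)
    (h' : IsLadder S' T' a') (f : V →ₗ[ℂ] W) (hf : ∀ v, f (S v) = S' (f v)) (φ : M →ₗ[ℂ] M')
    (hφ : Injective φ) (h0 : ∀ m, f (T 0 m) = T' 0 (φ m)) : Injective f := by
  have hmem : ∀ v, v ∈ ladderSpan T := fun v => htop ▸ Submodule.mem_top
  refine injective_of_locally_nilpotent S S' f hf (fun v => h.exists_pow_eq_zero (hmem v)) ?_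
  intro v hv hfv
  obtain ⟨m, rfl⟩ := h.eq_apply_zero (hmem v) hv
  have h1 : φ m = 0 := h'.injective (by rw [← h0, hfv, map_zero])
  rw [(injective_iff_map_eq_zero φ).mp hφ m h1, map_zero]

lemma range_eq_ladderSpan (htop : ladderSpan T = ⊤) (f : V →ₗ[ℂ] W) (φ : M →ₗ[ℂ] M')
    (hφ : Surjective φ) (h : ∀ j m, f (T j m) = T' j (φ m)) :
    LinearMap.range f = ladderSpan T' := by
  rw [LinearMap.range_eq_map, ← htop, ladderSpan, Submodule.map_span, ← Set.range_comp]
  congr 1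
  ext w
  constructor
  · rintro ⟨⟨j, m⟩, rfl⟩
    exact ⟨(j, φ m), (h j m).symm⟩
  · rintro ⟨⟨j, m'⟩, rfl⟩
    obtain ⟨m, rfl⟩ := hφ m'
    exact ⟨(j, m), h j m⟩

end LadderMap

section Hom

variable {V W : Type} [AddCommGroup V] [Module ℂ V] [LieRingModule 𝔤 V] [LieModule ℂ 𝔤 V] [GKRep V]
  [AddCommGroup W] [Module ℂ W] [LieRingModule 𝔤 W] [LieModule ℂ 𝔤 W] [GKRep W]

/-- The image of a homomorphism. -/
def GKHom.range (T : GKHom V W) : GKSubmodule W where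
  toLieSubmodule := T.toLieModuleHom.range
  rho_mem := by
    rintro k _ ⟨v, rfl⟩
    exact ⟨GKRep.rho k v, T.map_rho k v⟩

lemma GKHom.gkIsomorphic_of_injective (T : GKHom V W) (hT : Injective T.toLieModuleHom)
    (N : GKSubmodule W) (hN : LinearMap.range T.toLieModuleHom.toLinearMap = N.toSubmodule) :
    GKIsomorphic V N.toLieSubmodule := by
  have hmem : ∀ v, T.toLieModuleHom v ∈ N.toSubmodule := fun v => hN ▸ ⟨v, rfl⟩
  refine ⟨⟨⟨T.toLieModuleHom.toLinearMap.codRestrict N.toSubmodule hmem,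
    fun {X v} => Subtype.ext (T.toLieModuleHom.map_lie X v)⟩,
    fun k v => Subtype.ext (T.map_rho k v)⟩, fun v w h => hT (congrArg Subtype.val h), fun w => ?_⟩
  have hw : w.1 ∈ LinearMap.range T.toLieModuleHom.toLinearMap := hN ▸ w.2
  obtain ⟨v, hv⟩ := hw
  exact ⟨v, Subtype.ext hv⟩

lemma lie_lof {ι : Type} [DecidableEq ι] (i : ι) (X : 𝔤) (v : V) :
    ⁅X, DirectSum.lof ℂ ι (fun _ => V) i v⁆ = DirectSum.lof ℂ ι (fun _ => V) i ⁅X, v⁆ :=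
  ((DirectSum.lieModuleOf ℂ ι 𝔤 (fun _ => V) i).map_lie X v).symm

lemma rho_lof {ι : Type} [DecidableEq ι] (i : ι) (k : K) (v : V) :
    GKRep.rho k (DirectSum.lof ℂ ι (fun _ => V) i v) =
      DirectSum.lof ℂ ι (fun _ => V) i (GKRep.rho k v) :=
  DirectSum.lmap_lof (fun _ : ι => GKRep.rho (V := V) k) i v

/-- The homomorphism on a direct sum of copies of `V` with given components. -/
def GKHom.directSum {ι : Type} [DecidableEq ι] (T : ι → GKHom V W) : GKHom (⨁ _ : ι, V) W where
  toLinearMap := DirectSum.toModule ℂ ι W fun i => (T i).toLieModuleHom.toLinearMap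
  map_lie' := by
    intro X v
    refine LinearMap.congr_fun
      (f := DirectSum.toModule ℂ ι W (fun i => (T i).toLieModuleHom.toLinearMap) ∘ₗ
        LieModule.toEnd ℂ 𝔤 (⨁ _ : ι, V) X)
      (g := LieModule.toEnd ℂ 𝔤 W X ∘ₗ
        DirectSum.toModule ℂ ι W (fun i => (T i).toLieModuleHom.toLinearMap))
      (DirectSum.linearMap_ext ℂ fun i => LinearMap.ext fun w => ?_) v
    simp only [LinearMap.comp_apply, LieModule.toEnd_apply_apply, lie_lof, DirectSum.toModule_lof]
    exact (T i).toLieModuleHom.map_lie X w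
  map_rho := by
    intro k v
    refine LinearMap.congr_fun
      (f := DirectSum.toModule ℂ ι W (fun i => (T i).toLieModuleHom.toLinearMap) ∘ₗ GKRep.rho k)
      (g := GKRep.rho k ∘ₗ
        DirectSum.toModule ℂ ι W (fun i => (T i).toLieModuleHom.toLinearMap))
      (DirectSum.linearMap_ext ℂ fun i => LinearMap.ext fun w => ?_) v
    simp only [LinearMap.comp_apply, rho_lof, DirectSum.toModule_lof]
    exact (T i).map_rho k w

lemma GKHom.directSum_lof {ι : Type} [DecidableEq ι] (T : ι → GKHom V W) (i : ι) (v : V) :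
    (GKHom.directSum T).toLieModuleHom (DirectSum.lof ℂ ι (fun _ => V) i v) =
      (T i).toLieModuleHom v :=
  DirectSum.toModule_lof ℂ (φ := fun i => (T i).toLieModuleHom.toLinearMap) i v

end Hom

/-! ### `D_{p,+}` and its finite direct sums as ladders. -/

section DPlusLadder

variable (p : ℕ)

lemma DPlus.span_range_e : Submodule.span ℂ (Set.range (DPlus.e p)) = ⊤ := by
  rw [eq_top_iff]
  intro v _
  have : (Submodule.span ℂ (Set.range (DPlus.e p))).mkQ = 0 := DPlus.hom_ext p fun j =>
    (Submodule.Quotient.mk_eq_zero _).mpr (Submodule.subset_span ⟨j, rfl⟩)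
  exact (Submodule.Quotient.mk_eq_zero _).mp (LinearMap.congr_fun this v)

variable {p} in
/-- The linear map on `D_{p,+}` with prescribed values on the basis. -/
def DPlus.linTo {W : Type} [AddCommGroup W] [Module ℂ W] (x : ℕ → W) : DPlus p →ₗ[ℂ] W :=
  Finsupp.linearCombination ℂ x

lemma DPlus.linTo_e {W : Type} [AddCommGroup W] [Module ℂ W] (x : ℕ → W) (j : ℕ) :
    DPlus.linTo x (DPlus.e p j) = x j :=
  (Finsupp.linearCombination_single ℂ (1 : ℂ) j).trans (one_smul ℂ _)

lemma DPlus.lie_H_e (j : ℕ) : ⁅H, DPlus.e p j⁆ = ((p : ℂ) + 1 + 2 * j) • DPlus.e p j := by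
  rw [DPlus.lie_H_eq, DPlus.opH, DPlus.lin_e]

lemma DPlus.lie_R_e (j : ℕ) : ⁅R, DPlus.e p j⁆ = DPlus.e p (j + 1) := by
  rw [DPlus.lie_R_eq, DPlus.opR, DPlus.lin_e]

lemma DPlus.lie_L_e_zero : ⁅L, DPlus.e p 0⁆ = 0 := by
  rw [DPlus.lie_L_eq, DPlus.opL, DPlus.lin_e]; simp

lemma DPlus.lie_L_e_succ (j : ℕ) :
    ⁅L, DPlus.e p (j + 1)⁆ = (-(j + 1 : ℂ) * ((p : ℂ) + 1 + j)) • DPlus.e p j := by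
  rw [DPlus.lie_L_eq, DPlus.opL, DPlus.lin_e, Nat.add_sub_cancel]
  congr 1
  push_cast
  ring

lemma DPlus.coeff_ne_zero (j : ℕ) : -(j + 1 : ℂ) * ((p : ℂ) + 1 + j) ≠ 0 := by
  refine mul_ne_zero (neg_ne_zero.mpr (by exact_mod_cast Nat.succ_ne_zero j)) ?_
  have : (p : ℂ) + 1 + j = ((p + j + 1 : ℕ) : ℂ) := by push_cast; ring
  rw [this]
  exact Nat.cast_ne_zero.mpr (by omega)

lemma DPlus.e_ne_zero (j : ℕ) : DPlus.e p j ≠ 0 := Finsupp.single_ne_zero.mpr one_ne_zero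

/-- The maps `m ↦ ∑ m_i e_{j,i}`, where `e_{j,i}` is the `j`-th basis vector of the `i`-th summand
of a direct sum of copies of `D_{p,+}`. -/
def DPlus.sumLadder (n j : ℕ) : (Fin n → ℂ) →ₗ[ℂ] ⨁ _ : Fin n, DPlus p :=
  ∑ i, (DirectSum.lof ℂ (Fin n) (fun _ => DPlus p) i).comp
    ((LinearMap.toSpanSingleton ℂ (DPlus p) (DPlus.e p j)).comp (LinearMap.proj i))

lemma DPlus.sumLadder_apply (n j : ℕ) (m : Fin n → ℂ) : DPlus.sumLadder p n j m =
    ∑ i, DirectSum.lof ℂ (Fin n) (fun _ => DPlus p) i (m i • DPlus.e p j) := by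
  simp [DPlus.sumLadder]

/-- The direct sum of `n` copies is one ladder over `ℂⁿ`, with the same coefficients as for modular
forms. The comparison thus reduces to a choice of basis of the forms on the bottom rung. -/
lemma DPlus.isLadder_sumLadder (n : ℕ) :
    IsLadder (LieModule.toEnd ℂ 𝔤 (⨁ _ : Fin n, DPlus p) L) (DPlus.sumLadder p n)
      fun j => -(j + 1 : ℂ) * ((p : ℂ) + 1 + j) where
  zero m := by
    rw [DPlus.sumLadder_apply, map_sum]
    refine Finset.sum_eq_zero fun i _ => ?_
    rw [LieModule.toEnd_apply_apply, lie_lof, lie_smul, DPlus.lie_L_e_zero, smul_zero, map_zero]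
  succ j m := by
    rw [DPlus.sumLadder_apply, map_sum, DPlus.sumLadder_apply, Finset.smul_sum]
    refine Finset.sum_congr rfl fun i _ => ?_
    rw [LieModule.toEnd_apply_apply, lie_lof, lie_smul, DPlus.lie_L_e_succ, smul_comm, map_smul]
  ne_zero := DPlus.coeff_ne_zero p
  injective := by
    rw [injective_iff_map_eq_zero]
    intro m hm
    funext i
    have h := congrArg (DirectSum.component ℂ (Fin n) (fun _ => DPlus p) i) hm
    rw [DPlus.sumLadder_apply, map_sum, Finset.sum_eq_single i, DirectSum.component.lof_self,
      map_zero] at h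
    · exact (smul_eq_zero.mp h).resolve_right (DPlus.e_ne_zero p 0)
    · intro j _ hj
      rw [DirectSum.component.of, dif_neg hj]
    · intro h; exact absurd (Finset.mem_univ i) h

lemma DPlus.ladderSpan_sumLadder (n : ℕ) : ladderSpan (DPlus.sumLadder p n) = ⊤ := by
  rw [eq_top_iff]
  intro v _
  have : (ladderSpan (DPlus.sumLadder p n)).mkQ = 0 := by
    refine DirectSum.linearMap_ext ℂ fun i => DPlus.hom_ext p fun j => ?_
    refine (Submodule.Quotient.mk_eq_zero _).mpr ?_
    have h := mem_ladderSpan (DPlus.sumLadder p n) j (Pi.single i 1)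
    rw [DPlus.sumLadder_apply, Finset.sum_eq_single i, Pi.single_eq_same, one_smul] at h
    · exact h
    · intro k _ hk
      rw [Pi.single_eq_of_ne hk, zero_smul, map_zero]
    · intro h; exact absurd (Finset.mem_univ i) h
  exact (Submodule.Quotient.mk_eq_zero _).mp (LinearMap.congr_fun this v)

lemma DPlus.isLadder_e :
    IsLadder (LieModule.toEnd ℂ 𝔤 (DPlus p) L)
      (fun j => LinearMap.toSpanSingleton ℂ (DPlus p) (DPlus.e p j))
      fun j => -(j + 1 : ℂ) * ((p : ℂ) + 1 + j) where
  zero c := by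
    change ⁅L, c • DPlus.e p 0⁆ = 0
    rw [lie_smul, DPlus.lie_L_e_zero, smul_zero]
  succ j c := by
    change ⁅L, c • DPlus.e p (j + 1)⁆ = _ • c • DPlus.e p j
    rw [lie_smul, DPlus.lie_L_e_succ, smul_comm]
  ne_zero := DPlus.coeff_ne_zero p
  injective := smul_left_injective ℂ (DPlus.e_ne_zero p 0)

lemma DPlus.ladderSpan_e :
    ladderSpan (fun j => LinearMap.toSpanSingleton ℂ (DPlus p) (DPlus.e p j)) = ⊤ := by
  rw [eq_top_iff, ← DPlus.span_range_e p, Submodule.span_le]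
  rintro _ ⟨j, rfl⟩
  exact Submodule.subset_span ⟨(j, 1), one_smul ℂ _⟩

end DPlusLadder

/-! ### Isotypic components, independence and lowest weight vectors. -/

section Isotypic

variable (Γ : Subgroup SL(2, ℤ)) (p : ℕ)

/-- The homomorphism `D_{p,+} → C^∞(SL(2, ℝ))` defined by a modular form of weight `p + 1`. -/
def modHom (f : M Γ (p + 1)) : GKHom (DPlus p) SmoothFn :=
  GKHom.ofSpan (Set.range (DPlus.e p)) (DPlus.span_range_e p)
    (DPlus.linTo fun j => modLadder Γ p j f)
    (by
      rintro _ ⟨j, rfl⟩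
      refine ⟨_, DPlus.e_mem_weightSpace p j, ?_⟩
      rw [DPlus.linTo_e]
      have := modLadder_mem_weightSpace Γ p j f
      push_cast
      exact this)
    (by
      rintro _ ⟨j, rfl⟩
      rw [DPlus.lie_H_e, map_smul, DPlus.linTo_e,
        lie_H_modLadder])
    (by
      rintro _ ⟨j, rfl⟩
      rw [DPlus.lie_R_e, DPlus.linTo_e, DPlus.linTo_e, lie_R_modLadder])
    (by
      rintro _ ⟨j, rfl⟩
      rcases j with _ | j
      · rw [DPlus.lie_L_e_zero, map_zero, DPlus.linTo_e]
        exact (lie_L_modLift f).symm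
      · rw [DPlus.lie_L_e_succ, map_smul, DPlus.linTo_e, DPlus.linTo_e, lie_L_modLadder_succ])

lemma modHom_e (f : M Γ (p + 1)) (j : ℕ) :
    (modHom Γ p f).toLieModuleHom (DPlus.e p j) = modLadder Γ p j f := DPlus.linTo_e p _ j

lemma modHom_injective {f : M Γ (p + 1)} (hf : f ≠ 0) :
    Injective (modHom Γ p f).toLieModuleHom := by
  refine (DPlus.isLadder_e p).injective_of_comm (DPlus.ladderSpan_e p) (isLadder_modLadder Γ p)
    (modHom Γ p f).toLieModuleHom.toLinearMap (fun v => (modHom Γ p f).toLieModuleHom.map_lie L v)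
    (LinearMap.toSpanSingleton ℂ _ f) (smul_left_injective ℂ hf) fun c => ?_
  change (modHom Γ p f).toLieModuleHom (c • DPlus.e p 0) = modLadder Γ p 0 (c • f)
  rw [map_smul, modHom_e, map_smul]

/-- Vectors of the image of a homomorphism from `D_{p,+}` to the `𝔫`-finite forms. -/
lemma exists_modularForm_of_gkHom [Γ.FiniteIndex] (T : GKHom (DPlus p) SmoothFn)
    (hT : ∀ v, T.toLieModuleHom v ∈ (nFiniteModule Γ).toSubmodule) :
    ∃ f : M Γ (p + 1), ∀ j, T.toLieModuleHom (DPlus.e p j) = modLadder Γ p j f := by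
  have h1 := (mem_nFiniteModule Γ _).mp (hT (DPlus.e p 0))
  have h2 : T.toLieModuleHom (DPlus.e p 0) ∈ weightSpace SmoothFn (p + 1) := by
    have := T.map_weightSpace (DPlus.e_mem_weightSpace p 0)
    simpa using this
  have h3 : ⁅L, T.toLieModuleHom (DPlus.e p 0)⁆ = 0 := by
    rw [← LieModuleHom.map_lie, DPlus.lie_L_e_zero, map_zero]
  have h4 := exists_modularForm (Γ := Γ) (m := p + 1)
    ⟨h1.1.left_invariant, h1.1.slowly_increasing, h2⟩ 0 h3
  rw [show (p : ℤ) + 1 - 2 * (0 : ℕ) = p + 1 by simp] at h4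
  obtain ⟨f, hf⟩ := h4
  refine ⟨f, fun j => ?_⟩
  induction j with
  | zero => exact hf
  | succ j ih => rw [← DPlus.lie_R_e, LieModuleHom.map_lie, ih, lie_R_modLadder]

/-- A copy of `D_{p,+}` is generated by its lowest weight vector. This vector has weight `p + 1` and
is killed by `L`, so it is a modular form, and the copy consists of combinations of the `R^j f`.
Conversely, every non-zero form generates such a copy. -/
theorem isotypic_toSubmodule [Γ.FiniteIndex] :
    (isotypic (nFiniteModule Γ) (DPlus p)).toSubmodule = ladderSpan (modLadder Γ p) := by
  refine le_antisymm (iSup_le ?_) (Submodule.span_le.mpr ?_)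
  · rintro ⟨N, hN, T, hT⟩
    let T' : GKHom (DPlus p) SmoothFn :=
      ⟨N.toLieSubmodule.incl.comp T.toLieModuleHom, fun k v => congrArg Subtype.val (T.map_rho k v)⟩
    obtain ⟨f, hf⟩ := exists_modularForm_of_gkHom Γ p T' fun v => hN (T.toLieModuleHom v).2
    intro w hw
    obtain ⟨v, hv⟩ := hT.2 ⟨w, hw⟩
    have h1 : T'.toLieModuleHom v = w := congrArg Subtype.val hv
    have h2 : (⊤ : Submodule ℂ (DPlus p)) ≤
        (ladderSpan (modLadder Γ p)).comap T'.toLieModuleHom.toLinearMap := by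
      rw [← DPlus.span_range_e p, Submodule.span_le]
      rintro _ ⟨j, rfl⟩
      change T'.toLieModuleHom _ ∈ ladderSpan (modLadder Γ p)
      rw [hf j]
      exact mem_ladderSpan _ j f
    rw [← h1]
    exact h2 (Submodule.mem_top (x := v))
  · rintro _ ⟨⟨j, f⟩, rfl⟩
    by_cases hf : f = 0
    · change modLadder Γ p j f ∈ (isotypic (nFiniteModule Γ) (DPlus p)).toSubmodule
      rw [hf, map_zero]
      exact Submodule.zero_mem _
    · have hle : (modHom Γ p f).range.toSubmodule ≤ (nFiniteModule Γ).toSubmodule := by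
        rintro _ ⟨v, rfl⟩
        have h2 : (⊤ : Submodule ℂ (DPlus p)) ≤
            (nFiniteModule Γ).toSubmodule.comap (modHom Γ p f).toLieModuleHom.toLinearMap := by
          rw [← DPlus.span_range_e p, Submodule.span_le]
          rintro _ ⟨j, rfl⟩
          change (modHom Γ p f).toLieModuleHom _ ∈ (nFiniteModule Γ).toSubmodule
          rw [modHom_e]
          exact (mem_nFiniteModule Γ _).mpr (modLadder_mem_nFiniteForms Γ p j f)
        exact h2 (Submodule.mem_top (x := v))
      refine Submodule.mem_iSup_of_mem ⟨(modHom Γ p f).range, hle,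
        (modHom Γ p f).gkIsomorphic_of_injective (modHom_injective Γ p hf) _ rfl⟩ ?_
      exact ⟨DPlus.e p j, modHom_e Γ p f j⟩

lemma summand_eq_component [Γ.FiniteIndex] (o : Option ℕ) :
    summand (nFiniteModule Γ) eisModule o = component Γ o := by
  rcases o with _ | p
  · rfl
  · exact isotypic_toSubmodule Γ p

/-- On the kernel of `L` in the respective summands, `H` acts by the distinct scalars `0` and `p +
1`. -/
theorem iSupIndep_component : iSupIndep (component Γ) := by
  refine iSupIndep_of_locally_nilpotent lowerEnd (LieModule.toEnd ℂ 𝔤 SmoothFn H) (component Γ) ?_ ?_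
    (fun o => o.elim 0 fun p => (p : ℂ) + 1) ?_ ?_
  · rintro (_ | p) v hv
    exacts [isLadder_eisLadder.apply_mem hv, (isLadder_modLadder Γ p).apply_mem hv]
  · rintro (_ | p) v hv
    exacts [isLadder_eisLadder.exists_pow_eq_zero hv, (isLadder_modLadder Γ p).exists_pow_eq_zero hv]
  · rintro (_ | p) (_ | q) h
    · rfl
    · exact absurd h.symm (Nat.cast_add_one_ne_zero q)
    · exact absurd h (Nat.cast_add_one_ne_zero p)
    · have : (p : ℂ) = q := add_right_cancel h
      rw [Nat.cast_injective this]
  · rintro (_ | p) v hv hL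
    · obtain ⟨c, rfl⟩ := isLadder_eisLadder.eq_apply_zero hv hL
      change ⁅H, c • oneFn⁆ = (0 : ℂ) • c • oneFn
      rw [lie_smul_smoothFn, lie_H_oneFn, smul_zero, zero_smul]
    · obtain ⟨f, rfl⟩ := (isLadder_modLadder Γ p).eq_apply_zero hv hL
      refine (lie_H_modLadder Γ p 0 f).trans ?_
      congr 1
      change (p : ℂ) + 1 + 2 * (0 : ℕ) = (p : ℂ) + 1
      simp

/-- A basis of the modular forms gives one copy of `D_{p,+}` for each basis element. The map of
ladders is bijective because it is so on the bottom rung. -/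
theorem gkIsomorphic_isotypic [Γ.FiniteIndex] [FiniteDimensional ℂ (M Γ (p + 1))] :
    GKIsomorphic (⨁ _ : Fin (Module.finrank ℂ (M Γ (p + 1))), DPlus p)
      (isotypic (nFiniteModule Γ) (DPlus p)).toLieSubmodule := by
  let b := Module.finBasis ℂ (M Γ (p + 1))
  let T := GKHom.directSum fun i => modHom Γ p (b i)
  have hT : ∀ j m, T.toLieModuleHom (DPlus.sumLadder p _ j m) =
      modLadder Γ p j (b.equivFun.symm m) := by
    intro j m
    rw [DPlus.sumLadder_apply, map_sum, b.equivFun_symm_apply, map_sum]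
    refine Finset.sum_congr rfl fun i _ => ?_
    rw [GKHom.directSum_lof, map_smul, map_smul, modHom_e]
  refine T.gkIsomorphic_of_injective ?_ _ ?_
  · exact (DPlus.isLadder_sumLadder p _).injective_of_comm (DPlus.ladderSpan_sumLadder p _)
      (isLadder_modLadder Γ p) T.toLieModuleHom.toLinearMap
      (fun v => T.toLieModuleHom.map_lie L v) b.equivFun.symm.toLinearMap
      b.equivFun.symm.injective (hT 0)
  · rw [isotypic_toSubmodule]
    exact range_eq_ladderSpan (DPlus.ladderSpan_sumLadder p _) T.toLieModuleHom.toLinearMap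
      b.equivFun.symm.toLinearMap b.equivFun.symm.surjective hT

/-- The lowest weight vectors of the span of the functions `R^j f` come from modular forms. -/
lemma lie_L_eq_zero_iff_modLift {Φ : SmoothFn} (hΦ : Φ ∈ ladderSpan (modLadder Γ p)) :
    ⁅L, Φ⁆ = 0 ↔ ∃ f, modLift Γ (p + 1) f = Φ := by
  constructor
  · intro h
    obtain ⟨f, hf⟩ := (isLadder_modLadder Γ p).eq_apply_zero hΦ h
    exact ⟨f, hf.symm⟩
  · rintro ⟨f, rfl⟩
    exact lie_L_modLift f

/-- The rung `j` has weight `p + 1 + 2j`, which equals `p + 1` only for `j = 0`, and the bottom rung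
is the kernel of `L`. -/
lemma lie_L_eq_zero_iff_mem_weightSpace {Φ : SmoothFn} (hΦ : Φ ∈ ladderSpan (modLadder Γ p)) :
    ⁅L, Φ⁆ = 0 ↔ Φ ∈ weightSpace SmoothFn (p + 1) := by
  constructor
  · intro h
    obtain ⟨f, rfl⟩ := (lie_L_eq_zero_iff_modLift Γ p hΦ).mp h
    exact modLift_mem_weightSpace f
  · intro h
    have h1 := mem_span_of_eigenvector (LieModule.toEnd ℂ 𝔤 SmoothFn H)
      (x := fun x : ℕ × M Γ (p + 1) => modLadder Γ p x.1 x.2)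
      (c := fun x => (p : ℂ) + 1 + 2 * x.1) (fun x => lie_H_modLadder Γ p x.1 x.2) hΦ
      (lie_H_of_mem_weightSpace h)
    refine (Submodule.span_le.mpr ?_ : _ ≤ LinearMap.ker lowerEnd) h1
    rintro _ ⟨⟨j, f⟩, hj, rfl⟩
    have hj0 : j = 0 := by
      push_cast at hj
      simpa using hj
    subst hj0
    exact lie_L_modLift f

lemma mem_lowestWeightVectors [Γ.FiniteIndex] {Φ : SmoothFn} :
    Φ ∈ lowestWeightVectors (isotypic (nFiniteModule Γ) (DPlus p)) ↔
      ∃ f, modLift Γ (p + 1) f = Φ := by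
  change (Φ ∈ (isotypic (nFiniteModule Γ) (DPlus p)).toSubmodule ∧ _) ↔ _
  rw [isotypic_toSubmodule]
  constructor
  · rintro ⟨h1, h2⟩
    exact (lie_L_eq_zero_iff_modLift Γ p h1).mp h2
  · rintro ⟨f, rfl⟩
    exact ⟨mem_ladderSpan (modLadder Γ p) 0 f, lie_L_modLift f⟩

theorem bijOn_tilde [Γ.FiniteIndex] :
    Set.BijOn (fun Φ : SmoothFn => tilde (p + 1) Φ.1)
      (lowestWeightVectors (isotypic (nFiniteModule Γ) (DPlus p)))
      (Set.range fun f : M Γ (p + 1) => (f : ℍ → ℂ)) := by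
  refine ⟨?_, ?_, ?_⟩
  · intro Φ hΦ
    obtain ⟨f, rfl⟩ := (mem_lowestWeightVectors Γ p).mp hΦ
    exact ⟨f, (tilde_modLift f).symm⟩
  · intro Φ hΦ Ψ hΨ h
    obtain ⟨f, rfl⟩ := (mem_lowestWeightVectors Γ p).mp hΦ
    obtain ⟨g, rfl⟩ := (mem_lowestWeightVectors Γ p).mp hΨ
    change tilde (p + 1) (modLift Γ (p + 1) f).1 = tilde (p + 1) (modLift Γ (p + 1) g).1 at h
    rw [tilde_modLift, tilde_modLift] at h
    rw [DFunLike.coe_injective h]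
  · rintro _ ⟨f, rfl⟩
    exact ⟨modLift Γ (p + 1) f, (mem_lowestWeightVectors Γ p).mpr ⟨f, rfl⟩, tilde_modLift f⟩

end Isotypic

end NFin

end

noncomputable section

namespace NFin

open Function

/-! ### The non-split extension generated by `Φ₂`. -/

section EisensteinModule

/-- The basis vectors `1, Φ₂, R Φ₂, …` of the module generated by `Φ₂`. -/
def eisGen (j : ℕ) : eisModule.toLieSubmodule :=
  ⟨eisVec j, by
    have := mem_ladderSpan eisLadder j 1
    rwa [eisLadder_one] at this⟩

lemma lie_H_eisGen (j : ℕ) : ⁅H, eisGen j⁆ = (2 * j : ℂ) • eisGen j :=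
  Subtype.ext (lie_H_eisVec j)

lemma lie_L_eisGen_zero : ⁅L, eisGen 0⁆ = 0 := Subtype.ext lie_L_eisVec_zero

lemma lie_L_eisGen_succ (j : ℕ) : ⁅L, eisGen (j + 1)⁆ = eisCoeff j • eisGen j :=
  Subtype.ext (lie_L_eisVec_succ j)

lemma lie_R_eisGen_zero : ⁅R, eisGen 0⁆ = 0 := Subtype.ext lie_R_oneFn

lemma lie_R_eisGen_succ (j : ℕ) : ⁅R, eisGen (j + 1)⁆ = eisGen (j + 2) :=
  Subtype.ext (raisePow_succ j Phi2).symm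

lemma eisGen_ne_zero (j : ℕ) : eisGen j ≠ 0 := by
  intro h
  have h1 : eisLadder j 1 = 0 := by
    rw [eisLadder_one]; exact congrArg Subtype.val h
  obtain ⟨c, hc, hcm⟩ := isLadder_eisLadder.pow_self j
  have h2 := hcm 1
  rw [h1, map_zero, eisLadder_one] at h2
  exact (smul_ne_zero hc oneFn_ne_zero) h2.symm

lemma eisGen_mem_weightSpace (j : ℕ) :
    eisGen j ∈ weightSpace eisModule.toLieSubmodule (2 * j) :=
  (mem_weightSpace_coe eisModule _ _).mpr (eisVec_mem_weightSpace j)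

/-- The basis `1, Φ₂, R Φ₂, …` of the module generated by `Φ₂`. -/
def eisBasis : Module.Basis ℕ ℂ eisModule.toLieSubmodule :=
  Module.Basis.mk (v := eisGen)
    (Module.End.eigenvectors_linearIndependent' (LieModule.toEnd ℂ 𝔤 eisModule.toLieSubmodule H)
      (fun j : ℕ => (2 * j : ℂ))
      (fun i j hij => by exact_mod_cast mul_left_cancel₀ (two_ne_zero (α := ℂ)) hij) eisGen
      fun j => ⟨Module.End.mem_eigenspace_iff.mpr (lie_H_eisGen j), eisGen_ne_zero j⟩)
    (by
      have hinj : Injective eisModule.toSubmodule.subtype := Subtype.val_injective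
      refine (Submodule.map_le_map_iff_of_injective hinj _ _).mp ?_
      rw [Submodule.map_subtype_top, Submodule.map_span, ← Set.range_comp]
      refine Submodule.span_le.mpr ?_
      rintro _ ⟨⟨j, c⟩, rfl⟩
      exact Submodule.smul_mem _ c (Submodule.subset_span ⟨j, rfl⟩))

lemma eisBasis_apply (j : ℕ) : eisBasis j = eisGen j := Module.Basis.mk_apply _ _ j

lemma span_range_eisGen : Submodule.span ℂ (Set.range eisGen) = ⊤ := by
  rw [← eisBasis.span_eq]
  congr 2
  exact funext fun j => (eisBasis_apply j).symm

/-- The kernel of `L` is the bottom rung, here the constants. -/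
lemma eq_smul_eisGen_zero {v : eisModule.toLieSubmodule} (h : ⁅L, v⁆ = 0) :
    ∃ c : ℂ, v = c • eisGen 0 := by
  obtain ⟨c, hc⟩ := isLadder_eisLadder.eq_apply_zero v.2 (congrArg Subtype.val h)
  exact ⟨c, Subtype.ext hc⟩

/-- The constant functions. -/
def constHom : GKHom Triv eisModule.toLieSubmodule where
  toLinearMap := (LinearMap.toSpanSingleton ℂ _ (eisGen 0)).comp
    (TrivialLieModule.equiv ℂ 𝔤 ℂ).toLinearMap
  map_lie' := by
    intro X v
    have h : ∀ c : ℂ, ⁅X, c • eisGen 0⁆ = 0 := fun c => by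
      rw [lie_smul, eq_coeff X, add_lie, add_lie, smul_lie, smul_lie, smul_lie,
        lie_H_eisGen, lie_R_eisGen_zero, lie_L_eisGen_zero]
      simp
    rw [trivial_lie_zero]
    exact (zero_smul ℂ (eisGen 0)).trans (h _).symm
  map_rho := by
    intro k v
    change (TrivialLieModule.equiv ℂ 𝔤 ℂ v) • eisGen 0 =
      GKRep.rho k ((TrivialLieModule.equiv ℂ 𝔤 ℂ v) • eisGen 0)
    rw [map_smul, mem_weightSpace_iff_chi.mp (eisGen_mem_weightSpace 0) k]
    simp

lemma constHom_symm (c : ℂ) :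
    constHom.toLieModuleHom ((TrivialLieModule.equiv ℂ 𝔤 ℂ).symm c) = c • eisGen 0 := rfl

lemma constHom_apply (c : ℂ) (g : Matrix.SpecialLinearGroup (Fin 2) ℝ) :
    (constHom.toLieModuleHom ((TrivialLieModule.equiv ℂ 𝔤 ℂ).symm c)).1.1 g = c := by
  change c * oneFn.1 g = c
  rw [oneFn_apply, mul_one]

lemma constHom_injective : Injective constHom.toLieModuleHom := by
  intro v w h
  have h1 := smul_left_injective ℂ (eisGen_ne_zero 0) h
  exact (TrivialLieModule.equiv ℂ 𝔤 ℂ).injective h1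

/-- The images of the vectors `1, Φ₂, R Φ₂, …` in `D_{1,+}`. -/
def quotVec : ℕ → DPlus 1
  | 0 => 0
  | j + 1 => DPlus.e 1 j

lemma constr_eisGen (j : ℕ) : eisBasis.constr ℂ quotVec (eisGen j) = quotVec j := by
  rw [← eisBasis_apply, Module.Basis.constr_basis]

/-- The projection of the module generated by `Φ₂` onto `D_{1,+}`. -/
def quotHom : GKHom eisModule.toLieSubmodule (DPlus 1) :=
  GKHom.ofSpan (Set.range eisGen) span_range_eisGen (eisBasis.constr ℂ quotVec)
    (by
      rintro _ ⟨j, rfl⟩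
      refine ⟨_, eisGen_mem_weightSpace j, ?_⟩
      rw [constr_eisGen]
      rcases j with _ | j
      · exact zero_mem _
      · have := DPlus.e_mem_weightSpace 1 j
        rwa [show ((1 + 1 + 2 * j : ℕ) : ℤ) = 2 * (j + 1 : ℕ) by push_cast; ring] at this)
    (by
      rintro _ ⟨j, rfl⟩
      rw [lie_H_eisGen, map_smul, constr_eisGen]
      rcases j with _ | j
      · simp [quotVec]
      · rw [quotVec, DPlus.lie_H_e]
        congr 1
        push_cast
        ring)
    (by
      rintro _ ⟨j, rfl⟩
      rcases j with _ | j
      · rw [lie_R_eisGen_zero, map_zero, constr_eisGen, quotVec, lie_zero]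
      · rw [lie_R_eisGen_succ, constr_eisGen, constr_eisGen, quotVec, quotVec, DPlus.lie_R_e])
    (by
      rintro _ ⟨j, rfl⟩
      rcases j with _ | _ | j
      · rw [lie_L_eisGen_zero, map_zero, constr_eisGen, quotVec, lie_zero]
      · rw [lie_L_eisGen_succ, map_smul, constr_eisGen, constr_eisGen, quotVec, quotVec,
          DPlus.lie_L_e_zero, smul_zero]
      · rw [lie_L_eisGen_succ, map_smul, constr_eisGen, constr_eisGen, quotVec, quotVec,
          DPlus.lie_L_e_succ, eisCoeff]
        congr 1
        push_cast
        ring)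

lemma quotHom_eisGen (j : ℕ) : quotHom.toLieModuleHom (eisGen j) = quotVec j := constr_eisGen j

/-- A linear section of the projection onto `D_{1,+}`. -/
def quotSection : DPlus 1 →ₗ[ℂ] eisModule.toLieSubmodule := DPlus.linTo fun j => eisGen (j + 1)

/-- The map `quotSection` is only linear: it does not commute with `L`, which sends `Φ₂` to a
constant. It serves to prove exactness and surjectivity. -/
lemma quotSection_quotHom (v : eisModule.toLieSubmodule) :
    v = quotSection (quotHom.toLieModuleHom v) + eisBasis.coord 0 v • eisGen 0 := by
  refine LinearMap.congr_fun (f := LinearMap.id)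
    (g := quotSection ∘ₗ quotHom.toLieModuleHom.toLinearMap +
      (eisBasis.coord 0).smulRight (eisGen 0)) (eisBasis.ext fun j => ?_) v
  change eisBasis j = quotSection (quotHom.toLieModuleHom (eisBasis j)) +
    eisBasis.coord 0 (eisBasis j) • eisGen 0
  rw [Module.Basis.coord_apply, Module.Basis.repr_self, eisBasis_apply, quotHom_eisGen]
  rcases j with _ | j
  · simp [quotVec]
  · simp [quotVec, quotSection, DPlus.linTo_e]

lemma quotHom_surjective : Surjective quotHom.toLieModuleHom := by
  intro w
  refine ⟨quotSection w, LinearMap.congr_fun (f := quotHom.toLieModuleHom.toLinearMap ∘ₗ quotSection)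
    (g := LinearMap.id) (DPlus.hom_ext 1 fun j => ?_) w⟩
  change quotHom.toLieModuleHom (quotSection (DPlus.e 1 j)) = DPlus.e 1 j
  rw [quotSection, DPlus.linTo_e, quotHom_eisGen, quotVec]

lemma exact_constHom_quotHom : Exact constHom.toLieModuleHom quotHom.toLieModuleHom := by
  intro v
  constructor
  · intro h
    refine ⟨(TrivialLieModule.equiv ℂ 𝔤 ℂ).symm (eisBasis.coord 0 v), ?_⟩
    rw [constHom_symm]
    nth_rewrite 2 [quotSection_quotHom v]
    rw [h, map_zero, zero_add]
  · rintro ⟨c, rfl⟩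
    change quotHom.toLieModuleHom ((TrivialLieModule.equiv ℂ 𝔤 ℂ c) • eisGen 0) = 0
    rw [map_smul, quotHom_eisGen, quotVec, smul_zero]

/-- A splitting would carry the lowest weight vector to a vector killed by `L`, that is, to a
constant; but the projection kills constants. -/
lemma not_exists_splitting : ¬ ∃ s : GKHom (DPlus 1) eisModule.toLieSubmodule,
    ∀ v, quotHom.toLieModuleHom (s.toLieModuleHom v) = v := by
  rintro ⟨s, hs⟩
  have h1 : ⁅L, s.toLieModuleHom (DPlus.e 1 0)⁆ = 0 := by
    rw [← LieModuleHom.map_lie, DPlus.lie_L_e_zero, map_zero]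
  obtain ⟨c, hc⟩ := eq_smul_eisGen_zero h1
  have h2 := hs (DPlus.e 1 0)
  rw [hc, map_smul, quotHom_eisGen, quotVec, smul_zero] at h2
  exact DPlus.e_ne_zero 1 0 h2.symm

end EisensteinModule

end NFin

end

noncomputable section

namespace NFin

open Function

/-! ### Generators and universal property of Verma modules. -/

section VermaModule

variable (c : ℂ)

/-- The class of `u` in the Verma module. -/
def Verma.mk (u : U) : Verma c := (Submodule.Quotient.mk u : U ⧸ vermaIdeal c)

lemma Verma.mk_surjective : Surjective (Verma.mk c) := Submodule.Quotient.mk_surjective _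

lemma Verma.smul_mk (u w : U) : u • Verma.mk c w = Verma.mk c (u * w) := rfl

lemma Verma.lie_mk (X : 𝔤) (u : U) : ⁅X, Verma.mk c u⁆ = Verma.mk c (toU X * u) := rfl

lemma Verma.lie_L_mk_one : ⁅L, Verma.mk c 1⁆ = 0 := by
  rw [Verma.lie_mk, mul_one]
  exact (Submodule.Quotient.mk_eq_zero _).mpr (Submodule.subset_span (by simp))

lemma Verma.lie_H_mk_one : ⁅H, Verma.mk c 1⁆ = c • Verma.mk c 1 := by
  have h : Verma.mk c (toU H - algebraMap ℂ U c) = 0 :=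
    (Submodule.Quotient.mk_eq_zero _).mpr (Submodule.subset_span (by simp))
  have h1 : Verma.mk c (toU H - algebraMap ℂ U c) =
      ⁅H, Verma.mk c 1⁆ - algebraMap ℂ U c • Verma.mk c 1 := by
    rw [Verma.lie_mk, Verma.smul_mk, mul_one, mul_one]
    rfl
  rw [h1, sub_eq_zero, algebraMap_smul] at h
  exact h

/-- The Verma module is spanned by the vectors `R^j v_0`. -/
lemma Verma.span_raisePow :
    Submodule.span ℂ (Set.range fun j => raisePow j (Verma.mk c 1)) = ⊤ := by
  set N := Submodule.span ℂ (Set.range fun j => raisePow j (Verma.mk c 1)) with hN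
  have hstable : ∀ (X : 𝔤), ∀ v ∈ N, ⁅X, v⁆ ∈ N := by
    refine lie_mem_span_range (fun j => lie_H_raisePow (Verma.lie_H_mk_one c) j) (fun j => ?_)
      fun j => ?_
    · rw [← raisePow_succ]
      exact Submodule.subset_span ⟨j + 1, rfl⟩
    · rcases j with _ | j
      · rw [raisePow_zero, Verma.lie_L_mk_one]; exact zero_mem _
      · rw [lie_L_raisePow_succ (Verma.lie_H_mk_one c) (by rw [Verma.lie_L_mk_one, lie_zero])]
        exact Submodule.smul_mem _ _ (Submodule.subset_span ⟨j, rfl⟩)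
  -- The elements of the enveloping algebra that preserve `N` form a subalgebra containing `𝔤`,
  -- hence everything; as `N` contains the cyclic vector, it is the whole module.
  let S : Subalgebra ℂ U :=
    { carrier := {u | ∀ v ∈ N, u • v ∈ N}
      mul_mem' := fun {a b} ha hb v hv => by rw [mul_smul]; exact ha _ (hb v hv)
      add_mem' := fun {a b} ha hb v hv => by rw [add_smul]; exact add_mem (ha v hv) (hb v hv)
      algebraMap_mem' := fun t v hv => by rw [algebraMap_smul]; exact N.smul_mem t hv }
  rw [eq_top_iff]
  intro v _
  obtain ⟨u, rfl⟩ := Verma.mk_surjective c v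
  have := mem_of_toU_mem S (fun X v hv => hstable X v hv) u (Verma.mk c 1)
    (Submodule.subset_span ⟨0, raisePow_zero _⟩)
  rwa [Verma.smul_mk, mul_one] at this

variable {c} {W : Type} [AddCommGroup W] [Module ℂ W] [LieRingModule 𝔤 W] [LieModule ℂ 𝔤 W]

lemma envelopingAction_eq_zero {w : W} (hL : ⁅L, w⁆ = 0) (hH : ⁅H, w⁆ = c • w) {u : U}
    (hu : u ∈ vermaIdeal c) : envelopingAction W u w = 0 := by
  induction hu using Submodule.span_induction with
  | mem u hu =>
    rcases hu with rfl | rfl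
    · rw [envelopingAction_toU, hL]
    · rw [map_sub, LinearMap.sub_apply, envelopingAction_toU, hH, AlgHom.commutes]
      exact sub_self _
  | zero => rw [map_zero]; rfl
  | add u u' _ _ h h' => rw [map_add, LinearMap.add_apply, h, h', add_zero]
  | smul a u _ h => rw [smul_eq_mul, map_mul, Module.End.mul_apply, h, map_zero]

/-- The universal property of the Verma module. -/
def Verma.lift (w : W) (hL : ⁅L, w⁆ = 0) (hH : ⁅H, w⁆ = c • w) : Verma c →ₗ[ℂ] W :=
  (((vermaIdeal c).restrictScalars ℂ).liftQ
    ((LinearMap.applyₗ w).comp (envelopingAction W).toLinearMap)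
      fun _ hu => envelopingAction_eq_zero hL hH hu).comp
    (Submodule.Quotient.restrictScalarsEquiv ℂ (vermaIdeal c)).symm.toLinearMap

lemma Verma.lift_mk (w : W) (hL : ⁅L, w⁆ = 0) (hH : ⁅H, w⁆ = c • w) (u : U) :
    Verma.lift w hL hH (Verma.mk c u) = envelopingAction W u w := rfl

lemma Verma.lift_lie (w : W) (hL : ⁅L, w⁆ = 0) (hH : ⁅H, w⁆ = c • w) (X : 𝔤) (v : Verma c) :
    Verma.lift w hL hH ⁅X, v⁆ = ⁅X, Verma.lift w hL hH v⁆ := by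
  obtain ⟨u, rfl⟩ := Verma.mk_surjective c v
  rw [Verma.lie_mk, Verma.lift_mk, Verma.lift_mk, map_mul, Module.End.mul_apply,
    envelopingAction_toU]

lemma mem_weightSpace_vermaDual {m : ℤ} {f : VermaDual c} (hf : f ∈ eigenH (VermaDual c) m) :
    f ∈ weightSpace (VermaDual c) m :=
  mem_weightSpace_iff_chi.mpr fun k => weightRep_apply (iSup_eigenH_weightPart _) m f hf k

end VermaModule

/-! ### The module generated by `Φ₂` as the dual of `N(0)`. -/

section DualVerma

/-- The coefficient of the constant function, as a functional on the module generated by `Φ₂`. -/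
def constCoeff : FullDual eisModule.toLieSubmodule := eisBasis.coord 0

lemma constCoeff_eisGen (j : ℕ) : constCoeff.toDual (eisGen j) = if j = 0 then 1 else 0 := by
  change eisBasis.coord 0 (eisGen j) = _
  rw [← eisBasis_apply, Module.Basis.coord_apply, Module.Basis.repr_self, Finsupp.single_apply]

lemma lie_constCoeff {X : 𝔤} (h : ∀ j, constCoeff.toDual ⁅tau X, eisGen j⁆ = 0) :
    ⁅X, constCoeff⁆ = 0 := by
  refine eisBasis.ext fun j => ?_
  rw [eisBasis_apply]
  exact h j

/-- In the twisted dual `L` acts by composition with `R`, and no vector in the image of `R` involves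
the constant function. So the functional is a lowest weight vector, to which the universal property
of `N(0)` applies. -/
lemma lie_L_constCoeff : ⁅L, constCoeff⁆ = 0 := by
  refine lie_constCoeff fun j => ?_
  rw [tau_L]
  rcases j with _ | j
  · rw [lie_R_eisGen_zero, map_zero]
  · rw [lie_R_eisGen_succ, constCoeff_eisGen, if_neg (Nat.succ_ne_zero _)]

lemma lie_H_constCoeff : ⁅H, constCoeff⁆ = (0 : ℂ) • constCoeff := by
  rw [zero_smul]
  refine lie_constCoeff fun j => ?_
  rw [tau_H, lie_H_eisGen, map_smul, constCoeff_eisGen]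
  rcases j with _ | j <;> simp

/-- The pairing of the Verma module `N(0)` with the module generated by `Φ₂`. -/
def vermaPairing : Verma 0 →ₗ[ℂ] FullDual eisModule.toLieSubmodule :=
  Verma.lift constCoeff lie_L_constCoeff lie_H_constCoeff

/-- The homomorphism from the module generated by `Φ₂` to the full dual of `N(0)`. -/
def toFullDual : eisModule.toLieSubmodule →ₗ⁅ℂ, 𝔤⁆ FullDual (Verma 0) where
  toLinearMap := LinearMap.flip
    (show Verma 0 →ₗ[ℂ] eisModule.toLieSubmodule →ₗ[ℂ] ℂ from vermaPairing)
  map_lie' := by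
    intro X v
    refine LinearMap.ext fun n => ?_
    change (vermaPairing n).toDual ⁅X, v⁆ = (vermaPairing ⁅tau X, n⁆).toDual v
    rw [vermaPairing, Verma.lift_lie, FullDual.lie_apply, tau_tau]

lemma toFullDual_apply (v : eisModule.toLieSubmodule) (n : Verma 0) :
    (toFullDual v).toDual n = (vermaPairing n).toDual v := rfl

lemma toFullDual_mk_one (v : eisModule.toLieSubmodule) :
    (toFullDual v).toDual (Verma.mk 0 1) = constCoeff.toDual v := by
  rw [toFullDual_apply, vermaPairing, Verma.lift_mk, map_one]
  rfl

/-- By local nilpotency of `L` it suffices to look at the constants, and a constant is recovered as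
its value on the generator of `N(0)`. -/
lemma toFullDual_injective : Injective toFullDual := by
  refine injective_of_locally_nilpotent (LieModule.toEnd ℂ 𝔤 eisModule.toLieSubmodule L)
    (LieModule.toEnd ℂ 𝔤 (FullDual (Verma 0)) L) toFullDual.toLinearMap
    (fun v => toFullDual.map_lie L v) (fun v => ?_) fun v hv h0 => ?_
  · obtain ⟨n, hn⟩ := isLadder_eisLadder.exists_pow_eq_zero v.2
    have h : ∀ n : ℕ, (((LieModule.toEnd ℂ 𝔤 eisModule.toLieSubmodule L ^ n) v :
        eisModule.toLieSubmodule) : SmoothFn) = (lowerEnd ^ n) v.1 := by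
      intro n
      induction n with
      | zero => rfl
      | succ n ih =>
        rw [pow_succ', pow_succ', Module.End.mul_apply, Module.End.mul_apply, ← ih]
        rfl
    exact ⟨n, Subtype.ext ((h n).trans hn)⟩
  · obtain ⟨a, rfl⟩ := eq_smul_eisGen_zero hv
    have h1 := toFullDual_mk_one (a • eisGen 0)
    rw [show toFullDual (a • eisGen 0) = 0 from h0, map_smul, constCoeff_eisGen, if_pos rfl,
      smul_eq_mul, mul_one] at h1
    have ha : a = 0 := h1.symm
    rw [ha]
    exact zero_smul ℂ (eisGen 0)

lemma toFullDual_eisGen_mem (j : ℕ) : toFullDual (eisGen j) ∈ eigenH (FullDual (Verma 0)) (2 * j) := by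
  rw [mem_eigenH, ← LieModuleHom.map_lie, lie_H_eisGen, map_smul]
  push_cast
  rfl

lemma toFullDual_mem (v : eisModule.toLieSubmodule) : toFullDual v ∈ VermaDual 0 := by
  have h : (⊤ : Submodule ℂ eisModule.toLieSubmodule) ≤
      (⨆ m : ℤ, eigenH (FullDual (Verma 0)) m).comap toFullDual.toLinearMap := by
    rw [← span_range_eisGen, Submodule.span_le]
    rintro _ ⟨j, rfl⟩
    exact Submodule.mem_iSup_of_mem (2 * j) (toFullDual_eisGen_mem j)
  exact h (Submodule.mem_top (x := v))

/-- An eigenvector of `H` in the dual of `N(0)` vanishes on the vectors of different weight. -/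
lemma apply_raisePow_eq_zero {m : ℤ} {f : FullDual (Verma 0)} (hf : f ∈ eigenH (FullDual (Verma 0)) m)
    (j : ℕ) (hj : m ≠ 2 * j) : f.toDual (raisePow j (Verma.mk 0 1)) = 0 := by
  have h1 := congrArg (fun f : FullDual (Verma 0) => f.toDual (raisePow j (Verma.mk 0 1)))
    (mem_eigenH.mp hf)
  change (⁅H, f⁆ : FullDual (Verma 0)).toDual _ = (m : ℂ) * f.toDual _ at h1
  rw [FullDual.lie_apply, tau_H, lie_H_raisePow (Verma.lie_H_mk_one 0), zero_add, map_smul,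
    smul_eq_mul] at h1
  by_contra h
  have h2 := mul_right_cancel₀ h h1
  exact hj (by exact_mod_cast h2.symm)

lemma ext_raisePow {f g : FullDual (Verma 0)}
    (h : ∀ j, f.toDual (raisePow j (Verma.mk 0 1)) = g.toDual (raisePow j (Verma.mk 0 1))) :
    f = g := by
  refine LinearMap.ext_on (Verma.span_raisePow 0) ?_
  rintro _ ⟨j, rfl⟩
  exact h j

lemma exists_toFullDual_eq {m : ℤ} {f : FullDual (Verma 0)}
    (hf : f ∈ eigenH (FullDual (Verma 0)) m) : ∃ v, toFullDual v = f := by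
  by_cases hm : ∃ i : ℕ, m = 2 * i
  · obtain ⟨i, rfl⟩ := hm
    have hne : ∀ j, j ≠ i → (2 * i : ℤ) ≠ 2 * j := fun j hj h => hj (by omega)
    have h0 : (toFullDual (eisGen i)).toDual (raisePow i (Verma.mk 0 1)) ≠ 0 := by
      intro h
      refine eisGen_ne_zero i (toFullDual_injective ?_)
      rw [map_zero]
      refine ext_raisePow fun j => ?_
      change _ = (0 : ℂ)
      by_cases hj : j = i
      · rw [hj, h]
      · exact apply_raisePow_eq_zero (toFullDual_eisGen_mem i) j (hne j hj)
    refine ⟨(f.toDual (raisePow i (Verma.mk 0 1)) /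
      (toFullDual (eisGen i)).toDual (raisePow i (Verma.mk 0 1))) • eisGen i, ?_⟩
    rw [map_smul]
    refine ext_raisePow fun j => ?_
    change _ / _ * (toFullDual (eisGen i)).toDual _ = _
    by_cases hj : j = i
    · rw [hj, div_mul_cancel₀ _ h0]
    · rw [apply_raisePow_eq_zero (toFullDual_eisGen_mem i) j (hne j hj),
        apply_raisePow_eq_zero hf j (hne j hj), mul_zero]
  · refine ⟨0, ?_⟩
    rw [map_zero]
    refine ext_raisePow fun j => ?_
    rw [apply_raisePow_eq_zero hf j fun h => hm ⟨j, h⟩]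
    rfl

/-- The module generated by `Φ₂` is the dual of the Verma module `N(0)`. -/
theorem gkIsomorphic_vermaDual : GKIsomorphic eisModule.toLieSubmodule (VermaDual 0) := by
  let T : eisModule.toLieSubmodule →ₗ[ℂ] VermaDual 0 :=
    toFullDual.toLinearMap.codRestrict (VermaDual 0).toSubmodule toFullDual_mem
  have hT : ∀ (X : 𝔤) v, T ⁅X, v⁆ = ⁅X, T v⁆ := fun X v => Subtype.ext (toFullDual.map_lie X v)
  refine ⟨GKHom.ofSpan (Set.range eisGen) span_range_eisGen T ?_ (fun v _ => hT H v)
    (fun v _ => hT R v) (fun v _ => hT L v), fun v w h => ?_, fun f => ?_⟩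
  · rintro _ ⟨j, rfl⟩
    refine ⟨_, eisGen_mem_weightSpace j, mem_weightSpace_vermaDual (mem_eigenH.mpr ?_)⟩
    rw [← hT, lie_H_eisGen, map_smul]
    push_cast
    rfl
  · exact toFullDual_injective (congrArg Subtype.val h)
  · have h : ⨆ m : ℤ, eigenH (FullDual (Verma 0)) m ≤ LinearMap.range toFullDual.toLinearMap :=
      iSup_le fun m g hg => exists_toFullDual_eq hg
    obtain ⟨v, hv⟩ := h f.2
    exact ⟨v, Subtype.ext hv⟩

end DualVerma

end NFin

end

theorem mainTheorem3 (Γ : Subgroup SL(2, ℤ)) (hΓ : CongruenceSubgroup.IsCongruenceSubgroup Γ) :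
    ∃ (A : NFin.GKSubmodule NFin.SmoothFn) (Φ₂ : NFin.SmoothFn),
      -- the `𝔫`-finite automorphic forms are a `(𝔤, K)`-module under right translation
      (∀ Φ, Φ ∈ A.toSubmodule ↔ Φ ∈ NFin.nFiniteForms Γ) ∧
      NFin.IsGKModule A.toLieSubmodule ∧
      -- the function `Φ₂` corresponds to `E₂`
      NFin.tilde 2 Φ₂.1 = NFin.E2 ∧
      (∀ g, Φ₂.1 g = NFin.slash 2 NFin.E2 g UpperHalfPlane.I) ∧
      -- the module is the direct sum of the module generated by `Φ₂` and the isotypic components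
      iSupIndep (NFin.summand A (NFin.GKSubmodule.generatedBy {Φ₂})) ∧
      ⨆ o, NFin.summand A (NFin.GKSubmodule.generatedBy {Φ₂}) o = A.toSubmodule ∧
      -- the component for `D_{ℓ-1,+}`, `ℓ = p + 1`, and its lowest weight vectors
      (∀ p : ℕ,
        FiniteDimensional ℂ (NFin.M Γ (p + 1)) ∧
        NFin.GKIsomorphic
          (⨁ _ : Fin (Module.finrank ℂ (NFin.M Γ (p + 1))), NFin.DPlus p)
          (NFin.isotypic A (NFin.DPlus p)).toLieSubmodule ∧
        (∀ Φ ∈ NFin.isotypic A (NFin.DPlus p) |>.toSubmodule,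
          ⁅NFin.L, Φ⁆ = 0 ↔ Φ ∈ NFin.weightSpace NFin.SmoothFn (p + 1)) ∧
        Set.BijOn (fun Φ : NFin.SmoothFn => NFin.tilde (p + 1) Φ.1)
          (NFin.lowestWeightVectors (NFin.isotypic A (NFin.DPlus p)))
          (Set.range fun f : NFin.M Γ (p + 1) => (f : UpperHalfPlane → ℂ)) ∧
        (∀ Φ ∈ NFin.lowestWeightVectors (NFin.isotypic A (NFin.DPlus p)), ∀ g,
          NFin.slash (p + 1) (NFin.tilde (p + 1) Φ.1) g UpperHalfPlane.I = Φ.1 g)) ∧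
      -- the exact sequence `0 → ℂ → V → D_{1,+} → 0`, which does not split
      (∃ (ι : NFin.GKHom NFin.Triv (NFin.GKSubmodule.generatedBy {Φ₂}).toLieSubmodule)
        (q : NFin.GKHom (NFin.GKSubmodule.generatedBy {Φ₂}).toLieSubmodule (NFin.DPlus 1)),
        (∀ (c : ℂ) (g : SL(2, ℝ)),
          (ι.toLieModuleHom ((TrivialLieModule.equiv ℂ NFin.𝔤 ℂ).symm c)).1.1 g = c) ∧
        Function.Injective ι.toLieModuleHom ∧
        Function.Exact ι.toLieModuleHom q.toLieModuleHom ∧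
        Function.Surjective q.toLieModuleHom ∧
        ¬ ∃ s : NFin.GKHom (NFin.DPlus 1) (NFin.GKSubmodule.generatedBy {Φ₂}).toLieSubmodule,
          ∀ v, q.toLieModuleHom (s.toLieModuleHom v) = v) ∧
      -- the module generated by `Φ₂` is isomorphic to the dual Verma module `N(0)^∨`
      NFin.GKIsomorphic (NFin.GKSubmodule.generatedBy {Φ₂}).toLieSubmodule (NFin.VermaDual 0) := by
  have : Γ.FiniteIndex := hΓ.finiteIndex
  refine ⟨NFin.nFiniteModule Γ, NFin.Phi2, NFin.mem_nFiniteModule Γ,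
    NFin.isGKModule_nFiniteModule Γ, NFin.tilde_lift 2 NFin.rsmooth_E2, fun _ => rfl, ?_⟩
  -- From here on the summands are the explicit ladders spanned by `1, Φ₂, R Φ₂, …` and by the `R^j
  -- f`.
  rw [NFin.generatedBy_Phi2, funext (NFin.summand_eq_component Γ)]
  refine ⟨NFin.iSupIndep_component Γ, (NFin.nFiniteModule_toSubmodule Γ).symm, fun p => ?_,
    ⟨NFin.constHom, NFin.quotHom, NFin.constHom_apply, NFin.constHom_injective,
      NFin.exact_constHom_quotHom, NFin.quotHom_surjective, NFin.not_exists_splitting⟩,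
    NFin.gkIsomorphic_vermaDual⟩
  have : FiniteDimensional ℂ (NFin.M Γ (p + 1)) := NFin.finiteDimensional_modularForm _ _
  refine ⟨this, NFin.gkIsomorphic_isotypic Γ p, fun Φ hΦ => ?_, NFin.bijOn_tilde Γ p,
    fun Φ hΦ g => ?_⟩
  · rw [NFin.isotypic_toSubmodule] at hΦ
    exact NFin.lie_L_eq_zero_iff_mem_weightSpace Γ p hΦ
  · obtain ⟨f, rfl⟩ := (NFin.mem_lowestWeightVectors Γ p).mp hΦ
    exact NFin.slash_tilde (NFin.modLift_mem_weightSpace f) g
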